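/- For real $B\ge 1$ let $\tau_B$ be the generalised divisor function, i.e. the multiplicative function with $\tau_B(p^e)=\frac{B(B+1)\cdots(B+e-1)}{e!}$, and put $\tau_B(0)=1$. For $x>1$ let $x_1=\exp\big(\frac{\sqrt{\log x}}{\log\log x}\big)$. Theorem. Let $A\ge 1$, $\varepsilon>0$ and let $0\le k<l\le d$ be integers. Let $H\ge H_0(A,d)$ and $$\exp\big((\log H)^{1/100}\big)\le x\le H^{1/(2d)}.$$ Let $F:\mathbb Z\to\mathbb C$ be such that (1) $|F(n)|\le\tau_B(|n|)$ for all $n\in\mathbb Z$, for some real $B\ge1$ with $200B^{2d+4}\le A$; (2) there is a set $\mathcal Q\subset[1,x^d]\cap\mathbb Z$ of prime powers with $$\sum_{q\in\mathcal Q}q^{-1/(4d)}\le C_1(\log x)^{-3(A+1)},$$ such that for every integer $1\le q\le x^d$ that is not a multiple of any element of $\mathcal Q$, $$\max_{\substack{1\le v\le q\\ \gcd(v,q)\le x_1}}\ \sup_{\substack{I\ \text{interval}\\ |I|>H^{1-\varepsilon}x^{l-k}\\ I\subset[-(d+3)Hx^d,\,(d+3)Hx^d]}}\ \frac{q}{|I|}\,\Big|\sum_{\substack{n\in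 I\\ n\equiv v\,(\mathrm{mod}\, q)}}F(n)\Big|\le C_2(\log H)^{-40Ad^2}.$$ Then for every binary form $g(X,Y)=\sum_{i=0}^d c_iX^iY^{d-i}\in\mathbb Z[X,Y]$ with $|c_i|\le H$ for all $i$ and $c_0c_d\ne0$, and for all $\alpha_{m,n}\in\mathbb C$ with $|\alpha_{m,n}|\le1$, $$\sup_{x'\in[x/2,x]}\ \sum_{\substack{a,b\in\mathbb Z\\ |a|,|b|\le H}}\Big|\sum_{1\le m,n\le x'}\alpha_{m,n}F\big(am^kn^{d-k}+bm^ln^{d-l}+g(m,n)\big)\Big|^2\le C\,H^2x^4(\log x)^{-A},$$ where $C$ depends only on $A$, $d$, $\varepsilon$, $k$, $l$, $C_1$ and $C_2$. -/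

import Mathlib

open Finset

/-- The generalised divisor function `τ_B` for real `B`: the multiplicative function with
`τ_B(p ^ e) = B (B + 1) ⋯ (B + e - 1) / e!`, so that `∑ τ_B(n) n^{-s} = ζ(s)^B`.
For a positive integer `B` it counts the factorisations of `n` into `B` ordered factors.
Here `τ_B(0) = 1`, the empty product. -/
noncomputable def tauGen (B : ℝ) (n : ℕ) : ℝ :=
  n.factorization.prod fun _ e => ∏ j ∈ range e, (B + j) / (j + 1)

/-- The gcd threshold `x₁ = exp (√(log x) / log log x)`. -/
noncomputable def gcdThreshold (x : ℝ) : ℝ :=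
  Real.exp (Real.sqrt (Real.log x) / Real.log (Real.log x))

/-- The sum of `F n` over the integers `n ≡ v (mod q)` in the real interval `[s, t]`. -/
noncomputable def progressionSum (F : ℤ → ℂ) (q v : ℕ) (s t : ℝ) : ℂ :=
  ∑ n ∈ (Icc ⌈s⌉ ⌊t⌋).filter (fun n : ℤ => n ≡ (v : ℤ) [ZMOD (q : ℤ)]), F n

/-- The value at `(m, n)` of the binary form `∑ i, c i * X ^ i * Y ^ (d - i)`. -/
def binaryForm (d : ℕ) (c : Fin (d + 1) → ℤ) (m n : ℤ) : ℤ :=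
  ∑ i : Fin (d + 1), c i * m ^ (i : ℕ) * n ^ (d - (i : ℕ))

/-- Equidistribution of `F` in progressions whose modulus `q ≤ x ^ d` is not a multiple of any
element of `Q`: for every residue `1 ≤ v ≤ q` with `gcd (v, q) ≤ x₁`, and for every interval `I`
inside `[-R, R]` of length greater than `L`, one has `(q / |I|) |∑_{n ∈ I, n ≡ v (q)} F n| ≤ δ`.
(Closed intervals give the same supremum as all intervals, since an interval contains closed
subintervals with the same integers and with length arbitrarily close to its own.) -/
def EquidistributedOutside (F : ℤ → ℂ) (Q : Finset ℕ) (d : ℕ) (x L R δ : ℝ) : Prop :=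
  ∀ q : ℕ, 1 ≤ q → (q : ℝ) ≤ x ^ d → (∀ q' ∈ Q, ¬ q' ∣ q) →
    ∀ v : ℕ, 1 ≤ v → v ≤ q → (Nat.gcd v q : ℝ) ≤ gcdThreshold x →
      ∀ s t : ℝ, -R ≤ s → s ≤ t → t ≤ R → L < t - s →
        (q : ℝ) / (t - s) * ‖progressionSum F q v s t‖ ≤ δ

/-!
Put `j = l - k`, `i = d - l` and `Λ = (log x) ^ A`. For a pair `v = (m, n)` with `γ = gcd(m, n)`,
`m = γ m'`, `n = γ n'`, the argument of `F` is `g(v) + W y`, where `W = m ^ k n ^ i γ ^ j` and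
`y = a n' ^ j + b m' ^ j`. Expanding the square removes the coefficients and leaves the correlations
`∑_{a, b} F(v) conj F(z)` of the values at two pairs `v`, `z`
(`sum_norm_sq_le_sum_norm_correlation`). The second moments of `F` bound them up to a loss of
`Λ ^ 2`, so a saving of `Λ ^ 3` is needed. It is obtained on average over `z` for all `v` outside a
set of density `O(Λ⁻⁶)`, and the parts are put together in `sum_norm_sq_formValue_le`.

*Trivial bounds.* The mean square of `τ_B` along a progression whose length is at least the square
root of its terms (`sum_sq_tauGen_progression_le`) follows from the inequality
`τ_B(n) ≤ B τ_B(e) ^ 2` for some divisor `e ≤ √n` of `n` (`exists_dvd_sq_le_tauGen_le`). Since `A` is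
large compared with `B`, all powers of logarithms from such moments cost at most `Λ ^ 2`
(`moment_product_le`). The trivial bound therefore disposes of all pairs that are not generic
(`GenericPair`), as these are few (`card_not_genericPair_le`).

*Shifts.* Translating `(a, b)` by multiples of `(z₁ ^ j, -z₂ ^ j)` fixes the argument belonging to
`z`, and moves `y` by multiples of `q_z = n' ^ j z₁ ^ j - m' ^ j z₂ ^ j`. By Cauchy–Schwarz the
correlation is bounded by the mean square of averages of `F(g + W ·)` along progressions of
difference `q_z` (`norm_correlation_le`). By Parseval, a frequency `θ` contributes to these averages
only if `q_z θ` is near an integer (`sum_sum_norm_sq_shift_le`).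

*Diophantine approximation.* If `q_z θ` is near an integer for a proportion `Λ⁻⁶` of the pairs `z`,
then `θ` is very near a fraction whose denominator `s` is at most a power of `Λ`
(`exists_major_denominator`). Lagrange interpolation of the monomial `X ^ j` at `j + 1` nearby points
gives `s`, and two far apart points sharpen the approximation (`exists_nearInt_of_dense`).

*Major arcs.* If `W s` is not a multiple of any element of `Q`, then the hypothesis on `F` for the
modulus `W s` bounds long averages of `F(g + W ·)` along progressions of difference `s`
(`norm_sum_progressionValues_le`), and these dominate the contribution of the frequencies near
fractions with denominator `s`. The residue class in question has a small gcd with the modulus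
because `gcd(g(v), W)` is controlled by `gcd(m, n)`, `gcd(c₀, m)` and `gcd(c_d, n)`
(`gcd_binaryForm_le`), which are small for generic `v` since `c₀ c_d ≠ 0`. If `W s` is a multiple of
an element `p ^ e` of `Q`, then for generic `v` at least half of this prime power divides `s`, hence
divides `q_z`, which happens for few `z` only (`minor_or_exists_nearInt`).

The saving exists once `log x` is large; for bounded `H` the assertion is trivial
(`sum_norm_sq_le_of_bounded`).
-/

/-! ### The generalised divisor function -/

/-- The value `B (B + 1) ⋯ (B + e - 1) / e!` of `τ_B` at the `e`-th power of a prime. -/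
noncomputable def tauLocal (B : ℝ) (e : ℕ) : ℝ := ∏ j ∈ range e, (B + j) / (j + 1)

lemma tauLocal_zero (B : ℝ) : tauLocal B 0 = 1 := by simp [tauLocal]

lemma tauLocal_succ (B : ℝ) (e : ℕ) :
    tauLocal B (e + 1) = tauLocal B e * ((B + e) / (e + 1)) :=
  prod_range_succ _ _

lemma tauLocal_nonneg {B : ℝ} (hB : 0 ≤ B) (e : ℕ) : 0 ≤ tauLocal B e :=
  prod_nonneg fun _ _ => by positivity

lemma tauLocal_mono_left {B C : ℝ} (hB : 0 ≤ B) (h : B ≤ C) (e : ℕ) :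
    tauLocal B e ≤ tauLocal C e :=
  prod_le_prod (fun _ _ => by positivity) fun _ _ => by gcongr

lemma one_le_tauLocal_step {B : ℝ} (hB : 1 ≤ B) (e : ℕ) : 1 ≤ (B + e) / ((e : ℝ) + 1) := by
  rw [le_div_iff₀ (by positivity)]; linarith

lemma tauLocal_mono_right {B : ℝ} (hB : 1 ≤ B) : Monotone (tauLocal B) :=
  monotone_nat_of_le_succ fun e => by
    rw [tauLocal_succ]
    exact le_mul_of_one_le_right (tauLocal_nonneg (by linarith) e) (one_le_tauLocal_step hB e)

lemma tauLocal_add_le {B : ℝ} (hB : 1 ≤ B) (a b : ℕ) :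
    tauLocal B (a + b) ≤ tauLocal B a * tauLocal B b := by
  induction b with
  | zero => simp [tauLocal_zero]
  | succ b ih =>
    rw [← add_assoc, tauLocal_succ, tauLocal_succ, ← mul_assoc]
    have h0 : 0 ≤ tauLocal B a * tauLocal B b :=
      mul_nonneg (tauLocal_nonneg (by linarith) a) (tauLocal_nonneg (by linarith) b)
    refine mul_le_mul ih ?_ (by positivity) h0
    rw [div_le_div_iff₀ (by positivity) (by positivity)]
    push_cast
    nlinarith [mul_nonneg (sub_nonneg.2 hB) (Nat.cast_nonneg (α := ℝ) a)]

lemma tauLocal_mul_tauLocal_le {B C : ℝ} (hB : 1 ≤ B) (hC : 1 ≤ C) (e : ℕ) :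
    tauLocal B e * tauLocal C e ≤ tauLocal (B * C) e := by
  rw [tauLocal, tauLocal, tauLocal, ← prod_mul_distrib]
  refine prod_le_prod (fun _ _ => by positivity) fun j _ => ?_
  rw [div_mul_div_comm, div_le_div_iff₀ (by positivity) (by positivity)]
  have h : (B + j) * (C + j) ≤ (B * C + j) * (j + 1) := by
    nlinarith [mul_nonneg (mul_nonneg (sub_nonneg.2 hB) (sub_nonneg.2 hC))
      (Nat.cast_nonneg (α := ℝ) j)]
  nlinarith [mul_le_mul_of_nonneg_right h (by positivity : (0 : ℝ) ≤ j + 1)]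

/-- The values of `τ_{B + 1}` at prime powers are the partial sums of those of `τ_B`. -/
lemma sum_range_tauLocal (B : ℝ) (e : ℕ) :
    ∑ i ∈ range (e + 1), tauLocal B i = tauLocal (B + 1) e := by
  have key : ∀ e : ℕ, tauLocal (B + 1) (e + 1) = tauLocal (B + 1) e + tauLocal B (e + 1) := by
    -- both sides are `τ_B(p ^ e)` times an elementary factor once `B * τ_{B+1} = (B + e) * τ_B`
    have aux : ∀ e : ℕ, B * tauLocal (B + 1) e = (B + e) * tauLocal B e := by
      intro e
      induction e with
      | zero => simp [tauLocal_zero]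
      | succ e ih =>
        rw [tauLocal_succ, tauLocal_succ, ← mul_assoc, ih]
        push_cast
        field_simp
        ring
    intro e
    rw [tauLocal_succ, tauLocal_succ]
    have h := aux e
    field_simp
    linear_combination h
  induction e with
  | zero => simp [tauLocal_zero]
  | succ e ih => rw [sum_range_succ, ih, key]

lemma tauGen_eq_prod (B : ℝ) {n : ℕ} {s : Finset ℕ} (hs : n.primeFactors ⊆ s) :
    tauGen B n = ∏ p ∈ s, tauLocal B (n.factorization p) := by
  rw [tauGen, Finsupp.prod_of_support_subset _ (by simpa using hs) _ (by simp)]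
  rfl

lemma tauGen_zero (B : ℝ) : tauGen B 0 = 1 := by simp [tauGen]

lemma tauGen_one (B : ℝ) : tauGen B 1 = 1 := by simp [tauGen]

lemma tauGen_prime (B : ℝ) {p : ℕ} (hp : p.Prime) : tauGen B p = B := by
  rw [tauGen_eq_prod B (s := {p}) (by simp [hp.primeFactors])]
  simp [hp.factorization, tauLocal]

lemma tauGen_nonneg {B : ℝ} (hB : 0 ≤ B) (n : ℕ) : 0 ≤ tauGen B n := by
  rw [tauGen_eq_prod B subset_rfl]
  exact prod_nonneg fun _ _ => tauLocal_nonneg hB _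

lemma one_le_tauGen {B : ℝ} (hB : 1 ≤ B) (n : ℕ) : 1 ≤ tauGen B n := by
  rw [tauGen_eq_prod B subset_rfl]
  calc (1 : ℝ) = ∏ p ∈ n.primeFactors, 1 := by simp
    _ ≤ _ := prod_le_prod (fun _ _ => zero_le_one) fun p _ =>
      (tauLocal_zero B).symm.le.trans (tauLocal_mono_right hB (Nat.zero_le _))

lemma tauGen_mono_left {B C : ℝ} (hB : 0 ≤ B) (h : B ≤ C) (n : ℕ) :
    tauGen B n ≤ tauGen C n := by
  rw [tauGen_eq_prod B subset_rfl, tauGen_eq_prod C subset_rfl]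
  exact prod_le_prod (fun _ _ => tauLocal_nonneg hB _) fun _ _ => tauLocal_mono_left hB h _

lemma tauGen_mul_le {B : ℝ} (hB : 1 ≤ B) {m n : ℕ} (hm : m ≠ 0) (hn : n ≠ 0) :
    tauGen B (m * n) ≤ tauGen B m * tauGen B n := by
  have h := Nat.primeFactors_mul hm hn
  rw [tauGen_eq_prod B subset_rfl, tauGen_eq_prod B (n := m) (s := (m * n).primeFactors)
    (by rw [h]; exact subset_union_left), tauGen_eq_prod B (n := n) (s := (m * n).primeFactors)
    (by rw [h]; exact subset_union_right), ← prod_mul_distrib]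
  refine prod_le_prod (fun _ _ => tauLocal_nonneg (by linarith) _) fun p _ => ?_
  rw [Nat.factorization_mul hm hn]
  exact tauLocal_add_le hB _ _

lemma tauGen_le_of_dvd {B : ℝ} (hB : 1 ≤ B) {m n : ℕ} (hn : n ≠ 0) (h : m ∣ n) :
    tauGen B m ≤ tauGen B n := by
  rw [tauGen_eq_prod B (Nat.primeFactors_mono h hn), tauGen_eq_prod B subset_rfl]
  refine prod_le_prod (fun _ _ => tauLocal_nonneg (by linarith) _) fun p _ => ?_
  exact tauLocal_mono_right hB ((Nat.factorization_le_iff_dvd (ne_zero_of_dvd_ne_zero hn h) hn).2 h p)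

lemma tauGen_mul_tauGen_le {B C : ℝ} (hB : 1 ≤ B) (hC : 1 ≤ C) (n : ℕ) :
    tauGen B n * tauGen C n ≤ tauGen (B * C) n := by
  rw [tauGen_eq_prod B subset_rfl, tauGen_eq_prod C subset_rfl,
    tauGen_eq_prod (B * C) subset_rfl, ← prod_mul_distrib]
  refine prod_le_prod (fun _ _ => mul_nonneg (tauLocal_nonneg (by linarith) _)
    (tauLocal_nonneg (by linarith) _)) fun p _ => tauLocal_mul_tauLocal_le hB hC _

lemma tauGen_pow_le {B : ℝ} (hB : 1 ≤ B) (n r : ℕ) : tauGen B n ^ r ≤ tauGen (B ^ r) n := by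
  induction r with
  | zero => simpa using one_le_tauGen le_rfl n
  | succ r ih =>
    rw [pow_succ, pow_succ]
    exact (mul_le_mul_of_nonneg_right ih (tauGen_nonneg (by linarith) n)).trans
      (tauGen_mul_tauGen_le (one_le_pow₀ hB) hB n)

lemma tauGen_pow_right_le {B : ℝ} (hB : 1 ≤ B) {n : ℕ} (hn : n ≠ 0) (r : ℕ) :
    tauGen B (n ^ r) ≤ tauGen B n ^ r := by
  induction r with
  | zero => simp [tauGen_one]
  | succ r ih =>
    rw [pow_succ, pow_succ]
    exact (tauGen_mul_le hB (pow_ne_zero _ hn) hn).trans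
      (mul_le_mul_of_nonneg_right ih (tauGen_nonneg (by linarith) n))

/-- `τ_B` as an arithmetic function (with value `0` at `0`). -/
noncomputable def tauArith (B : ℝ) : ArithmeticFunction ℝ :=
  ⟨fun n => if n = 0 then 0 else tauGen B n, by simp⟩

lemma tauArith_apply (B : ℝ) {n : ℕ} (hn : n ≠ 0) : tauArith B n = tauGen B n := by
  simp [tauArith, hn]

lemma isMultiplicative_tauArith (B : ℝ) : (tauArith B).IsMultiplicative := by
  rw [ArithmeticFunction.IsMultiplicative.iff_ne_zero]
  refine ⟨by simp [tauArith_apply, tauGen_one], fun {m n} hm hn hmn => ?_⟩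
  rw [tauArith_apply _ hm, tauArith_apply _ hn, tauArith_apply _ (mul_ne_zero hm hn), tauGen,
    Nat.factorization_mul_of_coprime hmn, Finsupp.prod_add_index_of_disjoint]
  · rfl
  · simpa using Nat.Coprime.disjoint_primeFactors hmn

lemma sum_divisors_tauGen (B : ℝ) {n : ℕ} (hn : n ≠ 0) :
    ∑ e ∈ n.divisors, tauGen B e = tauGen (B + 1) n := by
  have h : tauArith B * (ArithmeticFunction.zeta : ArithmeticFunction ℝ) = tauArith (B + 1) := by
    rw [ArithmeticFunction.IsMultiplicative.eq_iff_eq_on_prime_powers _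
      ((isMultiplicative_tauArith B).mul ArithmeticFunction.isMultiplicative_zeta.natCast) _
      (isMultiplicative_tauArith (B + 1))]
    intro p i hp
    have hloc : ∀ C : ℝ, ∀ i, tauGen C (p ^ i) = tauLocal C i := fun C i => by
      rw [tauGen_eq_prod C (s := {p}) fun q hq => by
        have hq' := Nat.prime_of_mem_primeFactors hq
        simp [(Nat.prime_dvd_prime_iff_eq hq' hp).1
          (hq'.dvd_of_dvd_pow (Nat.dvd_of_mem_primeFactors hq))]]
      simp [hp.factorization]
    rw [ArithmeticFunction.coe_mul_zeta_apply, Nat.sum_divisors_prime_pow hp,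
      tauArith_apply _ (pow_ne_zero _ hp.ne_zero), hloc, ← sum_range_tauLocal]
    refine sum_congr rfl fun k _ => ?_
    rw [tauArith_apply _ (pow_ne_zero _ hp.ne_zero), hloc]
  have h2 := congrArg (fun f => f n) h
  simp only [ArithmeticFunction.coe_mul_zeta_apply, tauArith_apply _ hn] at h2
  rw [← h2]
  exact sum_congr rfl fun e he => (tauArith_apply _ (Nat.pos_of_mem_divisors he).ne').symm

/-! ### Mean values of the divisor function in arithmetic progressions -/

lemma sum_Icc_inv_le {N : ℕ} : ∑ e ∈ Icc 1 N, (1 : ℝ) / e ≤ 1 + Real.log N := by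
  have h := harmonic_le_one_add_log N
  rw [harmonic_eq_sum_Icc] at h
  push_cast at h
  simpa using h

/-- Proved by induction on `K`, as `τ_{K + 1}` is the Dirichlet convolution of `τ_K` and `1`. -/
lemma sum_tauGen_div_le (K : ℕ) {N : ℕ} (hN : 1 ≤ N) :
    ∑ e ∈ Icc 1 N, tauGen K e / e ≤ (1 + Real.log N) ^ K := by
  induction K with
  | zero =>
    rw [pow_zero, sum_eq_single_of_mem 1 (by simp [hN])]
    · simp [tauGen_one]
    · intro e he he1
      obtain ⟨p, hp, hpe⟩ := Nat.exists_prime_and_dvd he1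
      have he0 : e ≠ 0 := by have := (mem_Icc.1 he).1; omega
      rw [tauGen_eq_prod _ subset_rfl, prod_eq_zero (Nat.mem_primeFactors.2 ⟨hp, hpe, he0⟩), zero_div]
      rw [tauLocal]
      refine prod_eq_zero (mem_range.2 ((hp.dvd_iff_one_le_factorization he0).1 hpe)) ?_
      simp
  | succ K ih =>
    have hfib : ∀ n ∈ Icc 1 N, tauGen ((K + 1 : ℕ) : ℝ) n / n =
        ∑ p ∈ ((Icc 1 N ×ˢ Icc 1 N).filter (fun p => p.1 * p.2 ≤ N)).filter
          (fun p => p.1 * p.2 = n), tauGen K p.1 / p.1 * (1 / p.2) := by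
      intro n hn
      obtain ⟨hn1, hn2⟩ := mem_Icc.1 hn
      have hset : ((Icc 1 N ×ˢ Icc 1 N).filter (fun p => p.1 * p.2 ≤ N)).filter
          (fun p => p.1 * p.2 = n) = n.divisorsAntidiagonal := by
        ext ⟨a, b⟩
        simp only [mem_filter, mem_product, mem_Icc, Nat.mem_divisorsAntidiagonal]
        constructor
        · rintro ⟨_, h⟩
          exact ⟨h, by omega⟩
        · rintro ⟨rfl, h⟩
          have ha : a ≠ 0 := fun h' => h (by simp [h'])
          have hb : b ≠ 0 := fun h' => h (by simp [h'])
          have h1 : a ≤ a * b := Nat.le_mul_of_pos_right a (by omega)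
          have h2 : b ≤ a * b := Nat.le_mul_of_pos_left b (by omega)
          exact ⟨⟨⟨⟨by omega, by omega⟩, ⟨by omega, by omega⟩⟩, hn2⟩, rfl⟩
      rw [hset]
      have hpt : ∀ p ∈ n.divisorsAntidiagonal,
          tauGen K p.1 / p.1 * (1 / p.2) = tauGen K p.1 / (n : ℝ) := by
        intro p hp
        rw [← (Nat.mem_divisorsAntidiagonal.1 hp).1]
        push_cast
        rw [div_mul_div_comm, mul_one]
      rw [sum_congr rfl hpt, Nat.sum_divisorsAntidiagonal (fun a _ => tauGen K a / (n : ℝ)),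
        ← sum_div, sum_divisors_tauGen _ (by omega)]
      push_cast
      rfl
    rw [sum_congr rfl hfib, sum_fiberwise_of_maps_to]
    · have hlog : 0 ≤ Real.log N := Real.log_natCast_nonneg N
      calc _ ≤ ∑ p ∈ Icc 1 N ×ˢ Icc 1 N, tauGen K p.1 / p.1 * (1 / p.2) :=
            sum_le_sum_of_subset_of_nonneg (filter_subset _ _) fun p _ _ => by
              have := tauGen_nonneg (Nat.cast_nonneg (α := ℝ) K) p.1
              positivity
        _ = (∑ e ∈ Icc 1 N, tauGen K e / e) * ∑ e ∈ Icc 1 N, (1 : ℝ) / e := by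
            rw [sum_mul_sum, sum_product]
        _ ≤ (1 + Real.log N) ^ K * (1 + Real.log N) := by
            refine mul_le_mul ih sum_Icc_inv_le ?_ (by positivity)
            exact sum_nonneg fun _ _ => by positivity
        _ = _ := (pow_succ _ _).symm
    · rintro ⟨a, b⟩ hp
      simp only [mem_filter, mem_product, mem_Icc] at hp
      exact mem_Icc.2 ⟨Nat.mul_pos (by omega) (by omega), hp.2⟩

lemma sum_tauGen_le (K : ℕ) {N : ℕ} (hN : 1 ≤ N) :
    ∑ e ∈ Icc 1 N, tauGen K e ≤ N * (1 + Real.log N) ^ K := by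
  refine le_trans ?_ (mul_le_mul_of_nonneg_left (sum_tauGen_div_le K hN) (Nat.cast_nonneg N))
  rw [mul_sum]
  refine sum_le_sum fun e he => ?_
  obtain ⟨h1, h2⟩ := mem_Icc.1 he
  have he0 : (0 : ℝ) < e := by exact_mod_cast h1
  have heN : (e : ℝ) ≤ N := by exact_mod_cast h2
  rw [mul_div_assoc', le_div_iff₀ he0, mul_comm]
  exact mul_le_mul_of_nonneg_right heN (tauGen_nonneg (Nat.cast_nonneg K) e)

/-- Every `n` has a divisor `e ≤ √n` that controls `τ_B(n)`: take `e₁` the largest divisor with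
`e₁² ≤ n`; for a prime `p ∣ n / e₁` the cofactor `n / (e₁ p)` is also at most `√n`. -/
lemma exists_dvd_sq_le_tauGen_le {B : ℝ} (hB : 1 ≤ B) {n : ℕ} (hn : n ≠ 0) :
    ∃ e, e ∣ n ∧ e ^ 2 ≤ n ∧ tauGen B n ≤ B * tauGen B e ^ 2 := by
  have hne : (n.divisors.filter (fun e => e ^ 2 ≤ n)).Nonempty :=
    ⟨1, by simp [hn]; omega⟩
  obtain ⟨e, he, hmax⟩ := exists_max_image _ id hne
  simp only [mem_filter, Nat.mem_divisors, id] at he hmax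
  obtain ⟨⟨hen, -⟩, hesq⟩ := he
  obtain ⟨r, hr⟩ := hen
  have he0 : e ≠ 0 := by rintro rfl; simp at hr; exact hn hr
  have hr0 : r ≠ 0 := by rintro rfl; simp at hr; exact hn hr
  have hB0 : (0 : ℝ) ≤ B := by linarith
  rcases eq_or_ne r 1 with rfl | hr1
  · refine ⟨e, ⟨1, hr⟩, hesq, ?_⟩
    have : n = e := by simpa using hr
    subst this
    have h1 := one_le_tauGen hB n
    nlinarith
  obtain ⟨p, hp, s, rfl⟩ := Nat.exists_prime_and_dvd hr1
  have hs0 : s ≠ 0 := by rintro rfl; simp at hr0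
  have hbig : n < (e * p) ^ 2 := by
    by_contra! hcon
    have h1 := hmax (e * p) ⟨⟨⟨s, by rw [hr, mul_assoc]⟩, hn⟩, hcon⟩
    have := hp.two_le
    nlinarith [Nat.pos_of_ne_zero he0]
  have hssq : s ^ 2 ≤ n := by
    by_contra! hcon
    have h2 : n * n < (e * p) ^ 2 * s ^ 2 := Nat.mul_lt_mul'' hbig hcon
    rw [← mul_pow, mul_assoc, ← hr, sq] at h2
    exact lt_irrefl _ h2
  have h0 : tauGen B n ≤ B * (tauGen B e * tauGen B s) := by
    rw [hr]
    have h1 := tauGen_mul_le hB he0 hr0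
    have h2 := tauGen_mul_le hB hp.ne_zero hs0
    rw [tauGen_prime B hp] at h2
    have := mul_le_mul_of_nonneg_left h2 (tauGen_nonneg hB0 e)
    linarith
  have hte := tauGen_nonneg hB0 e
  have hts := tauGen_nonneg hB0 s
  rcases le_total (tauGen B e) (tauGen B s) with h | h
  · refine ⟨s, ⟨e * p, by rw [hr]; ring⟩, hssq, h0.trans ?_⟩
    rw [sq]
    gcongr
  · refine ⟨e, ⟨p * s, hr⟩, hesq, h0.trans ?_⟩
    rw [sq]
    gcongr

/-- Second moments of `τ_B` reduce to counting multiples of small numbers `e`: only divisors up to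
the square root occur, which a progression as long as that can detect. -/
lemma tauGen_sq_le_sum {B : ℝ} (hB : 1 ≤ B) {K : ℕ} (hK : B ^ 4 ≤ K) {n M : ℕ} (hn : n ≠ 0)
    (hM : n ≤ M) :
    tauGen B n ^ 2 ≤ B ^ 2 * ∑ e ∈ (Icc 1 M.sqrt).filter (fun e => e ∣ n), tauGen K e := by
  obtain ⟨e, hen, hesq, hle⟩ := exists_dvd_sq_le_tauGen_le hB hn
  have hB0 : (0 : ℝ) ≤ B := by linarith
  calc tauGen B n ^ 2 ≤ (B * tauGen B e ^ 2) ^ 2 := by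
        gcongr
        exact tauGen_nonneg hB0 n
    _ = B ^ 2 * tauGen B e ^ 4 := by ring
    _ ≤ B ^ 2 * tauGen K e := by
        gcongr
        exact (tauGen_pow_le hB e 4).trans (tauGen_mono_left (by positivity) hK e)
    _ ≤ _ := by
        gcongr
        refine single_le_sum (f := fun e => tauGen (K : ℝ) e)
          (fun i _ => tauGen_nonneg (Nat.cast_nonneg K) i) ?_
        rw [mem_filter, mem_Icc]
        exact ⟨⟨Nat.pos_of_dvd_of_pos hen (by omega), Nat.le_sqrt'.2 (hesq.trans hM)⟩, hen⟩

lemma card_filter_modEq_le (p r v : ℤ) {e : ℕ} (he : 0 < e) :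
    (#((Icc p r).filter (fun a => a ≡ v [ZMOD e])) : ℝ) ≤ (#(Icc p r) : ℝ) / e + 1 := by
  have he' : (0 : ℝ) < e := by exact_mod_cast he
  rcases lt_or_ge r p with h | h
  · simp [Icc_eq_empty (not_le.2 h)]
  have hI : Icc p r = Ioc (p - 1) r := by ext; simp
  have h1 := Int.Ioc_filter_modEq_card (p - 1) r (r := e) (by exact_mod_cast he) v
  rw [← hI] at h1
  have h2 : (#((Icc p r).filter (fun a => a ≡ v [ZMOD e])) : ℚ) ≤ (r - p + 1) / e + 1 := by
    have h3 : ((#((Icc p r).filter (fun a => a ≡ v [ZMOD e])) : ℤ) : ℚ) ≤ (r - p + 1) / e + 1 := by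
      rw [h1]
      have he'' : (0 : ℚ) < e := by exact_mod_cast he
      push_cast
      apply max_le
      · have a1 := Int.floor_le (((r : ℚ) - v) / e)
        have a2 := Int.lt_floor_add_one ((((p - 1 : ℤ) : ℚ) - v) / e)
        have a3 : ((r : ℚ) - v) / e - (((p - 1 : ℤ) : ℚ) - v) / e = (r - p + 1) / e := by
          push_cast; ring
        push_cast at a1 a2 a3 ⊢
        linarith
      · have : (p : ℚ) ≤ r := by exact_mod_cast h
        have : 0 ≤ ((r : ℚ) - p + 1) / e := div_nonneg (by linarith) he''.le
        linarith
    exact_mod_cast h3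
  have h4 : (#(Icc p r) : ℝ) = r - p + 1 := by
    rw [Int.card_Icc]
    have : (((r + 1 - p).toNat : ℤ) : ℝ) = ((r + 1 - p : ℤ) : ℝ) := by
      rw [Int.toNat_of_nonneg (by omega)]
    push_cast at this
    rw [this]
    ring
  rw [h4]
  exact_mod_cast h2

/-- If `X` and `w` are coprime, then `e ∣ a X + w` forces `e` to be coprime to `X`, so that `a` lies
in a single class modulo `e`. -/
lemma card_filter_dvd_linear_le (p r : ℤ) {e : ℕ} (he : 0 < e) {X w : ℤ} (hXw : IsCoprime X w) :
    (#((Icc p r).filter (fun a => (e : ℤ) ∣ a * X + w)) : ℝ) ≤ (#(Icc p r) : ℝ) / e + 1 := by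
  rcases ((Icc p r).filter (fun a => (e : ℤ) ∣ a * X + w)).eq_empty_or_nonempty with h | ⟨a₀, h₀⟩
  · rw [h]
    simp
    positivity
  · refine le_trans ?_ (card_filter_modEq_le p r a₀ he)
    have h₀' := (mem_filter.1 h₀).2
    have hcop : IsCoprime (e : ℤ) X := by
      obtain ⟨c, hc⟩ := h₀'
      obtain ⟨s, t, hst⟩ := hXw
      exact ⟨t * c, s - t * a₀, by linear_combination hst - t * hc⟩
    gcongr with a ha
    intro hd
    have h3 : (e : ℤ) ∣ (a₀ - a) * X := by
      rw [show (a₀ - a) * X = a₀ * X + w - (a * X + w) by ring]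
      exact dvd_sub h₀' hd
    exact (Int.modEq_iff_dvd).2 (hcop.dvd_of_dvd_mul_right h3)

/-- The mean square of `τ_B` along an arithmetic progression `a X + w` whose length is at least the
square root of its largest term. The factor `τ_B(X)²` accounts for `gcd(X, w)`. -/
lemma sum_sq_tauGen_progression_le {B : ℝ} (hB : 1 ≤ B) {K : ℕ} (hK : B ^ 4 ≤ K) {X : ℕ}
    (hX : X ≠ 0) (w p r : ℤ) {M : ℕ} (hM : 1 ≤ M)
    (hle : ∀ a ∈ Icc p r, (a * X + w).natAbs ≤ M) (hlen : M ≤ #(Icc p r) ^ 2) :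
    ∑ a ∈ Icc p r, tauGen B (a * X + w).natAbs ^ 2 ≤
      3 * B ^ 2 * tauGen B X ^ 2 * #(Icc p r) * (1 + Real.log M) ^ K := by
  have hB0 : (0 : ℝ) ≤ B := by linarith
  set J := Icc p r with hJ
  have hJ1 : (1 : ℝ) ≤ #J := by
    have : 1 ≤ #J := by
      by_contra! h
      have : #J = 0 := by omega
      rw [this] at hlen
      omega
    exact_mod_cast this
  obtain ⟨h, X1, w1, hh, hcop, hX1, hw1⟩ : ∃ (h : ℕ) (X1 w1 : ℤ), h ≠ 0 ∧ IsCoprime X1 w1 ∧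
      (X : ℤ) = h * X1 ∧ w = h * w1 := by
    have hg : 0 < Int.gcd (X : ℤ) w := Int.gcd_pos_of_ne_zero_left _ (by exact_mod_cast hX)
    refine ⟨Int.gcd X w, X / Int.gcd X w, w / Int.gcd X w, hg.ne', ?_, ?_, ?_⟩
    · rw [Int.isCoprime_iff_gcd_eq_one]
      exact Int.gcd_ediv_gcd_ediv_gcd hg
    · exact (Int.mul_ediv_cancel' (Int.gcd_dvd_left ..)).symm
    · exact (Int.mul_ediv_cancel' (Int.gcd_dvd_right ..)).symm
  have hX1' : X1 ≠ 0 := by rintro rfl; simp at hX1; exact hX hX1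
  have hhX : h ∣ X := by exact_mod_cast Dvd.intro _ hX1.symm
  have hn : ∀ a : ℤ, (a * X + w).natAbs = h * (a * X1 + w1).natAbs := fun a => by
    rw [hX1, hw1, show a * (h * X1) + h * w1 = h * (a * X1 + w1) by ring, Int.natAbs_mul,
      Int.natAbs_natCast]
  have hpt : ∀ a ∈ J, tauGen B (a * X + w).natAbs ^ 2 ≤ (if a * X1 + w1 = 0 then 1 else 0) +
      tauGen B X ^ 2 * (B ^ 2 * ∑ e ∈ Icc 1 M.sqrt,
        if (e : ℤ) ∣ a * X1 + w1 then tauGen K e else 0) := by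
    intro a ha
    have hnn : 0 ≤ ∑ e ∈ Icc 1 M.sqrt, if (e : ℤ) ∣ a * X1 + w1 then tauGen K e else 0 :=
      sum_nonneg fun e _ => by
        split_ifs
        · exact tauGen_nonneg (Nat.cast_nonneg K) e
        · exact le_rfl
    split_ifs with h0
    · have h1 : tauGen B (a * X + w).natAbs ^ 2 = 1 := by
        rw [hn, h0]
        simp [tauGen_zero]
      rw [h1]
      have : 0 ≤ tauGen B X ^ 2 * (B ^ 2 * ∑ e ∈ Icc 1 M.sqrt,
        if (e : ℤ) ∣ a * X1 + w1 then tauGen K e else 0) := by positivity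
      linarith
    · have hne : (a * X1 + w1).natAbs ≠ 0 := by simpa using h0
      have hM' : (a * X1 + w1).natAbs ≤ M :=
        (Nat.le_mul_of_pos_left _ (Nat.pos_of_ne_zero hh)).trans ((hn a).symm.le.trans (hle a ha))
      rw [zero_add, hn]
      calc tauGen B (h * (a * X1 + w1).natAbs) ^ 2
          ≤ (tauGen B h * tauGen B (a * X1 + w1).natAbs) ^ 2 := by
            gcongr
            · exact tauGen_nonneg hB0 _
            · exact tauGen_mul_le hB hh hne
        _ = tauGen B h ^ 2 * tauGen B (a * X1 + w1).natAbs ^ 2 := mul_pow _ _ _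
        _ ≤ _ := by
            gcongr
            · exact tauGen_nonneg hB0 _
            · exact tauGen_le_of_dvd hB hX hhX
            · have := tauGen_sq_le_sum hB hK hne hM'
              rw [sum_filter] at this
              simpa only [Int.natCast_dvd] using this
  refine (sum_le_sum hpt).trans ?_
  rw [sum_add_distrib, ← mul_sum, ← mul_sum, sum_comm]
  have hfirst : ∑ a ∈ J, (if a * X1 + w1 = 0 then (1 : ℝ) else 0) ≤ 1 := by
    rw [sum_boole]
    have : #(J.filter (fun a => a * X1 + w1 = 0)) ≤ 1 := by
      rw [card_le_one]
      intro a ha b hb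
      have h1 := (mem_filter.1 ha).2
      have h2 := (mem_filter.1 hb).2
      exact mul_right_cancel₀ hX1' (by linarith)
    exact_mod_cast this
  have hM1 : 1 ≤ M.sqrt := Nat.le_sqrt.2 (by omega)
  have hlog : Real.log M.sqrt ≤ Real.log M :=
    Real.log_le_log (by exact_mod_cast hM1) (by exact_mod_cast Nat.sqrt_le_self M)
  have hlog0 : 0 ≤ Real.log M.sqrt := Real.log_natCast_nonneg _
  have hsecond : ∑ e ∈ Icc 1 M.sqrt, ∑ a ∈ J,
      (if (e : ℤ) ∣ a * X1 + w1 then tauGen K e else 0) ≤ 2 * #J * (1 + Real.log M) ^ K := by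
    calc _ ≤ ∑ e ∈ Icc 1 M.sqrt, 2 * #J * (tauGen K e / e) := by
          refine sum_le_sum fun e he => ?_
          obtain ⟨he1, he2⟩ := mem_Icc.1 he
          have hτ := tauGen_nonneg (Nat.cast_nonneg (α := ℝ) K) e
          have he0 : (0 : ℝ) < e := by exact_mod_cast he1
          rw [← sum_filter, sum_const, nsmul_eq_mul]
          have hc := card_filter_dvd_linear_le p r he1 hcop
          have heJ : (e : ℝ) ≤ #J := by
            have : e ^ 2 ≤ #J ^ 2 := (Nat.le_sqrt'.1 he2).trans hlen
            exact_mod_cast (Nat.pow_le_pow_iff_left two_ne_zero).1 this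
          have h1 : (1 : ℝ) ≤ #J / e := (one_le_div he0).2 heJ
          calc _ ≤ (#J / e + 1) * tauGen K e := by gcongr
            _ ≤ (#J / e + #J / e) * tauGen K e := by gcongr
            _ = _ := by ring
      _ = 2 * #J * ∑ e ∈ Icc 1 M.sqrt, tauGen K e / e := (mul_sum _ _ _).symm
      _ ≤ 2 * #J * (1 + Real.log M.sqrt) ^ K := by gcongr; exact sum_tauGen_div_le K hM1
      _ ≤ _ := by gcongr
  have hX2 : 1 ≤ tauGen B X := one_le_tauGen hB X
  have hP : (1 : ℝ) ≤ (1 + Real.log M) ^ K := one_le_pow₀ (by linarith)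
  have hone : (1 : ℝ) ≤ B ^ 2 * tauGen B X ^ 2 * #J * (1 + Real.log M) ^ K := by
    have a1 : (1 : ℝ) ≤ B ^ 2 := one_le_pow₀ hB
    have a2 : (1 : ℝ) ≤ tauGen B X ^ 2 := one_le_pow₀ hX2
    exact one_le_mul_of_one_le_of_one_le (one_le_mul_of_one_le_of_one_le
      (one_le_mul_of_one_le_of_one_le a1 a2) hJ1) hP
  calc _ ≤ 1 + tauGen B X ^ 2 * (B ^ 2 * (2 * #J * (1 + Real.log M) ^ K)) := by gcongr
    _ ≤ _ := by linarith

/-! ### Diophantine approximation of monomials -/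

/-- The real number `ψ` lies within `δ` of an integer. -/
def NearInt (ψ δ : ℝ) : Prop := ∃ r : ℤ, |ψ - r| ≤ δ

lemma NearInt.mono {ψ δ δ' : ℝ} (h : NearInt ψ δ) (hδ : δ ≤ δ') : NearInt ψ δ' :=
  h.imp fun _ hr => hr.trans hδ

lemma NearInt.mul_nat {ψ δ : ℝ} (h : NearInt ψ δ) (s : ℕ) : NearInt (s * ψ) (s * δ) := by
  obtain ⟨r, hr⟩ := h
  refine ⟨s * r, ?_⟩
  push_cast
  rw [← mul_sub, abs_mul, Nat.abs_cast]
  gcongr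

lemma NearInt.neg {ψ δ : ℝ} (h : NearInt ψ δ) : NearInt (-ψ) δ := by
  obtain ⟨r, hr⟩ := h
  refine ⟨-r, ?_⟩
  push_cast
  rwa [← neg_sub', abs_neg]

/-- The denominator `∏ (i - k)` attached to the node `i` in Lagrange interpolation. -/
def nodeProd (S : Finset ℕ) (i : ℕ) : ℤ := ∏ k ∈ S.erase i, ((i : ℤ) - k)

lemma nodeProd_ne_zero (S : Finset ℕ) (i : ℕ) : nodeProd S i ≠ 0 := by
  refine prod_ne_zero_iff.2 fun k hk => ?_
  have := (mem_erase.1 hk).1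
  omega

/-- Lagrange interpolation for the coefficient of `X ^ j`. -/
lemma sum_eval_div_nodeProd {S : Finset ℕ} {j : ℕ} (hS : #S = j + 1) (P : Polynomial ℚ)
    (hP : P.natDegree ≤ j) : ∑ i ∈ S, P.eval (i : ℚ) / nodeProd S i = P.coeff j := by
  have hinj : Set.InjOn (fun i : ℕ => (i : ℚ)) S := Nat.cast_injective.injOn
  have h := Lagrange.coeff_eq_sum hinj (P := P) (by
    rw [hS]
    exact (Polynomial.degree_le_natDegree).trans_lt (by exact_mod_cast Nat.lt_succ_of_le hP))
  rw [hS, Nat.add_sub_cancel] at h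
  rw [h]
  refine sum_congr rfl fun i _ => ?_
  rw [nodeProd]
  push_cast
  rfl

lemma abs_nodeProd_le {S : Finset ℕ} {j w : ℕ} (hS : #S = j + 1)
    (hw : ∀ a ∈ S, ∀ b ∈ S, a ≤ b + w) {i : ℕ} (hi : i ∈ S) : |nodeProd S i| ≤ (w : ℤ) ^ j := by
  rw [nodeProd, abs_prod]
  have hc : #(S.erase i) = j := by rw [card_erase_of_mem hi, hS]; rfl
  rw [← hc, ← prod_const]
  refine prod_le_prod (fun _ _ => abs_nonneg _) fun k hk => ?_
  have hk' := (mem_erase.1 hk).2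
  have h1 := hw i hi k hk'
  have h2 := hw k hk' i hi
  rw [abs_le]
  constructor <;> omega

/-- Clearing denominators in the interpolation formula for `X ^ j` and for the constant `1`. -/
lemma exists_interpolation_weights {S : Finset ℕ} {j w : ℕ} (hj : 1 ≤ j) (hS : #S = j + 1)
    (hw : ∀ a ∈ S, ∀ b ∈ S, a ≤ b + w) :
    ∃ (s : ℕ) (c : ℕ → ℤ), 1 ≤ s ∧ s ≤ w ^ (j * (j + 1)) ∧ ∑ i ∈ S, c i * (i : ℤ) ^ j = s ∧
      ∑ i ∈ S, c i = 0 ∧ ∀ i ∈ S, |c i| ≤ s := by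
  set P : ℤ := ∏ i ∈ S, nodeProd S i with hP
  have hP0 : P ≠ 0 := prod_ne_zero_iff.2 fun i _ => nodeProd_ne_zero S i
  have hdvd : ∀ i ∈ S, nodeProd S i ∣ |P| := fun i hi =>
    (dvd_abs _ _).2 (dvd_prod_of_mem _ hi)
  have hcast : ∀ i ∈ S, ((|P| / nodeProd S i : ℤ) : ℚ) = (|P| : ℤ) / (nodeProd S i : ℚ) :=
    fun i hi => Int.cast_div (hdvd i hi) (by exact_mod_cast nodeProd_ne_zero S i)
  have hs : ((P.natAbs : ℕ) : ℤ) = |P| := Int.natCast_natAbs P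
  refine ⟨P.natAbs, fun i => |P| / nodeProd S i, Int.natAbs_pos.2 hP0, ?_, ?_, ?_, ?_⟩
  · have : |P| ≤ (w : ℤ) ^ (j * (j + 1)) := by
      rw [hP, abs_prod, pow_mul, ← hS, ← prod_const]
      exact prod_le_prod (fun _ _ => abs_nonneg _) fun i hi => abs_nodeProd_le hS hw hi
    rw [← hs] at this
    exact_mod_cast this
  · have h := sum_eval_div_nodeProd hS (Polynomial.X ^ j) (by simp)
    simp only [Polynomial.eval_pow, Polynomial.eval_X, Polynomial.coeff_X_pow, if_true] at h
    have h2 : ((∑ i ∈ S, |P| / nodeProd S i * (i : ℤ) ^ j : ℤ) : ℚ) = ((|P| : ℤ) : ℚ) := by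
      push_cast
      rw [← mul_one (|(P : ℚ)|), ← h, mul_sum]
      refine sum_congr rfl fun i hi => ?_
      rw [hcast i hi]
      push_cast
      ring
    rw [hs]
    exact_mod_cast h2
  · have h := sum_eval_div_nodeProd hS (Polynomial.C 1) (by simp)
    rw [Polynomial.coeff_C_of_ne_zero (by omega)] at h
    simp only [Polynomial.eval_C] at h
    have h2 : ((∑ i ∈ S, |P| / nodeProd S i : ℤ) : ℚ) = 0 := by
      push_cast
      rw [← mul_zero (|(P : ℚ)|), ← h, mul_sum]
      refine sum_congr rfl fun i hi => ?_
      rw [hcast i hi]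
      push_cast
      ring
    exact_mod_cast h2
  · intro i hi
    rw [hs]
    obtain ⟨t, ht⟩ := hdvd i hi
    have h1 : |P| / nodeProd S i = t := by
      rw [ht, Int.mul_ediv_cancel_left _ (nodeProd_ne_zero S i)]
    change |(|P| / nodeProd S i)| ≤ |P|
    rw [h1, ← abs_abs P, ht, abs_mul]
    exact le_mul_of_one_le_left (abs_nonneg _) (Int.one_le_abs (nodeProd_ne_zero S i))

/-- A dense subset of `[1, N]` has `J + 1` elements in some window of length `w`. -/
lemma exists_subset_window {N J w : ℕ} {M : Finset ℕ} (hM : M ⊆ Icc 1 N) (hw : 1 ≤ w)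
    (hcard : J * (N / w + 1) < #M) :
    ∃ S ⊆ M, #S = J + 1 ∧ ∀ a ∈ S, ∀ b ∈ S, a ≤ b + (w - 1) := by
  obtain ⟨y, -, hy⟩ := exists_lt_card_fiber_of_mul_lt_card_of_maps_to (s := M)
    (t := range (N / w + 1)) (f := fun m => m / w) (n := J)
    (fun m hm => mem_range.2 (Nat.lt_succ_of_le (Nat.div_le_div_right (mem_Icc.1 (hM hm)).2)))
    (by rwa [card_range, mul_comm])
  obtain ⟨S, hS, hSc⟩ := exists_subset_card_eq (Nat.succ_le_of_lt hy)
  refine ⟨S, fun m hm => (mem_filter.1 (hS hm)).1, hSc, fun a ha b hb => ?_⟩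
  have h1 := (mem_filter.1 (hS ha)).2
  have h2 := (mem_filter.1 (hS hb)).2
  have e1 := Nat.div_add_mod a w
  have e2 := Nat.div_add_mod b w
  have e3 := Nat.mod_lt a hw
  rw [h1] at e1
  rw [h2] at e2
  omega

/-- If `φ m ^ j + c` is within `δ` of an integer for a dense set of `m ≤ N`, then some small
multiple `s φ` is within about `δ / N ^ j` of an integer. Interpolation at `j + 1` nearby points
gives `s` with `s φ` near an integer; two far apart points then sharpen the approximation. -/
lemma exists_nearInt_of_dense {N j w₁ w₂ J : ℕ} (hj : 1 ≤ j) {M : Finset ℕ} (hM : M ⊆ Icc 1 N)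
    {φ c δ : ℝ} (hδ : 0 ≤ δ) (hnear : ∀ m ∈ M, NearInt (φ * m ^ j + c) δ)
    (hw₁ : 1 ≤ w₁) (h₁ : j * (N / w₁ + 1) < #M) (hJ : 1 ≤ J) (hw₂ : 1 ≤ w₂)
    (h₂ : J * (N / w₂ + 1) < #M)
    (hsmall : (w₁ : ℝ) ^ (j * (j + 1)) * δ * ((j + 1) * (j * N ^ (j - 1) * w₂) + 2) < 1) :
    ∃ s : ℕ, 1 ≤ s ∧ s ≤ w₁ ^ (j * (j + 1)) ∧
      NearInt (s * φ) (2 * w₁ ^ (j * (j + 1)) * δ / J ^ j) := by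
  obtain ⟨S, hSM, hSc, hSw⟩ := exists_subset_window hM hw₁ h₁
  obtain ⟨s, co, hs1, hsle, hco1, hco0, hcole⟩ := exists_interpolation_weights hj hSc hSw
  have hsle' : s ≤ w₁ ^ (j * (j + 1)) :=
    hsle.trans (Nat.pow_le_pow_left (Nat.sub_le _ _) _)
  have hsR : (s : ℝ) ≤ (w₁ : ℝ) ^ (j * (j + 1)) := by exact_mod_cast hsle'
  set U : ℝ := (w₁ : ℝ) ^ (j * (j + 1)) with hU
  have hs0 : (0 : ℝ) < s := by exact_mod_cast hs1
  have hU0 : 0 < U := hs0.trans_le hsR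
  refine ⟨s, hs1, hsle', ?_⟩
  choose! ρ hρ using hnear
  -- interpolation gives a first approximation to `s φ`
  obtain ⟨r, hr⟩ : ∃ r : ℤ, |s * φ - r| ≤ (j + 1) * (s * δ) := by
    refine ⟨∑ i ∈ S, co i * ρ i, ?_⟩
    have e1 : (s : ℝ) * φ = ∑ i ∈ S, (co i : ℝ) * (φ * (i : ℝ) ^ j + c) := by
      have a1 : (s : ℝ) = ∑ i ∈ S, (co i : ℝ) * (i : ℝ) ^ j := by exact_mod_cast hco1.symm
      have a2 : (0 : ℝ) = ∑ i ∈ S, (co i : ℝ) := by exact_mod_cast hco0.symm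
      have a3 : (s : ℝ) * φ = (∑ i ∈ S, (co i : ℝ) * (i : ℝ) ^ j) * φ +
          (∑ i ∈ S, (co i : ℝ)) * c := by rw [← a1, ← a2]; ring
      rw [a3, sum_mul, sum_mul, ← sum_add_distrib]
      exact sum_congr rfl fun i _ => by ring
    rw [e1]
    push_cast
    rw [← sum_sub_distrib]
    refine (abs_sum_le_sum_abs _ _).trans ?_
    have : ∀ i ∈ S, |(co i : ℝ) * (φ * (i : ℝ) ^ j + c) - co i * ρ i| ≤ s * δ := fun i hi => by
      rw [← mul_sub, abs_mul]
      have h1 : |(co i : ℝ)| ≤ s := by exact_mod_cast hcole i hi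
      exact mul_le_mul h1 (hρ i (hSM hi)) (abs_nonneg _) hs0.le
    refine (sum_le_sum this).trans ?_
    rw [sum_const, hSc, nsmul_eq_mul]
    push_cast
    exact le_rfl
  -- two far apart points in a window
  obtain ⟨S', hS'M, hS'c, hS'w⟩ := exists_subset_window hM hw₂ h₂
  have hne : S'.Nonempty := card_pos.1 (by omega)
  set y := S'.min' hne
  set z := S'.max' hne
  have hy : y ∈ S' := min'_mem _ _
  have hz : z ∈ S' := max'_mem _ _
  have hyz : y + J ≤ z := by
    have hsub : S' ⊆ Icc y z := fun i hi => mem_Icc.2 ⟨min'_le _ _ hi, le_max' _ _ hi⟩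
    have := card_le_card hsub
    rw [hS'c, Nat.card_Icc] at this
    omega
  have hzw : z ≤ y + w₂ := (hS'w z hz y hy).trans (by omega)
  have hzN : z ≤ N := (mem_Icc.1 (hM (hS'M hz))).2
  set D : ℤ := (z : ℤ) ^ j - (y : ℤ) ^ j with hD
  have hDlow : (J : ℝ) ^ j ≤ D := by
    have h := pow_add_pow_le (R := ℝ) (x := y) (y := (z : ℝ) - y) (n := j) (by positivity)
      (by have : (y : ℝ) + J ≤ z := by exact_mod_cast hyz
          have : (0 : ℝ) ≤ J := by positivity
          linarith) (by omega)
    have h' : (J : ℝ) ^ j ≤ ((z : ℝ) - y) ^ j := by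
      gcongr
      have : (y : ℝ) + J ≤ z := by exact_mod_cast hyz
      linarith
    rw [hD]
    push_cast
    have e : (y : ℝ) + (z - y) = z := by ring
    rw [e] at h
    linarith
  have hJ0 : (0 : ℝ) < (J : ℝ) ^ j := by
    have : (0 : ℝ) < J := by exact_mod_cast hJ
    positivity
  have hD0 : (0 : ℝ) < D := hJ0.trans_le hDlow
  have hDup : (D : ℝ) ≤ j * (N : ℝ) ^ (j - 1) * w₂ := by
    have h := (le_abs_self _).trans (abs_pow_sub_pow_le (z : ℝ) (y : ℝ) j)
    have hyN : (y : ℝ) ≤ N := by exact_mod_cast (show y ≤ N by omega)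
    have hzN' : (z : ℝ) ≤ N := by exact_mod_cast hzN
    have hd : |(z : ℝ) - y| ≤ w₂ := by
      rw [abs_le]
      have a1 : (y : ℝ) + J ≤ z := by exact_mod_cast hyz
      have a2 : (z : ℝ) ≤ y + w₂ := by exact_mod_cast hzw
      have a3 : (0 : ℝ) ≤ J := by positivity
      constructor <;> linarith
    have hm : max |(z : ℝ)| |(y : ℝ)| ≤ N := by
      rw [Nat.abs_cast, Nat.abs_cast]
      exact max_le hzN' hyN
    rw [hD]
    push_cast
    calc _ ≤ _ := h
      _ ≤ (w₂ : ℝ) * j * (N : ℝ) ^ (j - 1) := by gcongr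
      _ = _ := by ring
  have hz' := hρ z (hS'M hz)
  have hy' := hρ y (hS'M hy)
  set β : ℝ := s * φ - r with hβ
  set ε : ℝ := (φ * (z : ℝ) ^ j + c - ρ z) - (φ * (y : ℝ) ^ j + c - ρ y) with hε
  have hεle : |ε| ≤ 2 * δ := (abs_sub _ _).trans (by linarith)
  have hid : β * D - s * ε = ((s * (ρ z - ρ y) - r * D : ℤ) : ℝ) := by
    rw [hβ, hε, hD]
    push_cast
    ring
  -- an integer of absolute value less than `1`, so that the error `β` is in fact `s ε / D`
  have hzero : s * (ρ z - ρ y) - r * D = 0 := by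
    rw [← Int.abs_lt_one_iff]
    have hlt : |β * D - s * ε| < 1 := by
      calc |β * D - s * ε| ≤ |β * D| + |s * ε| := abs_sub _ _
        _ = |β| * D + s * |ε| := by rw [abs_mul, abs_mul, abs_of_pos hD0, Nat.abs_cast]
        _ ≤ ((j + 1) * (U * δ)) * (j * (N : ℝ) ^ (j - 1) * w₂) + U * (2 * δ) := by
            have : |β| ≤ (j + 1) * (U * δ) := hr.trans (by gcongr)
            gcongr
        _ = U * δ * ((j + 1) * (j * N ^ (j - 1) * w₂) + 2) := by ring
        _ < 1 := hsmall
    rw [hid] at hlt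
    exact_mod_cast hlt
  rw [hzero, Int.cast_zero, sub_eq_zero] at hid
  refine ⟨r, ?_⟩
  rw [le_div_iff₀ hJ0]
  calc |s * φ - r| * (J : ℝ) ^ j ≤ |β| * D := by gcongr
    _ = |β * D| := by rw [abs_mul, abs_of_pos hD0]
    _ = s * |ε| := by rw [hid, abs_mul, Nat.abs_cast]
    _ ≤ U * (2 * δ) := by gcongr
    _ = 2 * U * δ := by ring

/-- If `ψ a` and `ψ b` are within `ε` of integers `r` and `t`, then `r b = t a`. By coprimality `a ∣
r` and `b ∣ t`, and dividing by the larger of `a` and `b` gives the approximation to `ψ`. -/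
lemma nearInt_of_coprime_mul {a b : ℕ} (ha : 1 ≤ a) (hb : 1 ≤ b) (hab : Nat.Coprime a b)
    {ψ ε : ℝ} (h1 : NearInt (ψ * a) ε) (h2 : NearInt (ψ * b) ε) (hε : ε * (a + b) < 1) :
    NearInt ψ (ε / max a b) := by
  obtain ⟨r, hr⟩ := h1
  obtain ⟨t, ht⟩ := h2
  have ha0 : (0 : ℝ) < a := by exact_mod_cast ha
  have hb0 : (0 : ℝ) < b := by exact_mod_cast hb
  have hid : r * b = t * a := by
    rw [← sub_eq_zero, ← Int.abs_lt_one_iff]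
    have : |((r * b - t * a : ℤ) : ℝ)| < 1 := by
      have e : ((r * b - t * a : ℤ) : ℝ) = (ψ * b - t) * a - (ψ * a - r) * b := by
        push_cast; ring
      rw [e]
      calc _ ≤ |(ψ * b - t) * a| + |(ψ * a - r) * b| := abs_sub _ _
        _ = |ψ * b - t| * a + |ψ * a - r| * b := by
            rw [abs_mul, abs_mul, abs_of_pos ha0, abs_of_pos hb0]
        _ ≤ ε * a + ε * b := by gcongr
        _ < 1 := by linarith
    exact_mod_cast this
  have hcop : IsCoprime (a : ℤ) (b : ℤ) := Nat.isCoprime_iff_coprime.2 hab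
  obtain ⟨q, hq⟩ : (a : ℤ) ∣ r := hcop.dvd_of_dvd_mul_right ⟨t, by rw [hid]; ring⟩
  have hqt : t = b * q := by
    have : (a : ℤ) ≠ 0 := by exact_mod_cast ha0.ne'
    refine mul_left_cancel₀ this ?_
    rw [mul_comm _ t, ← hid, hq]
    ring
  refine ⟨q, ?_⟩
  rw [le_div_iff₀ (by positivity)]
  rcases le_total a b with h | h
  · rw [max_eq_right (by exact_mod_cast h)]
    rw [hqt] at ht
    calc |ψ - q| * b = |ψ * b - (b * q : ℤ)| := by
          rw [← abs_of_pos hb0, ← abs_mul, abs_of_pos hb0]; push_cast; ring_nf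
      _ ≤ ε := ht
  · rw [max_eq_left (by exact_mod_cast h)]
    rw [hq] at hr
    calc |ψ - q| * a = |ψ * a - (a * q : ℤ)| := by
          rw [← abs_of_pos ha0, ← abs_mul, abs_of_pos ha0]; push_cast; ring_nf
      _ ≤ ε := hr

/-- If `θ (a m ^ j - b n ^ j)` is close to an integer for many pairs `(m, n)`, with `a` and `b`
coprime, then `θ` is very close to a rational with small denominator. -/
lemma exists_nearInt_of_dense_pairs {N j w₁ w₂ J a b L : ℕ} (hj : 1 ≤ j) (ha : 1 ≤ a)
    (hb : 1 ≤ b) (hab : Nat.Coprime a b) {Z : Finset (ℕ × ℕ)} (hZ : Z ⊆ Icc 1 N ×ˢ Icc 1 N)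
    {θ δ : ℝ} (hδ : 0 ≤ δ)
    (hnear : ∀ z ∈ Z, NearInt (θ * (a * (z.1 : ℝ) ^ j - b * (z.2 : ℝ) ^ j)) δ)
    (hL : N * L < #Z) (hw₁ : 1 ≤ w₁) (h₁ : j * (N / w₁ + 1) ≤ L) (hJ : 1 ≤ J)
    (hw₂ : 1 ≤ w₂) (h₂ : J * (N / w₂ + 1) ≤ L)
    (hsmall : (w₁ : ℝ) ^ (j * (j + 1)) * δ * ((j + 1) * (j * N ^ (j - 1) * w₂) + 2) < 1)
    (hsmall' : (w₁ : ℝ) ^ (j * (j + 1)) * (2 * w₁ ^ (j * (j + 1)) * δ / J ^ j) * (a + b) < 1) :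
    ∃ s : ℕ, 1 ≤ s ∧ s ≤ w₁ ^ (j * (j + 1)) * w₁ ^ (j * (j + 1)) ∧
      NearInt (s * θ)
        ((w₁ : ℝ) ^ (j * (j + 1)) * (2 * w₁ ^ (j * (j + 1)) * δ / J ^ j) / max a b) := by
  have hL' : #(Icc 1 N) * L < #Z := by simpa using hL
  obtain ⟨n, -, hn⟩ := exists_lt_card_fiber_of_mul_lt_card_of_maps_to (s := Z) (t := Icc 1 N)
    (f := Prod.snd) (fun z hz => (mem_product.1 (hZ hz)).2) hL'
  obtain ⟨m, -, hm⟩ := exists_lt_card_fiber_of_mul_lt_card_of_maps_to (s := Z) (t := Icc 1 N)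
    (f := Prod.fst) (fun z hz => (mem_product.1 (hZ hz)).1) hL'
  have hc1 : #((Z.filter fun z => z.2 = n).image Prod.fst) = #(Z.filter fun z => z.2 = n) :=
    card_image_of_injOn fun x hx y hy h =>
      Prod.ext h ((mem_filter.1 hx).2.trans (mem_filter.1 hy).2.symm)
  have hc2 : #((Z.filter fun z => z.1 = m).image Prod.snd) = #(Z.filter fun z => z.1 = m) :=
    card_image_of_injOn fun x hx y hy h =>
      Prod.ext ((mem_filter.1 hx).2.trans (mem_filter.1 hy).2.symm) h
  obtain ⟨s, hs1, hsle, hsn⟩ := exists_nearInt_of_dense (φ := θ * a) (c := -(θ * b * (n : ℝ) ^ j))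
    (M := (Z.filter fun z => z.2 = n).image Prod.fst) hj
    (fun x hx => by
      obtain ⟨z, hz, rfl⟩ := mem_image.1 hx
      exact (mem_product.1 (hZ (mem_filter.1 hz).1)).1) hδ
    (fun x hx => by
      obtain ⟨z, hz, rfl⟩ := mem_image.1 hx
      obtain ⟨hz1, rfl⟩ := mem_filter.1 hz
      have := hnear z hz1
      convert this using 1
      ring) hw₁ (by omega) hJ hw₂ (by omega) hsmall
  obtain ⟨t, ht1, htle, htn⟩ := exists_nearInt_of_dense (φ := -(θ * b)) (c := θ * a * (m : ℝ) ^ j)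
    (M := (Z.filter fun z => z.1 = m).image Prod.snd) hj
    (fun x hx => by
      obtain ⟨z, hz, rfl⟩ := mem_image.1 hx
      exact (mem_product.1 (hZ (mem_filter.1 hz).1)).2) hδ
    (fun x hx => by
      obtain ⟨z, hz, rfl⟩ := mem_image.1 hx
      obtain ⟨hz1, rfl⟩ := mem_filter.1 hz
      have := hnear z hz1
      convert this using 1
      ring) hw₁ (by omega) hJ hw₂ (by omega) hsmall
  refine ⟨s * t, Nat.mul_pos hs1 ht1, Nat.mul_le_mul hsle htle, ?_⟩
  have hsR : (s : ℝ) ≤ (w₁ : ℝ) ^ (j * (j + 1)) := by exact_mod_cast hsle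
  have htR : (t : ℝ) ≤ (w₁ : ℝ) ^ (j * (j + 1)) := by exact_mod_cast htle
  refine nearInt_of_coprime_mul ha hb hab ?_ ?_ hsmall'
  · have := hsn.mul_nat t
    have e : (t : ℝ) * (s * (θ * a)) = ((s * t : ℕ) : ℝ) * θ * a := by push_cast; ring
    rw [e] at this
    exact this.mono (by gcongr)
  · have := (htn.mul_nat s).neg
    have e : -((s : ℝ) * (t * (-(θ * b)))) = ((s * t : ℕ) : ℝ) * θ * b := by push_cast; ring
    rw [e] at this
    exact this.mono (by gcongr)

/-- For `p ∤ a` the congruence `a m ^ j ≡ c (mod p ^ f)` has at most `j` solutions in any window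
shorter than `p ^ (f / j)`, by interpolation and the ultrametric inequality. -/
lemma card_filter_prime_pow_dvd_le {p f j N w : ℕ} (hp : p.Prime) (hj : 1 ≤ j) {a c : ℤ}
    (ha : ¬ (p : ℤ) ∣ a) (hw : 1 ≤ w) (hwp : (w - 1) ^ j < p ^ f) :
    #((Icc 1 N).filter fun m : ℕ => ((p ^ f : ℕ) : ℤ) ∣ a * (m : ℤ) ^ j - c) ≤
      j * (N / w + 1) := by
  by_contra! hcon
  obtain ⟨S, hSM, hSc, hSw⟩ := exists_subset_window (filter_subset _ _) hw hcon
  have : Fact p.Prime := ⟨hp⟩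
  have hne : S.Nonempty := card_pos.1 (by omega)
  have hp0 : (0 : ℚ) < (p : ℚ) := by exact_mod_cast hp.pos
  have hsum := sum_eval_div_nodeProd hSc
    (Polynomial.C (a : ℚ) * Polynomial.X ^ j - Polynomial.C (c : ℚ)) (by compute_degree)
  simp only [Polynomial.eval_sub, Polynomial.eval_mul, Polynomial.eval_C, Polynomial.eval_pow,
    Polynomial.eval_X, Polynomial.coeff_sub, Polynomial.coeff_C_mul, Polynomial.coeff_X_pow,
    if_true, mul_one, Polynomial.coeff_C_of_ne_zero (show j ≠ 0 by omega), sub_zero] at hsum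
  have hlt : padicNorm p (∑ i ∈ S, ((a : ℚ) * (i : ℚ) ^ j - c) / nodeProd S i) < 1 := by
    refine padicNorm.sum_lt hne fun i hi => ?_
    have h1 : padicNorm p ((a : ℚ) * (i : ℚ) ^ j - c) ≤ (p : ℚ) ^ (-(f : ℤ)) := by
      have := padicNorm.dvd_iff_norm_le.1 (mem_filter.1 (hSM hi)).2
      push_cast at this
      exact this
    have h2 : (p : ℚ) ^ (-(f : ℤ)) < padicNorm p (nodeProd S i) := by
      by_contra! hle
      have hdvd := padicNorm.dvd_iff_norm_le.2 hle
      have h3 := Int.le_of_dvd (abs_pos.2 (nodeProd_ne_zero S i)) ((dvd_abs _ _).2 hdvd)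
      have h4 := h3.trans (abs_nodeProd_le hSc hSw hi)
      have h5 : p ^ f ≤ (w - 1) ^ j := by exact_mod_cast h4
      omega
    rw [padicNorm.div, div_lt_one ((by positivity : (0 : ℚ) < _).trans h2)]
    exact h1.trans_lt h2
  rw [hsum, (padicNorm.int_eq_one_iff a).2 ha] at hlt
  exact lt_irrefl _ hlt

/-- As `p` does not divide both `a` and `b`, one of the variables can be counted for each value of
the other. -/
lemma card_pairs_prime_pow_dvd_le {p f j N w a b : ℕ} (hp : p.Prime) (hj : 1 ≤ j)
    (hab : Nat.Coprime a b) (hw : 1 ≤ w) (hwp : (w - 1) ^ j < p ^ f) :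
    #((Icc 1 N ×ˢ Icc 1 N).filter fun z : ℕ × ℕ =>
      ((p ^ f : ℕ) : ℤ) ∣ a * (z.1 : ℤ) ^ j - b * (z.2 : ℤ) ^ j) ≤ N * (j * (N / w + 1)) := by
  rw [card_filter, sum_product]
  by_cases hpa : (p : ℤ) ∣ a
  · have hpb : ¬ (p : ℤ) ∣ b := fun hpb => by
      have h1 := Nat.dvd_gcd (Int.natCast_dvd_natCast.1 hpa) (Int.natCast_dvd_natCast.1 hpb)
      rw [hab] at h1
      exact hp.one_lt.ne' (Nat.dvd_one.1 h1)
    calc _ ≤ ∑ m ∈ Icc 1 N, j * (N / w + 1) := by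
          refine sum_le_sum fun m _ => ?_
          rw [← card_filter]
          refine le_trans (card_le_card fun n hn => ?_)
            (card_filter_prime_pow_dvd_le (c := a * (m : ℤ) ^ j) hp hj hpb hw hwp)
          rw [mem_filter] at hn ⊢
          exact ⟨hn.1, by rw [← neg_sub]; exact (dvd_neg).2 hn.2⟩
      _ = _ := by simp
  · rw [sum_comm]
    calc _ ≤ ∑ n ∈ Icc 1 N, j * (N / w + 1) := by
          refine sum_le_sum fun n _ => ?_
          rw [← card_filter]
          exact card_filter_prime_pow_dvd_le (c := b * (n : ℤ) ^ j) hp hj hpa hw hwp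
      _ = _ := by simp

/-! ### Fourier analysis on the integers -/

/-- The additive character `e(t) = exp (2 π i t)`. -/
noncomputable def addChar (t : ℝ) : ℂ := Complex.exp (Complex.I * (2 * Real.pi * t : ℝ))

lemma addChar_add (s t : ℝ) : addChar (s + t) = addChar s * addChar t := by
  rw [addChar, addChar, addChar, ← Complex.exp_add, ← mul_add]
  push_cast
  ring_nf

lemma addChar_zero : addChar 0 = 1 := by simp [addChar]

lemma addChar_int (n : ℤ) : addChar n = 1 := by
  rw [addChar, ← Complex.exp_int_mul_two_pi_mul_I n]
  push_cast
  ring_nf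

lemma norm_addChar (t : ℝ) : ‖addChar t‖ = 1 := by
  rw [addChar, mul_comm, Complex.norm_exp_ofReal_mul_I]

lemma addChar_nat_mul (n : ℕ) (t : ℝ) : addChar (n * t) = addChar t ^ n := by
  rw [addChar, addChar, ← Complex.exp_nat_mul]
  push_cast
  ring_nf

lemma addChar_sub_int (t : ℝ) (r : ℤ) : addChar (t - r) = addChar t := by
  have h := addChar_add (t - r) r
  rw [sub_add_cancel, addChar_int, mul_one] at h
  exact h.symm

lemma conj_addChar (t : ℝ) : (starRingEnd ℂ) (addChar t) = addChar (-t) := by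
  rw [addChar, addChar, ← Complex.exp_conj, map_mul, Complex.conj_I, Complex.conj_ofReal]
  push_cast
  ring_nf

lemma norm_addChar_sub_one (t : ℝ) : ‖addChar t - 1‖ = 2 * |Real.sin (Real.pi * t)| := by
  rw [addChar, Complex.norm_exp_I_mul_ofReal_sub_one, norm_mul, Real.norm_eq_abs, Real.norm_eq_abs,
    abs_two]
  congr 3
  ring

lemma norm_addChar_sub_one_le (t : ℝ) : ‖addChar t - 1‖ ≤ 2 * Real.pi * |t| := by
  refine Real.norm_exp_I_mul_ofReal_sub_one_le.trans ?_
  rw [Real.norm_eq_abs, abs_mul, abs_of_pos Real.two_pi_pos]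

@[fun_prop]
lemma continuous_addChar : Continuous addChar := by
  unfold addChar
  fun_prop

/-- The kernel `∑_{t < T} e(t ψ)`. -/
noncomputable def expKernel (T : ℕ) (ψ : ℝ) : ℂ := ∑ t ∈ range T, addChar (t * ψ)

@[fun_prop]
lemma continuous_expKernel (T : ℕ) : Continuous (expKernel T) := by
  unfold expKernel
  fun_prop

lemma norm_expKernel_le (T : ℕ) (ψ : ℝ) : ‖expKernel T ψ‖ ≤ T := by
  refine (norm_sum_le _ _).trans ?_
  simp [norm_addChar]

/-- The bound for a geometric sum. -/
lemma norm_expKernel_le_of_not_nearInt (T : ℕ) {ψ δ : ℝ} (hδ : 0 < δ) (h : ¬ NearInt ψ δ) :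
    ‖expKernel T ψ‖ ≤ 1 / (2 * δ) := by
  have hr : δ < |ψ - round ψ| := not_le.1 fun hle => h ⟨_, hle⟩
  have hr2 : |ψ - round ψ| ≤ 1 / 2 := abs_sub_round ψ
  have hpi := Real.pi_pos
  have hsin : 4 * δ ≤ ‖addChar ψ - 1‖ := by
    rw [← addChar_sub_int ψ (round ψ), norm_addChar_sub_one]
    have h1 := Real.mul_abs_le_abs_sin (x := Real.pi * (ψ - round ψ)) (by
      rw [abs_mul, abs_of_pos hpi]
      nlinarith)
    rw [abs_mul, abs_of_pos hpi, ← mul_assoc, div_mul_cancel₀ _ hpi.ne'] at h1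
    linarith
  have hgeom : expKernel T ψ * (addChar ψ - 1) = addChar ψ ^ T - 1 := by
    rw [← geom_sum_mul, expKernel]
    simp_rw [addChar_nat_mul]
  have hnum : ‖addChar ψ ^ T - 1‖ ≤ 2 := by
    refine (norm_sub_le _ _).trans ?_
    rw [norm_pow, norm_addChar]
    norm_num
  rw [← hgeom, norm_mul] at hnum
  rw [le_div_iff₀ (by positivity)]
  nlinarith [norm_nonneg (expKernel T ψ)]

/-- The constant `13` is a convenient integer above `4 π`: each term is within `2 π / 13 < 1 / 2` of
`1`. -/
lemma half_le_norm_expKernel {T : ℕ} {ψ : ℝ} (h : NearInt ψ (1 / (13 * T))) :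
    (T : ℝ) / 2 ≤ ‖expKernel T ψ‖ := by
  rcases Nat.eq_zero_or_pos T with rfl | hT
  · simp
  obtain ⟨r, hr⟩ := h
  have hT0 : (0 : ℝ) < T := by exact_mod_cast hT
  have hpi := Real.pi_lt_d2
  have hdiff : ‖expKernel T ψ - T‖ ≤ T / 2 := by
    have e : expKernel T ψ - T = ∑ t ∈ range T, (addChar (t * ψ) - 1) := by
      rw [sum_sub_distrib, expKernel]
      simp
    rw [e]
    have hterm : ∀ t ∈ range T, ‖addChar (t * ψ) - 1‖ ≤ 1 / 2 := fun t ht => by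
      have ht' : (t : ℝ) ≤ T := by exact_mod_cast (mem_range.1 ht).le
      have e2 : addChar (t * ψ) = addChar (t * (ψ - r)) := by
        rw [addChar_nat_mul, addChar_nat_mul, addChar_sub_int]
      rw [e2]
      refine (norm_addChar_sub_one_le _).trans ?_
      rw [abs_mul, Nat.abs_cast]
      have h1 : (t : ℝ) * |ψ - r| ≤ T * (1 / (13 * T)) := by gcongr
      have h2 : (T : ℝ) * (1 / (13 * T)) = 1 / 13 := by field_simp
      rw [h2] at h1
      nlinarith [Real.pi_pos, mul_nonneg t.cast_nonneg (abs_nonneg (ψ - r))]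
    refine (norm_sum_le _ _).trans ((sum_le_sum hterm).trans ?_)
    simp
    linarith
  have h3 : ‖(T : ℂ)‖ ≤ ‖expKernel T ψ‖ + ‖expKernel T ψ - T‖ := by
    have := norm_sub_le (expKernel T ψ) (expKernel T ψ - T)
    rwa [sub_sub_cancel] at this
  rw [Complex.norm_natCast] at h3
  linarith

lemma integral_addChar (n : ℤ) : ∫ θ in (0 : ℝ)..1, addChar (n * θ) = if n = 0 then 1 else 0 := by
  split_ifs with h
  · simp [h, addChar_zero]
  · have hc : (2 * Real.pi * n * Complex.I : ℂ) ≠ 0 := by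
      simp [h, Real.pi_ne_zero, Complex.I_ne_zero]
    have e : ∀ θ : ℝ, addChar (n * θ) = Complex.exp ((2 * Real.pi * n * Complex.I) * θ) :=
      fun θ => by rw [addChar]; push_cast; ring_nf
    simp_rw [e]
    rw [integral_exp_mul_complex hc, ← e, ← e]
    rw [mul_one, mul_zero, addChar_int, addChar_zero, sub_self, zero_div]

/-- The trigonometric polynomial `∑_{y ∈ I} f(y) e(-y θ)`. -/
noncomputable def trigPoly (I : Finset ℤ) (f : ℤ → ℂ) (θ : ℝ) : ℂ :=
  ∑ y ∈ I, f y * addChar (-(y * θ))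

@[fun_prop]
lemma continuous_trigPoly (I : Finset ℤ) (f : ℤ → ℂ) : Continuous (trigPoly I f) := by
  unfold trigPoly
  fun_prop

/-- Parseval's identity. -/
lemma integral_norm_sq_trigPoly (I : Finset ℤ) (f : ℤ → ℂ) :
    ∫ θ in (0 : ℝ)..1, ‖trigPoly I f θ‖ ^ 2 = ∑ y ∈ I, ‖f y‖ ^ 2 := by
  have hexp : ∀ θ : ℝ, ((‖trigPoly I f θ‖ ^ 2 : ℝ) : ℂ) =
      ∑ y ∈ I, ∑ z ∈ I, f y * (starRingEnd ℂ) (f z) * addChar (((z - y : ℤ) : ℝ) * θ) := by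
    intro θ
    push_cast
    rw [← Complex.mul_conj', trigPoly, map_sum, sum_mul_sum]
    refine sum_congr rfl fun y _ => sum_congr rfl fun z _ => ?_
    rw [map_mul, conj_addChar, neg_neg]
    have : addChar (((z : ℝ) - y) * θ) = addChar (-(y * θ)) * addChar (z * θ) := by
      rw [← addChar_add]
      ring_nf
    rw [this]
    ring
  have h : ((∫ θ in (0 : ℝ)..1, ‖trigPoly I f θ‖ ^ 2 : ℝ) : ℂ) = ((∑ y ∈ I, ‖f y‖ ^ 2 : ℝ) : ℂ) := by
    rw [← intervalIntegral.integral_ofReal]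
    simp_rw [hexp]
    rw [intervalIntegral.integral_finsetSum fun y _ =>
      Continuous.intervalIntegrable (by fun_prop) _ _, Complex.ofReal_sum]
    refine sum_congr rfl fun y hy => ?_
    rw [intervalIntegral.integral_finsetSum fun z _ =>
      Continuous.intervalIntegrable (by fun_prop) _ _]
    simp_rw [intervalIntegral.integral_const_mul, integral_addChar]
    rw [sum_eq_single_of_mem y hy fun z _ hzy => by rw [if_neg (by omega), mul_zero]]
    rw [sub_self, if_pos rfl, mul_one, Complex.mul_conj', Complex.ofReal_pow]
  exact_mod_cast h

/-- Averaging over shifts by `q` multiplies the trigonometric polynomial by `expKernel T (q θ)`.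
Here `I` contains the support of `f`, and `I'` that of the average. -/
lemma trigPoly_shift {I I' : Finset ℤ} {f : ℤ → ℂ} (hf : ∀ y ∉ I, f y = 0) (T : ℕ) (q : ℤ)
    (hI' : ∀ y, ∀ t < T, y + t * q ∈ I → y ∈ I') (θ : ℝ) :
    trigPoly I' (fun y => ∑ t ∈ range T, f (y + t * q)) θ =
      expKernel T (q * θ) * trigPoly I f θ := by
  rw [trigPoly, expKernel, sum_mul]
  simp_rw [sum_mul]
  rw [sum_comm]
  refine sum_congr rfl fun t ht => ?_
  have hsub : I.map (Equiv.subRight ((t : ℤ) * q)).toEmbedding ⊆ I' := by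
    intro y hy
    obtain ⟨z, hz, rfl⟩ := mem_map.1 hy
    exact hI' _ t (mem_range.1 ht) (by simpa using hz)
  rw [← sum_subset hsub, sum_map, trigPoly, mul_sum]
  · refine sum_congr rfl fun z _ => ?_
    have e : addChar (-(((z - t * q : ℤ) : ℝ) * θ)) = addChar (t * (q * θ)) * addChar (-(z * θ)) := by
      rw [← addChar_add]
      push_cast
      ring_nf
    change f (z - t * q + t * q) * addChar (-(((z - t * q : ℤ) : ℝ) * θ)) = _
    rw [e, sub_add_cancel]
    ring
  · intro y _ hy
    rw [hf, zero_mul]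
    intro h
    exact hy (mem_map.2 ⟨y + t * q, h, by simp⟩)

lemma sum_norm_sq_shift_eq {I I' : Finset ℤ} {f : ℤ → ℂ} (hf : ∀ y ∉ I, f y = 0) (T : ℕ) (q : ℤ)
    (hI' : ∀ y, ∀ t < T, y + t * q ∈ I → y ∈ I') :
    ∑ y ∈ I', ‖∑ t ∈ range T, f (y + t * q)‖ ^ 2 =
      ∫ θ in (0 : ℝ)..1, ‖expKernel T (q * θ)‖ ^ 2 * ‖trigPoly I f θ‖ ^ 2 := by
  rw [← integral_norm_sq_trigPoly]
  refine intervalIntegral.integral_congr fun θ _ => ?_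
  rw [trigPoly_shift hf T q hI', norm_mul, mul_pow]

/-- Unlike in `sum_norm_sq_shift_eq`, the set `I'` is arbitrary. -/
lemma sum_norm_sq_shift_le {I : Finset ℤ} {f : ℤ → ℂ} (hf : ∀ y ∉ I, f y = 0) (T : ℕ) (q : ℤ)
    (I' : Finset ℤ) :
    ∑ y ∈ I', ‖∑ t ∈ range T, f (y + t * q)‖ ^ 2 ≤
      ∫ θ in (0 : ℝ)..1, ‖expKernel T (q * θ)‖ ^ 2 * ‖trigPoly I f θ‖ ^ 2 := by
  rw [← sum_norm_sq_shift_eq hf T q (I' := I' ∪ (range T ×ˢ I).image fun p => p.2 - p.1 * q)]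
  · exact sum_le_sum_of_subset_of_nonneg subset_union_left fun _ _ _ => by positivity
  · intro y t ht hy
    refine mem_union_right _ (mem_image.2 ⟨(t, y + t * q), ?_, by simp⟩)
    exact mem_product.2 ⟨mem_range.2 ht, hy⟩

/-- Averages of `f` along the progressions with the differences `q v` are small in mean square,
unless they are so along one of the few differences `s ∈ SS`: a frequency `θ` contributes to the
former only if `q v * θ` is near an integer, which is to happen for at most `κ` of the `v`, or else
`θ` is near a fraction with a denominator in `SS`. -/
lemma sum_sum_norm_sq_shift_le {ι : Type*} {I I₁ : Finset ℤ} {f : ℤ → ℂ} (hf : ∀ y ∉ I, f y = 0)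
    (V : Finset ι) (q : ι → ℤ) (I' : Finset ℤ) {T T₁ : ℕ} (hT₁ : 1 ≤ T₁) (SS : Finset ℕ)
    {δ κ : ℝ} (hδ : 0 < δ) (hκ : 0 ≤ κ)
    (hI₁ : ∀ s ∈ SS, ∀ y : ℤ, ∀ t < T₁, y + t * (s : ℤ) ∈ I → y ∈ I₁)
    (hθ : ∀ θ : ℝ, (∀ W ⊆ V, (∀ v ∈ W, NearInt (q v * θ) δ) → (#W : ℝ) ≤ κ) ∨
      ∃ s ∈ SS, NearInt (s * θ) (1 / (13 * T₁))) :
    ∑ v ∈ V, ∑ y ∈ I', ‖∑ t ∈ range T, f (y + t * q v)‖ ^ 2 ≤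
      (κ * T ^ 2 + #V * (1 / (2 * δ)) ^ 2) * ∑ y ∈ I, ‖f y‖ ^ 2 +
      4 * #V * (T / T₁) ^ 2 *
        ∑ s ∈ SS, ∑ y ∈ I₁, ‖∑ t ∈ range T₁, f (y + t * (s : ℤ))‖ ^ 2 := by
  classical
  have hT₁0 : (0 : ℝ) < T₁ := by exact_mod_cast hT₁
  calc _ ≤ ∑ v ∈ V, ∫ θ in (0 : ℝ)..1, ‖expKernel T (q v * θ)‖ ^ 2 * ‖trigPoly I f θ‖ ^ 2 :=
        sum_le_sum fun v _ => sum_norm_sq_shift_le hf T (q v) I'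
    _ = ∫ θ in (0 : ℝ)..1, ∑ v ∈ V, ‖expKernel T (q v * θ)‖ ^ 2 * ‖trigPoly I f θ‖ ^ 2 := by
        rw [intervalIntegral.integral_finsetSum fun v _ =>
          Continuous.intervalIntegrable (by fun_prop) _ _]
    _ ≤ ∫ θ in (0 : ℝ)..1, ((κ * T ^ 2 + #V * (1 / (2 * δ)) ^ 2) * ‖trigPoly I f θ‖ ^ 2 +
          4 * #V * (T / T₁) ^ 2 *
            ∑ s ∈ SS, ‖expKernel T₁ ((s : ℤ) * θ)‖ ^ 2 * ‖trigPoly I f θ‖ ^ 2) := by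
        refine intervalIntegral.integral_mono_on zero_le_one
          (Continuous.intervalIntegrable (by fun_prop) _ _)
          (Continuous.intervalIntegrable (by fun_prop) _ _) fun θ _ => ?_
        have hterm : ∀ v ∈ V, ‖expKernel T (q v * θ)‖ ^ 2 ≤
            (if NearInt (q v * θ) δ then (T : ℝ) ^ 2 else 0) + (1 / (2 * δ)) ^ 2 := by
          intro v _
          split_ifs with h
          · have := pow_le_pow_left₀ (norm_nonneg _) (norm_expKernel_le T (q v * θ)) 2
            have : 0 ≤ (1 / (2 * δ)) ^ 2 := by positivity
            linarith
          · rw [zero_add]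
            exact pow_le_pow_left₀ (norm_nonneg _) (norm_expKernel_le_of_not_nearInt T hδ h) 2
        have htriv : ∀ v ∈ V, ‖expKernel T (q v * θ)‖ ^ 2 ≤ (T : ℝ) ^ 2 := fun v _ =>
          pow_le_pow_left₀ (norm_nonneg _) (norm_expKernel_le T (q v * θ)) 2
        rw [← sum_mul, ← sum_mul, ← mul_assoc, ← add_mul]
        refine mul_le_mul_of_nonneg_right ?_ (by positivity)
        have hmaj : 0 ≤ ∑ s ∈ SS, ‖expKernel T₁ ((s : ℤ) * θ)‖ ^ 2 :=
          sum_nonneg fun _ _ => by positivity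
        by_cases hcase : ∃ s ∈ SS, NearInt (s * θ) (1 / (13 * T₁))
        · obtain ⟨s, hs, hns⟩ := hcase
          have h1 : ((T₁ : ℝ) / 2) ^ 2 ≤ ∑ s ∈ SS, ‖expKernel T₁ ((s : ℤ) * θ)‖ ^ 2 := by
            refine le_trans ?_ (single_le_sum (f := fun s : ℕ => ‖expKernel T₁ ((s : ℤ) * θ)‖ ^ 2)
              (fun _ _ => by positivity) hs)
            refine pow_le_pow_left₀ (by positivity) ?_ 2
            push_cast
            exact half_le_norm_expKernel hns
          have h2 : #V * (T : ℝ) ^ 2 = 4 * #V * (T / T₁) ^ 2 * (T₁ / 2) ^ 2 := by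
            field_simp
            norm_num
          have h3 : ∑ v ∈ V, ‖expKernel T (q v * θ)‖ ^ 2 ≤ #V * (T : ℝ) ^ 2 := by
            refine (sum_le_sum htriv).trans ?_
            rw [sum_const, nsmul_eq_mul]
          rw [h2] at h3
          refine h3.trans (le_add_of_nonneg_of_le (by positivity) ?_)
          gcongr
        · have h := (hθ θ).resolve_right hcase
          have h1 : (#(V.filter fun v => NearInt (q v * θ) δ) : ℝ) ≤ κ :=
            h _ (filter_subset _ _) fun v hv => (mem_filter.1 hv).2
          calc _ ≤ ∑ v ∈ V, ((if NearInt (q v * θ) δ then (T : ℝ) ^ 2 else 0) +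
                (1 / (2 * δ)) ^ 2) := sum_le_sum hterm
            _ = #(V.filter fun v => NearInt (q v * θ) δ) * (T : ℝ) ^ 2 +
                #V * (1 / (2 * δ)) ^ 2 := by
                rw [sum_add_distrib, ← sum_filter, sum_const, sum_const, nsmul_eq_mul, nsmul_eq_mul]
            _ ≤ κ * (T : ℝ) ^ 2 + #V * (1 / (2 * δ)) ^ 2 := by gcongr
            _ ≤ _ := le_add_of_nonneg_right (by positivity)
    _ = _ := by
        rw [intervalIntegral.integral_add (Continuous.intervalIntegrable (by fun_prop) _ _)
          (Continuous.intervalIntegrable (by fun_prop) _ _), intervalIntegral.integral_const_mul,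
          intervalIntegral.integral_const_mul, integral_norm_sq_trigPoly,
          intervalIntegral.integral_finsetSum fun v _ =>
            Continuous.intervalIntegrable (by fun_prop) _ _]
        congr 2
        refine sum_congr rfl fun s hs => ?_
        rw [sum_norm_sq_shift_eq hf T₁ s (hI₁ s hs)]

/-! ### Exceptional pairs -/

lemma card_Icc_filter_dvd (N r : ℕ) : #((Icc 1 N).filter fun m => r ∣ m) = N / r :=
  Nat.Ioc_filter_dvd_card_eq_div N r

lemma card_Icc_filter_dvd_le (N r : ℕ) :
    (#((Icc 1 N).filter fun m => r ∣ m) : ℝ) ≤ N / r := by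
  rw [card_Icc_filter_dvd]
  exact Nat.cast_div_le

lemma sum_Ioc_inv_sq_le_inv {G N : ℕ} (hG : 1 ≤ G) :
    ∑ r ∈ Ioc G N, ((r : ℝ) ^ 2)⁻¹ ≤ 1 / G := by
  rcases le_total G N with h | h
  · refine (sum_Ioc_inv_sq_le_sub (by omega) h).trans ?_
    rw [one_div]
    exact sub_le_self _ (by positivity)
  · rw [Ioc_eq_empty (by omega)]
    simp

/-- Few pairs have a large gcd, by summing `(N / r) ^ 2` over `r > G`. -/
lemma card_filter_lt_gcd_le {G N : ℕ} (hG : 1 ≤ G) :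
    (#((Icc 1 N ×ˢ Icc 1 N).filter fun v : ℕ × ℕ => G < Nat.gcd v.1 v.2) : ℝ) ≤
      (N : ℝ) ^ 2 / G := by
  have hsub : ((Icc 1 N ×ˢ Icc 1 N).filter fun v : ℕ × ℕ => G < Nat.gcd v.1 v.2) ⊆
      (Ioc G N).biUnion fun r =>
        ((Icc 1 N).filter fun m => r ∣ m) ×ˢ ((Icc 1 N).filter fun m => r ∣ m) := by
    intro v hv
    obtain ⟨hv, hG⟩ := mem_filter.1 hv
    obtain ⟨h1, h2⟩ := mem_product.1 hv
    have hle : Nat.gcd v.1 v.2 ≤ N :=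
      (Nat.gcd_le_left _ (mem_Icc.1 h1).1).trans (mem_Icc.1 h1).2
    exact mem_biUnion.2 ⟨_, mem_Ioc.2 ⟨hG, hle⟩, mem_product.2
      ⟨mem_filter.2 ⟨h1, Nat.gcd_dvd_left _ _⟩, mem_filter.2 ⟨h2, Nat.gcd_dvd_right _ _⟩⟩⟩
  have h1 : (#((Icc 1 N ×ˢ Icc 1 N).filter fun v : ℕ × ℕ => G < Nat.gcd v.1 v.2) : ℝ) ≤
      ∑ r ∈ Ioc G N, (N : ℝ) ^ 2 * ((r : ℝ) ^ 2)⁻¹ := by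
    refine (Nat.cast_le.2 ((card_le_card hsub).trans card_biUnion_le)).trans ?_
    push_cast
    refine sum_le_sum fun r _ => ?_
    rw [card_product]
    push_cast
    have := card_Icc_filter_dvd_le N r
    calc _ ≤ ((N : ℝ) / r) * (N / r) := by gcongr
      _ = _ := by rw [← sq, div_pow, div_eq_mul_inv]
  refine h1.trans ?_
  rw [← mul_sum, div_eq_mul_one_div]
  gcongr
  exact sum_Ioc_inv_sq_le_inv hG

lemma two_pow_card_primeFactors_le_tauGen {n : ℕ} (hn : n ≠ 0) :
    (2 : ℝ) ^ #n.primeFactors ≤ tauGen 2 n := by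
  rw [tauGen_eq_prod 2 subset_rfl, ← prod_const]
  refine prod_le_prod (fun _ _ => by norm_num) fun p hp => ?_
  have h1 : 1 ≤ n.factorization p :=
    ((Nat.prime_of_mem_primeFactors hp).dvd_iff_one_le_factorization hn).1
      (Nat.dvd_of_mem_primeFactors hp)
  calc (2 : ℝ) = tauLocal 2 1 := by simp [tauLocal]
    _ ≤ _ := tauLocal_mono_right (by norm_num) h1

lemma card_primeFactors_le_log {n : ℕ} (hn : n ≠ 0) : #n.primeFactors ≤ Nat.log 2 n := by
  refine Nat.le_log_of_pow_le (by norm_num) ?_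
  refine le_trans ?_ (Nat.le_of_dvd (Nat.pos_of_ne_zero hn) (Nat.prod_primeFactors_dvd n))
  rw [← prod_const]
  exact prod_le_prod' fun p hp => (Nat.prime_of_mem_primeFactors hp).two_le

/-- A number with few prime factors, none of them occurring to a large power, is small. -/
lemma exists_primePow_gt {e R ν : ℕ} (he0 : e ≠ 0) (hR : 1 ≤ R) (hν : #e.primeFactors ≤ ν)
    (he : R ^ (3 * ν) < e) : ∃ p ∈ e.primeFactors, R ^ 3 < p ^ e.factorization p := by
  by_contra! hcon
  have h1 : e ≤ R ^ (3 * ν) := by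
    conv_lhs => rw [← Nat.prod_factorization_pow_eq_self he0]
    rw [Finsupp.prod, Nat.support_factorization]
    calc _ ≤ ∏ p ∈ e.primeFactors, R ^ 3 := prod_le_prod' hcon
      _ = (R ^ 3) ^ #e.primeFactors := prod_const _
      _ ≤ (R ^ 3) ^ ν := Nat.pow_le_pow_right (by positivity) hν
      _ = _ := (pow_mul _ _ _).symm
  omega

/-- Few `m ≤ N` have a large common factor with a given `c`: such an `m` has many prime factors,
or a large prime factor in common with `c`, or a large square divisor. -/
lemma card_filter_lt_gcd_const_le {c N R ν : ℕ} (hc : c ≠ 0) (hN : 1 ≤ N) (hR : 1 ≤ R) :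
    (#((Icc 1 N).filter fun m => R ^ (3 * ν) < Nat.gcd c m) : ℝ) ≤
      N * ((1 + Real.log N) ^ 2 / 2 ^ ν + Nat.log 2 c / R + 1 / R) := by
  have hR0 : (0 : ℝ) < R := by exact_mod_cast hR
  set S1 := (Icc 1 N).filter fun m => ν < #m.primeFactors
  set S2 := (c.primeFactors.filter fun p => R < p).biUnion fun p => (Icc 1 N).filter fun m => p ∣ m
  set S3 := (Ioc R N).biUnion fun r => (Icc 1 N).filter fun m => r ^ 2 ∣ m
  have hsub : ((Icc 1 N).filter fun m => R ^ (3 * ν) < Nat.gcd c m) ⊆ S1 ∪ (S2 ∪ S3) := by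
    intro m hm
    obtain ⟨hmN, hgt⟩ := mem_filter.1 hm
    have hm0 : m ≠ 0 := by have := (mem_Icc.1 hmN).1; omega
    by_cases hω : ν < #m.primeFactors
    · exact mem_union_left _ (mem_filter.2 ⟨hmN, hω⟩)
    refine mem_union_right _ ?_
    have hg0 : Nat.gcd c m ≠ 0 := Nat.gcd_ne_zero_left hc
    have hω' : #(Nat.gcd c m).primeFactors ≤ ν :=
      (card_le_card (Nat.primeFactors_mono (Nat.gcd_dvd_right c m) hm0)).trans (by omega)
    obtain ⟨p, hp, hlt⟩ := exists_primePow_gt hg0 hR hω' hgt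
    have hpp := Nat.prime_of_mem_primeFactors hp
    set a := (Nat.gcd c m).factorization p with ha
    have hdvd : p ^ a ∣ m := (Nat.ordProj_dvd _ p).trans (Nat.gcd_dvd_right c m)
    rcases Nat.lt_or_ge a 2 with h | h
    · refine mem_union_left _ (mem_biUnion.2 ⟨p, mem_filter.2 ⟨?_, ?_⟩, mem_filter.2 ⟨hmN, ?_⟩⟩)
      · exact Nat.primeFactors_mono (Nat.gcd_dvd_left c m) hc hp
      · calc R ≤ R ^ 3 := Nat.le_self_pow (by norm_num) R
          _ < p ^ a := hlt
          _ ≤ p ^ 1 := Nat.pow_le_pow_right hpp.pos (by omega)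
          _ = p := pow_one p
      · exact (Nat.dvd_of_mem_primeFactors hp).trans (Nat.gcd_dvd_right c m)
    · have hr3 : R ^ 3 < (p ^ (a / 2)) ^ 3 := by
        rw [← pow_mul]
        exact hlt.trans_le (Nat.pow_le_pow_right hpp.pos (by omega))
      have hr2 : (p ^ (a / 2)) ^ 2 ∣ m := by
        rw [← pow_mul]
        exact (pow_dvd_pow p (by omega)).trans hdvd
      have hrN : p ^ (a / 2) ≤ N :=
        (Nat.le_self_pow two_ne_zero _).trans
          ((Nat.le_of_dvd (by omega) hr2).trans (mem_Icc.1 hmN).2)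
      refine mem_union_right _ (mem_biUnion.2 ⟨p ^ (a / 2), mem_Ioc.2 ⟨?_, hrN⟩,
        mem_filter.2 ⟨hmN, hr2⟩⟩)
      exact lt_of_pow_lt_pow_left₀ 3 (Nat.zero_le _) hr3
  have h1 : (#S1 : ℝ) ≤ N * ((1 + Real.log N) ^ 2 / 2 ^ ν) := by
    rw [← mul_div_assoc, le_div_iff₀ (by positivity)]
    calc (#S1 : ℝ) * 2 ^ ν = ∑ m ∈ S1, (2 : ℝ) ^ ν := by rw [sum_const, nsmul_eq_mul]
      _ ≤ ∑ m ∈ S1, tauGen 2 m := by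
          refine sum_le_sum fun m hm => ?_
          obtain ⟨hmN, hω⟩ := mem_filter.1 hm
          have hm0 : m ≠ 0 := by have := (mem_Icc.1 hmN).1; omega
          exact (pow_le_pow_right₀ (by norm_num) hω.le).trans
            (two_pow_card_primeFactors_le_tauGen hm0)
      _ ≤ ∑ m ∈ Icc 1 N, tauGen 2 m :=
          sum_le_sum_of_subset_of_nonneg (filter_subset _ _) fun m _ _ =>
            tauGen_nonneg (by norm_num) m
      _ ≤ _ := by exact_mod_cast sum_tauGen_le 2 hN
  have h2 : (#S2 : ℝ) ≤ N * (Nat.log 2 c / R) := by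
    have : (#S2 : ℝ) ≤ ∑ p ∈ c.primeFactors.filter fun p => R < p, (N : ℝ) / R := by
      refine (Nat.cast_le.2 card_biUnion_le).trans ?_
      push_cast
      refine sum_le_sum fun p hp => (card_Icc_filter_dvd_le N p).trans ?_
      have : (R : ℝ) ≤ p := by exact_mod_cast (mem_filter.1 hp).2.le
      gcongr
    refine this.trans ?_
    rw [sum_const, nsmul_eq_mul]
    have hcard : (#(c.primeFactors.filter fun p => R < p) : ℝ) ≤ Nat.log 2 c := by
      exact_mod_cast (card_filter_le _ _).trans (card_primeFactors_le_log hc)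
    calc _ ≤ (Nat.log 2 c : ℝ) * (N / R) := by gcongr
      _ = _ := by ring
  have h3 : (#S3 : ℝ) ≤ N * (1 / R) := by
    have : (#S3 : ℝ) ≤ ∑ r ∈ Ioc R N, (N : ℝ) * ((r : ℝ) ^ 2)⁻¹ := by
      refine (Nat.cast_le.2 card_biUnion_le).trans ?_
      push_cast
      refine sum_le_sum fun r _ => (card_Icc_filter_dvd_le N (r ^ 2)).trans ?_
      push_cast
      rw [div_eq_mul_inv]
    refine this.trans ?_
    rw [← mul_sum]
    gcongr
    exact sum_Ioc_inv_sq_le_inv hR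
  have h4 : (#((Icc 1 N).filter fun m => R ^ (3 * ν) < Nat.gcd c m) : ℝ) ≤ #S1 + (#S2 + #S3) := by
    exact_mod_cast (card_le_card hsub).trans ((card_union_le _ _).trans
      (Nat.add_le_add_left (card_union_le _ _) _))
  linarith

/-- A prime power dividing `m ^ k * n ^ i * gcd(m, n) ^ j` forces a large power of the prime to
divide `m` or `n`. -/
lemma exists_pow_dvd_of_pow_dvd {p f m n k i j d : ℕ} (hp : p.Prime) (hm : m ≠ 0) (hn : n ≠ 0)
    (hd : k + i + j = d) (h : p ^ f ∣ m ^ k * n ^ i * Nat.gcd m n ^ j) :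
    ∃ g, f ≤ d * g ∧ (p ^ g ∣ m ∨ p ^ g ∣ n) := by
  have hg0 : Nat.gcd m n ≠ 0 := Nat.gcd_ne_zero_left hm
  have h1 := (hp.pow_dvd_iff_le_factorization (by positivity)).1 h
  rw [Nat.factorization_mul (by positivity) (by positivity), Nat.factorization_mul (by positivity)
    (by positivity), Nat.factorization_pow, Nat.factorization_pow, Nat.factorization_pow,
    Nat.factorization_gcd hm hn] at h1
  simp only [Finsupp.coe_add, Finsupp.coe_smul, Pi.add_apply, Pi.smul_apply, smul_eq_mul,
    Finsupp.inf_apply] at h1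
  set a := m.factorization p
  set b := n.factorization p
  have h2 : k * a + i * b + j * (a ⊓ b) ≤ d * max a b := by
    rw [← hd, add_mul, add_mul]
    exact Nat.add_le_add (Nat.add_le_add (Nat.mul_le_mul_left _ (le_max_left _ _))
      (Nat.mul_le_mul_left _ (le_max_right _ _))) (Nat.mul_le_mul_left _ inf_le_sup)
  refine ⟨max a b, h1.trans h2, ?_⟩
  rcases le_total a b with hab | hab
  · right; rw [max_eq_right hab]; exact Nat.ordProj_dvd _ _
  · left; rw [max_eq_left hab]; exact Nat.ordProj_dvd _ _

/-- The pairs `(m, n)` such that `m ^ k * n ^ i * gcd(m, n) ^ j` is divisible by at least the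
square root of some prime power in `Q`. -/
def badPrimePow (Q : Finset ℕ) (k i j : ℕ) (v : ℕ × ℕ) : Prop :=
  ∃ q ∈ Q, q.minFac ^ ((q.factorization q.minFac + 1) / 2) ∣
    v.1 ^ k * v.2 ^ i * Nat.gcd v.1 v.2 ^ j

open Classical in
/-- If `p ^ ⌈e / 2⌉` divides a product of `d` factors `m`, `n`, `gcd(m, n)`, then about the `2 d`-th
root of `p ^ e` divides `m` or `n`. The count over `Q` is then bounded by the sum of `q ^ (-1 / (2
d))`, and this by the square of the sum of `q ^ (-1 / (4 d))`. -/
lemma card_badPrimePow_le {Q : Finset ℕ} (hQ : ∀ q ∈ Q, IsPrimePow q) {k i j d : ℕ} (hd1 : 1 ≤ d)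
    (hd : k + i + j = d) (N : ℕ) :
    (#((Icc 1 N ×ˢ Icc 1 N).filter (badPrimePow Q k i j)) : ℝ) ≤
      2 * N ^ 2 * (∑ q ∈ Q, (q : ℝ) ^ (-(1 / (4 * (d : ℝ))))) ^ 2 := by
  have hd0 : (0 : ℝ) < d := by exact_mod_cast hd1
  -- the least exponent `g` with `2 d g ≥ e`, where `q = p ^ e`
  set E : ℕ → ℕ := fun q => (q.factorization q.minFac + 2 * d - 1) / (2 * d) with hE
  set D : ℕ → Finset ℕ := fun q => (Icc 1 N).filter fun m => q.minFac ^ E q ∣ m with hD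
  have hsub : (Icc 1 N ×ˢ Icc 1 N).filter (badPrimePow Q k i j) ⊆
      Q.biUnion fun q => D q ×ˢ Icc 1 N ∪ Icc 1 N ×ˢ D q := by
    intro v hv
    obtain ⟨hv, q, hq, hdvd⟩ := mem_filter.1 hv
    obtain ⟨h1, h2⟩ := mem_product.1 hv
    have hm := (mem_Icc.1 h1).1
    have hn := (mem_Icc.1 h2).1
    have hp := Nat.minFac_prime (hQ q hq).one_lt.ne'
    obtain ⟨g, hg, hor⟩ := exists_pow_dvd_of_pow_dvd hp (by omega) (by omega) hd hdvd
    have hEg : E q ≤ g := by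
      have h3 : q.factorization q.minFac ≤ 2 * d * g := by
        have : q.factorization q.minFac ≤ 2 * ((q.factorization q.minFac + 1) / 2) := by omega
        nlinarith
      rw [hE]
      refine Nat.le_of_lt_succ ((Nat.div_lt_iff_lt_mul (by positivity)).2 ?_)
      rw [show g.succ * (2 * d) = 2 * d * g + 2 * d by rw [Nat.succ_eq_add_one]; ring]
      omega
    refine mem_biUnion.2 ⟨q, hq, ?_⟩
    rcases hor with h | h
    · exact mem_union_left _ (mem_product.2 ⟨mem_filter.2 ⟨h1, (pow_dvd_pow _ hEg).trans h⟩, h2⟩)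
    · exact mem_union_right _ (mem_product.2 ⟨h1, mem_filter.2 ⟨h2, (pow_dvd_pow _ hEg).trans h⟩⟩)
  have hDle : ∀ q ∈ Q, (#(D q) : ℝ) ≤ N * ((q : ℝ) ^ (-(1 / (4 * (d : ℝ))))) ^ 2 := by
    intro q hq
    refine (card_Icc_filter_dvd_le N _).trans ?_
    rw [div_eq_mul_inv]
    refine mul_le_mul_of_nonneg_left ?_ (Nat.cast_nonneg N)
    have hp := Nat.minFac_prime (hQ q hq).one_lt.ne'
    have hp1 : (1 : ℝ) ≤ q.minFac := by exact_mod_cast hp.one_lt.le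
    have hp0 : (0 : ℝ) ≤ q.minFac := by linarith
    have hq' : (q : ℝ) = (q.minFac : ℝ) ^ (q.factorization q.minFac : ℝ) := by
      rw [Real.rpow_natCast]
      exact_mod_cast (hQ q hq).minFac_pow_factorization_eq.symm
    rw [← Real.rpow_natCast (_ ^ _) 2, ← Real.rpow_mul (Nat.cast_nonneg q), hq',
      ← Real.rpow_mul hp0]
    push_cast
    rw [← Real.rpow_natCast, ← Real.rpow_neg hp0]
    refine Real.rpow_le_rpow_of_exponent_le hp1 ?_
    have h1 : (q.factorization q.minFac : ℝ) ≤ 2 * d * E q := by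
      have := Nat.lt_div_mul_add (a := q.factorization q.minFac + 2 * d - 1)
        (b := 2 * d) (by positivity)
      have h2 : q.factorization q.minFac ≤ 2 * d * E q := by
        rw [mul_comm, hE]
        simp only
        omega
      exact_mod_cast h2
    have h2 : (q.factorization q.minFac : ℝ) * (-(1 / (4 * (d : ℝ))) * 2) =
        -((q.factorization q.minFac : ℝ) / (2 * d)) := by
      field_simp
      ring
    rw [h2]
    refine neg_le_neg ?_
    rw [div_le_iff₀ (by positivity)]
    linarith
  have h1 : (#((Icc 1 N ×ˢ Icc 1 N).filter (badPrimePow Q k i j)) : ℝ) ≤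
      ∑ q ∈ Q, 2 * N ^ 2 * ((q : ℝ) ^ (-(1 / (4 * (d : ℝ))))) ^ 2 := by
    refine (Nat.cast_le.2 ((card_le_card hsub).trans card_biUnion_le)).trans ?_
    push_cast
    refine sum_le_sum fun q hq => ?_
    refine (Nat.cast_le.2 (card_union_le _ _)).trans ?_
    rw [card_product, card_product, Nat.card_Icc, Nat.add_sub_cancel]
    push_cast
    have := hDle q hq
    calc _ = 2 * N * (#(D q) : ℝ) := by ring
      _ ≤ 2 * N * (N * ((q : ℝ) ^ (-(1 / (4 * (d : ℝ))))) ^ 2) := by gcongr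
      _ = _ := by ring
  refine h1.trans ?_
  rw [← mul_sum]
  gcongr
  exact sum_sq_le_sq_sum_of_nonneg fun q _ => by positivity

/-! ### Common factors of a binary form with its variables -/

lemma gcd_pow_right_dvd (r m k : ℕ) : Nat.gcd r (m ^ k) ∣ Nat.gcd r m ^ k := by
  induction k with
  | zero => simp
  | succ k ih =>
    rw [pow_succ, pow_succ]
    exact (Nat.gcd_mul_right_dvd_mul_gcd _ _ _).trans (mul_dvd_mul_right ih _)

lemma dvd_binaryForm_sub_left (d : ℕ) (c : Fin (d + 1) → ℤ) (m n : ℤ) :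
    m ∣ binaryForm d c m n - c 0 * n ^ d := by
  rw [binaryForm, Fin.sum_univ_succ]
  simp only [Fin.val_zero, pow_zero, mul_one, Nat.sub_zero, add_sub_cancel_left, Fin.val_succ]
  exact dvd_sum fun i _ => Dvd.intro (c i.succ * m ^ (i : ℕ) * n ^ (d - (i + 1))) (by ring)

lemma dvd_binaryForm_sub_right (d : ℕ) (c : Fin (d + 1) → ℤ) (m n : ℤ) :
    n ∣ binaryForm d c m n - c (Fin.last d) * m ^ d := by
  rw [binaryForm, Fin.sum_univ_castSucc]
  simp only [Fin.val_last, Nat.sub_self, pow_zero, mul_one, add_sub_cancel_right, Fin.val_castSucc]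
  refine dvd_sum fun i _ => ?_
  obtain ⟨e, he⟩ : ∃ e, d - (i : ℕ) = e + 1 := ⟨d - i - 1, by have := i.isLt; omega⟩
  rw [he]
  exact Dvd.intro (c i.castSucc * m ^ (i : ℕ) * n ^ e) (by ring)

lemma gcd_dvd_of_dvd_sub {g c n : ℤ} {m d : ℕ} (h : (m : ℤ) ∣ g - c * n ^ d) :
    Nat.gcd g.natAbs m ∣ Nat.gcd c.natAbs m * Nat.gcd n.natAbs m ^ d := by
  have h1 : Nat.gcd g.natAbs m ∣ (c * n ^ d).natAbs := by
    rw [← Int.natCast_dvd]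
    have a1 : ((Nat.gcd g.natAbs m : ℕ) : ℤ) ∣ g := Int.natCast_dvd.2 (Nat.gcd_dvd_left _ _)
    have a2 : ((Nat.gcd g.natAbs m : ℕ) : ℤ) ∣ g - c * n ^ d :=
      (Int.natCast_dvd_natCast.2 (Nat.gcd_dvd_right _ _)).trans h
    have a3 := dvd_sub a1 a2
    rwa [sub_sub_cancel] at a3
  rw [Int.natAbs_mul, Int.natAbs_pow] at h1
  have h2 := Nat.dvd_gcd (Nat.gcd_dvd_right g.natAbs m) h1
  refine h2.trans ((Nat.gcd_mul_right_dvd_mul_gcd _ _ _).trans ?_)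
  rw [Nat.gcd_comm m, Nat.gcd_comm n.natAbs]
  exact mul_dvd_mul_left _ (gcd_pow_right_dvd _ _ _)

/-- Modulo `m` the form is `c₀ n ^ d`, and modulo `n` it is `c_d m ^ d`; so the gcd of the form with
`m` divides `gcd(c₀, m) gcd(m, n) ^ d`, and similarly for `n`. -/
lemma gcd_binaryForm_dvd (d k i : ℕ) (c : Fin (d + 1) → ℤ) (m n : ℕ) :
    Nat.gcd (binaryForm d c m n).natAbs (m ^ k * n ^ i) ∣
      (Nat.gcd (c 0).natAbs m * Nat.gcd m n ^ d) ^ k *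
        (Nat.gcd (c (Fin.last d)).natAbs n * Nat.gcd m n ^ d) ^ i := by
  refine (Nat.gcd_mul_right_dvd_mul_gcd _ _ _).trans (mul_dvd_mul ?_ ?_)
  · refine (gcd_pow_right_dvd _ _ _).trans (pow_dvd_pow_of_dvd ?_ _)
    have := gcd_dvd_of_dvd_sub (dvd_binaryForm_sub_left d c m n)
    rwa [Int.natAbs_natCast, Nat.gcd_comm n m] at this
  · refine (gcd_pow_right_dvd _ _ _).trans (pow_dvd_pow_of_dvd ?_ _)
    have := gcd_dvd_of_dvd_sub (dvd_binaryForm_sub_right d c m n)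
    rwa [Int.natAbs_natCast] at this

/-! ### Sums over short progressions -/

/-- Equidistribution in long intervals bounds the sum over any interval, as the difference of the
sums over two long intervals. -/
lemma norm_progressionSum_le {F : ℤ → ℂ} {Q : Finset ℕ} {d : ℕ} {x L R δ₀ ℓ : ℝ}
    (hF : EquidistributedOutside F Q d x L R δ₀) {q v : ℕ} (hq1 : 1 ≤ q) (hqx : (q : ℝ) ≤ x ^ d)
    (hqQ : ∀ q' ∈ Q, ¬ q' ∣ q) (hv1 : 1 ≤ v) (hvq : v ≤ q)
    (hgcd : (Nat.gcd v q : ℝ) ≤ gcdThreshold x) (hLℓ : L < ℓ) (hℓ1 : 1 ≤ ℓ) (hℓR : 4 * ℓ ≤ R)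
    {p r : ℤ} (hp : -R ≤ p) (hr : (r : ℝ) ≤ R) (hpr : (r : ℝ) - p ≤ ℓ) :
    ‖∑ n ∈ (Icc p r).filter (fun n : ℤ => n ≡ (v : ℤ) [ZMOD (q : ℤ)]), F n‖ ≤
      δ₀ * (4 * ℓ / q) := by
  have hq0 : (0 : ℝ) < q := by exact_mod_cast hq1
  have hlong : ∀ s t : ℝ, -R ≤ s → t ≤ R → ℓ ≤ t - s →
      ‖progressionSum F q v s t‖ ≤ δ₀ * ((t - s) / q) := by
    intro s t hs ht hst
    have h := hF q hq1 hqx hqQ v hv1 hvq hgcd s t hs (by linarith) ht (by linarith)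
    have hst0 : 0 < t - s := by linarith
    rw [div_mul_eq_mul_div, div_le_iff₀ hst0] at h
    rw [← mul_div_assoc, le_div_iff₀ hq0]
    linarith
  have hδ₀ : 0 ≤ δ₀ := by
    have h := (norm_nonneg _).trans (hlong (-R) R le_rfl le_rfl (by linarith))
    by_contra! hneg
    have : 0 < (R - -R) / q := div_pos (by linarith) hq0
    nlinarith
  rcases lt_or_ge r p with hlt | hle
  · rw [Icc_eq_empty (not_le.2 hlt)]
    simp only [filter_empty, sum_empty, norm_zero]
    have : 0 ≤ ℓ := by linarith
    positivity
  have hle' : (p : ℝ) ≤ r := by exact_mod_cast hle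
  have hfin : ∀ {s₁ s₂ : ℝ}, s₁ ≤ 2 * ℓ + 1 → s₂ ≤ ℓ →
      δ₀ * (s₁ / q) + δ₀ * (s₂ / q) ≤ δ₀ * (4 * ℓ / q) := by
    intro s₁ s₂ h1 h2
    rw [← mul_add, ← add_div]
    gcongr
    linarith
  by_cases hroom : (r : ℝ) + 1 + ℓ ≤ R
  · have e : progressionSum F q v p (r + 1 + ℓ) =
        ∑ n ∈ (Icc p r).filter (fun n : ℤ => n ≡ (v : ℤ) [ZMOD (q : ℤ)]), F n +
        progressionSum F q v ((r + 1 : ℤ) : ℝ) (r + 1 + ℓ) := by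
      rw [progressionSum, progressionSum, Int.ceil_intCast, Int.ceil_intCast,
        ← sum_union (disjoint_left.2 fun n h1 h2 => by
          have a1 := (mem_Icc.1 (mem_filter.1 h1).1).2
          have a2 := (mem_Icc.1 (mem_filter.1 h2).1).1
          omega), ← filter_union]
      congr 2
      have hfl : r ≤ ⌊(r : ℝ) + 1 + ℓ⌋ := Int.le_floor.2 (by linarith)
      ext n
      simp only [mem_Icc, mem_union]
      omega
    have h1 := hlong p (r + 1 + ℓ) hp hroom (by linarith)
    have h2 := hlong ((r + 1 : ℤ) : ℝ) (r + 1 + ℓ) (by push_cast; linarith) hroom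
      (by push_cast; linarith)
    rw [eq_sub_of_add_eq e.symm]
    exact (norm_sub_le _ _).trans ((add_le_add h1 h2).trans
      (hfin (by linarith) (by push_cast; linarith)))
  · have hroom' : -R ≤ (p : ℝ) - 1 - ℓ := by linarith [not_le.1 hroom]
    have e : progressionSum F q v (p - 1 - ℓ) r =
        progressionSum F q v (p - 1 - ℓ) ((p - 1 : ℤ) : ℝ) +
        ∑ n ∈ (Icc p r).filter (fun n : ℤ => n ≡ (v : ℤ) [ZMOD (q : ℤ)]), F n := by
      rw [progressionSum, progressionSum, Int.floor_intCast, Int.floor_intCast,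
        ← sum_union (disjoint_left.2 fun n h1 h2 => by
          have a1 := (mem_Icc.1 (mem_filter.1 h1).1).2
          have a2 := (mem_Icc.1 (mem_filter.1 h2).1).1
          omega), ← filter_union]
      congr 2
      have hfl : ⌈(p : ℝ) - 1 - ℓ⌉ ≤ p := Int.ceil_le.2 (by linarith)
      ext n
      simp only [mem_Icc, mem_union]
      omega
    have h1 := hlong (p - 1 - ℓ) r hroom' hr (by linarith)
    have h2 := hlong (p - 1 - ℓ) ((p - 1 : ℤ) : ℝ) hroom' (by push_cast; linarith)
      (by push_cast; linarith)
    rw [eq_sub_of_add_eq' e.symm]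
    exact (norm_sub_le _ _).trans ((add_le_add h1 h2).trans
      (hfin (by linarith) (by push_cast; linarith)))

/-- The values of `F` along the progression `g + W y`, cut off to `|y| ≤ Y`. -/
noncomputable def progressionValues (F : ℤ → ℂ) (g W : ℤ) (Y : ℕ) (y : ℤ) : ℂ :=
  if y ∈ Icc (-(Y : ℤ)) Y then F (g + W * y) else 0

/-- The sum over `t` runs over terms of a single residue class modulo `W s`. The gcd of the class
with the modulus is at most `gcd(g, W) s`. -/
lemma norm_sum_progressionValues_le {F : ℤ → ℂ} {Q : Finset ℕ} {d : ℕ} {x L R δ₀ : ℝ}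
    (hF : EquidistributedOutside F Q d x L R δ₀) {g : ℤ} {W s T₁ Y : ℕ} (hW : 1 ≤ W) (hs : 1 ≤ s)
    (hT₁ : 1 ≤ T₁) (hqx : (W : ℝ) * s ≤ x ^ d) (hqQ : ∀ q' ∈ Q, ¬ q' ∣ W * s)
    (hgcd : (Nat.gcd g.natAbs W : ℝ) * s ≤ gcdThreshold x) (hL : L < W * s * T₁)
    (hR : 4 * ((W : ℝ) * s * T₁) ≤ R) (hgR : |(g : ℝ)| + W * Y ≤ R) (y : ℤ) :
    ‖∑ t ∈ range T₁, progressionValues F g W Y (y + t * (s : ℤ))‖ ≤ δ₀ * (4 * T₁) := by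
  have hq1 : 1 ≤ W * s := Nat.mul_pos hW hs
  have hW0 : (0 : ℝ) < W := by exact_mod_cast hW
  have hs0 : (0 : ℝ) < s := by exact_mod_cast hs
  have hqZ : (0 : ℤ) < ((W * s : ℕ) : ℤ) := by exact_mod_cast hq1
  have hWZ : (0 : ℤ) < W := by exact_mod_cast hW
  have hsZ : (0 : ℤ) < s := by exact_mod_cast hs
  -- a representative of the residue class in `[1, W s]`
  obtain ⟨v, hv1, hvq, hvmod⟩ : ∃ v : ℕ, 1 ≤ v ∧ v ≤ W * s ∧
      (v : ℤ) ≡ g + W * y [ZMOD ((W * s : ℕ) : ℤ)] := by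
    have h0 := Int.emod_nonneg (g + W * y - 1) hqZ.ne'
    have h1 := Int.emod_lt_of_pos (g + W * y - 1) hqZ
    refine ⟨((g + W * y - 1) % ((W * s : ℕ) : ℤ)).toNat + 1, by omega, by omega, ?_⟩
    rw [Nat.cast_succ, Int.toNat_of_nonneg h0]
    have := (Int.mod_modEq (g + W * y - 1) ((W * s : ℕ) : ℤ)).add_right 1
    rwa [sub_add_cancel] at this
  have hgcd' : (Nat.gcd v (W * s) : ℝ) ≤ gcdThreshold x := by
    refine le_trans ?_ hgcd
    have h1 : Nat.gcd v (W * s) ∣ Nat.gcd g.natAbs W * s := by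
      set D := Nat.gcd v (W * s)
      have a1 : (D : ℤ) ∣ g + W * y := by
        have b1 : (D : ℤ) ∣ (g + W * y) - v :=
          (Int.natCast_dvd_natCast.2 (Nat.gcd_dvd_right _ _)).trans hvmod.dvd
        have b2 : (D : ℤ) ∣ v := Int.natCast_dvd_natCast.2 (Nat.gcd_dvd_left _ _)
        have := dvd_add b1 b2
        rwa [sub_add_cancel] at this
      have a2 : D ∣ Nat.gcd (g + W * y).natAbs (W * s) :=
        Nat.dvd_gcd (Int.natCast_dvd.1 a1) (Nat.gcd_dvd_right _ _)
      refine a2.trans ((Nat.gcd_mul_right_dvd_mul_gcd _ _ _).trans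
        (mul_dvd_mul ?_ (Nat.gcd_dvd_right _ _)))
      refine Nat.dvd_gcd ?_ (Nat.gcd_dvd_right _ _)
      rw [← Int.natCast_dvd]
      have b1 : ((Nat.gcd (g + W * y).natAbs W : ℕ) : ℤ) ∣ g + W * y :=
        Int.natCast_dvd.2 (Nat.gcd_dvd_left _ _)
      have b2 : ((Nat.gcd (g + W * y).natAbs W : ℕ) : ℤ) ∣ W * y :=
        (Int.natCast_dvd_natCast.2 (Nat.gcd_dvd_right _ _)).trans (dvd_mul_right _ _)
      have := dvd_sub b1 b2
      rwa [add_sub_cancel_right] at this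
    have h2 : 0 < Nat.gcd g.natAbs W * s := Nat.mul_pos (Nat.gcd_pos_of_pos_right _ hW) hs
    exact_mod_cast Nat.le_of_dvd h2 h1
  set p : ℤ := g + W * max y (-(Y : ℤ)) with hp
  set r : ℤ := g + W * min (y + (T₁ - 1 : ℕ) * (s : ℤ)) Y with hr
  -- the sum over `t` is the sum of `F` over a progression
  have hsum : ∑ t ∈ range T₁, progressionValues F g W Y (y + t * (s : ℤ)) =
      ∑ n ∈ (Icc p r).filter (fun n : ℤ => n ≡ (v : ℤ) [ZMOD ((W * s : ℕ) : ℤ)]), F n := by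
    simp only [progressionValues]
    rw [← sum_filter]
    refine sum_bij (fun t _ => g + W * (y + t * (s : ℤ))) ?_ ?_ ?_ (fun _ _ => rfl)
    · intro t ht
      simp only [mem_filter, mem_range, mem_Icc] at ht ⊢
      obtain ⟨ht1, ht2, ht3⟩ := ht
      have ht4 : (t : ℤ) * s ≤ (T₁ - 1 : ℕ) * s :=
        mul_le_mul_of_nonneg_right (by omega) hsZ.le
      have ht5 : 0 ≤ (t : ℤ) * s := by positivity
      refine ⟨⟨?_, ?_⟩, ?_⟩
      · rw [hp]
        have : max y (-(Y : ℤ)) ≤ y + t * s := max_le (by omega) (by omega)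
        have := mul_le_mul_of_nonneg_left this hWZ.le
        linarith
      · rw [hr]
        have : y + t * s ≤ min (y + (T₁ - 1 : ℕ) * (s : ℤ)) Y := le_min (by omega) (by omega)
        have := mul_le_mul_of_nonneg_left this hWZ.le
        linarith
      · refine Int.ModEq.trans ?_ hvmod.symm
        exact (Int.modEq_iff_dvd).2 ⟨-t, by push_cast; ring⟩
    · intro t₁ _ t₂ _ h
      have h1 := mul_left_cancel₀ hWZ.ne' (add_left_cancel h)
      have h2 := mul_right_cancel₀ hsZ.ne' (add_left_cancel h1)
      exact_mod_cast h2
    · intro n hn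
      simp only [mem_filter, mem_Icc] at hn
      obtain ⟨⟨hn1, hn2⟩, hn3⟩ := hn
      obtain ⟨t, ht⟩ := ((hn3.trans hvmod).symm).dvd
      have hnt : n = g + W * (y + t * s) := by
        push_cast at ht
        linear_combination ht
      rw [hnt, hp] at hn1
      rw [hnt, hr] at hn2
      have h1 := le_of_mul_le_mul_left (by linarith : (W : ℤ) * max y (-(Y : ℤ)) ≤ W * (y + t * s)) hWZ
      have h2 := le_of_mul_le_mul_left (by linarith : (W : ℤ) * (y + t * s) ≤
        W * min (y + (T₁ - 1 : ℕ) * (s : ℤ)) Y) hWZ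
      have h3 : 0 ≤ t := by
        have : (0 : ℤ) ≤ t * s := by have := le_max_left y (-(Y : ℤ)); omega
        exact nonneg_of_mul_nonneg_left this hsZ
      have h4 : t ≤ (T₁ - 1 : ℕ) := by
        have : t * (s : ℤ) ≤ (T₁ - 1 : ℕ) * s := by
          have := min_le_left (y + (T₁ - 1 : ℕ) * (s : ℤ)) Y
          omega
        exact le_of_mul_le_mul_right this hsZ
      lift t to ℕ using h3
      refine ⟨t, ?_, hnt.symm⟩
      simp only [mem_filter, mem_range, mem_Icc]
      have a1 := le_max_right y (-(Y : ℤ))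
      have a2 := min_le_right (y + (T₁ - 1 : ℕ) * (s : ℤ)) Y
      exact ⟨by omega, by omega, by omega⟩
  rw [hsum]
  have hℓ1 : (1 : ℝ) ≤ W * s * T₁ := by exact_mod_cast Nat.mul_pos hq1 hT₁
  rcases lt_or_ge r p with hlt | hle
  · rw [Icc_eq_empty (not_le.2 hlt)]
    simp only [filter_empty, sum_empty, norm_zero]
    have h := hF (W * s) hq1 (by exact_mod_cast hqx) hqQ v hv1 hvq hgcd' (-R) R le_rfl
      (by linarith) le_rfl (by linarith)
    have h0 : 0 ≤ δ₀ := le_trans (mul_nonneg (div_nonneg (by positivity) (by linarith))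
      (norm_nonneg _)) h
    positivity
  have hmaxmin : max y (-(Y : ℤ)) ≤ min (y + (T₁ - 1 : ℕ) * (s : ℤ)) Y := by
    refine le_of_mul_le_mul_left ?_ hWZ
    rw [hp, hr] at hle
    linarith
  have hYmin : min (y + (T₁ - 1 : ℕ) * (s : ℤ)) Y ≤ Y := min_le_right _ _
  have hYmax : -(Y : ℤ) ≤ max y (-(Y : ℤ)) := le_max_right _ _
  have hpR : -R ≤ (p : ℝ) := by
    have h1 : -(Y : ℝ) ≤ ((max y (-(Y : ℤ)) : ℤ) : ℝ) := by exact_mod_cast hYmax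
    have h2 := mul_le_mul_of_nonneg_left h1 hW0.le
    rw [hp, Int.cast_add, Int.cast_mul, Int.cast_natCast]
    linarith [neg_abs_le (g : ℝ)]
  have hrR : (r : ℝ) ≤ R := by
    have h1 : ((min (y + (T₁ - 1 : ℕ) * (s : ℤ)) Y : ℤ) : ℝ) ≤ Y := by exact_mod_cast hYmin
    have h2 := mul_le_mul_of_nonneg_left h1 hW0.le
    rw [hr, Int.cast_add, Int.cast_mul, Int.cast_natCast]
    linarith [le_abs_self (g : ℝ)]
  have hlen : (r : ℝ) - p ≤ W * s * T₁ := by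
    have h1 : min (y + (T₁ - 1 : ℕ) * (s : ℤ)) Y - max y (-(Y : ℤ)) ≤ s * T₁ := by
      have a1 := min_le_left (y + (T₁ - 1 : ℕ) * (s : ℤ)) Y
      have a2 := le_max_left y (-(Y : ℤ))
      have a3 : ((T₁ - 1 : ℕ) : ℤ) * s ≤ s * T₁ := by
        rw [mul_comm]
        exact mul_le_mul_of_nonneg_left (by omega) hsZ.le
      omega
    have h2 := mul_le_mul_of_nonneg_left h1 hWZ.le
    have h3 : r - p ≤ W * s * T₁ := by rw [hr, hp]; linarith
    exact_mod_cast h3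
  have h := norm_progressionSum_le hF hq1 (by exact_mod_cast hqx) hqQ hv1 hvq hgcd' hL hℓ1 hR
    hpR hrR hlen
  refine h.trans (le_of_eq ?_)
  push_cast
  field_simp

/-! ### Correlations of the values at two pairs -/

/-- The square `[-h, h]²` in `ℤ²`. -/
noncomputable def intBox (h : ℤ) : Finset (ℤ × ℤ) := Icc (-h) h ×ˢ Icc (-h) h

lemma mem_intBox {h : ℤ} {p : ℤ × ℤ} : p ∈ intBox h ↔ |p.1| ≤ h ∧ |p.2| ≤ h := by
  rw [intBox, mem_product, mem_Icc, mem_Icc, abs_le, abs_le]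

lemma card_filter_linear_eq_le {a b : ℕ} (ha : 1 ≤ a) (hab : Nat.Coprime a b) (h y : ℤ) :
    (#((intBox h).filter fun p => p.1 * a + p.2 * b = y) : ℝ) ≤ (#(Icc (-h) h) : ℝ) / a + 1 := by
  rcases ((intBox h).filter fun p => p.1 * (a : ℤ) + p.2 * b = y).eq_empty_or_nonempty
    with he | ⟨p₀, hp₀⟩
  · rw [he]
    simp only [card_empty, Nat.cast_zero]
    positivity
  refine le_trans ?_ (card_filter_modEq_le (-h) h p₀.2 ha)
  have haZ : (a : ℤ) ≠ 0 := by exact_mod_cast (by omega : a ≠ 0)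
  refine Nat.cast_le.2 (card_le_card_of_injOn Prod.snd ?_ ?_)
  · intro p hp
    obtain ⟨hp1, hp2⟩ := mem_filter.1 hp
    have hp3 := (mem_filter.1 hp₀).2
    rw [mem_coe, mem_filter]
    refine ⟨(mem_product.1 hp1).2, (Int.modEq_iff_dvd).2 ?_⟩
    have hcop : IsCoprime (a : ℤ) (b : ℤ) := Nat.isCoprime_iff_coprime.2 hab
    exact hcop.dvd_of_dvd_mul_right ⟨p.1 - p₀.1, by linear_combination hp3 - hp2⟩
  · intro p hp p' hp' h2
    have e1 := (mem_filter.1 hp).2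
    have e2 := (mem_filter.1 hp').2
    refine Prod.ext (mul_right_cancel₀ haZ ?_) h2
    rw [h2] at e1
    linarith

lemma card_filter_linear_eq_le_max {a b : ℕ} (ha : 1 ≤ a) (hb : 1 ≤ b) (hab : Nat.Coprime a b)
    (h y : ℤ) : (#((intBox h).filter fun p => p.1 * a + p.2 * b = y) : ℝ) ≤
      (#(Icc (-h) h) : ℝ) / max a b + 1 := by
  rcases le_total a b with hle | hle
  · rw [max_eq_right (by exact_mod_cast hle)]
    refine le_trans (Nat.cast_le.2 ?_) (card_filter_linear_eq_le hb hab.symm h y)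
    refine card_le_card_of_injOn Prod.swap ?_ Prod.swap_injective.injOn
    intro p hp
    obtain ⟨hp1, hp2⟩ := mem_filter.1 hp
    obtain ⟨h1, h2⟩ := mem_product.1 hp1
    exact mem_filter.2 ⟨mem_product.2 ⟨h2, h1⟩, by simpa [add_comm] using hp2⟩
  · rw [max_eq_left (by exact_mod_cast hle)]
    exact card_filter_linear_eq_le ha hab h y

/-- Summing a function of `y = p₁ a + p₂ b` over a box, for coprime `a`, `b`. -/
lemma sum_linear_le {a b : ℕ} (ha : 1 ≤ a) (hb : 1 ≤ b) (hab : Nat.Coprime a b) (h : ℕ)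
    {φ : ℤ → ℝ} (hφ : ∀ y, 0 ≤ φ y) :
    ∑ p ∈ intBox h, φ (p.1 * a + p.2 * b) ≤
      ((#(Icc (-(h : ℤ)) h) : ℝ) / max a b + 1) *
        ∑ y ∈ Icc (-((h * (a + b) : ℕ) : ℤ)) (h * (a + b) : ℕ), φ y := by
  rw [← sum_fiberwise_of_maps_to (s := intBox h)
    (t := Icc (-((h * (a + b) : ℕ) : ℤ)) (h * (a + b) : ℕ)) (g := fun p => p.1 * a + p.2 * b)]
  · rw [mul_sum]
    refine sum_le_sum fun y _ => ?_
    have e : ∀ p ∈ (intBox h).filter (fun p => p.1 * (a : ℤ) + p.2 * b = y),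
        φ (p.1 * a + p.2 * b) = φ y := fun p hp => by rw [(mem_filter.1 hp).2]
    rw [sum_congr rfl e, sum_const, nsmul_eq_mul]
    exact mul_le_mul_of_nonneg_right (card_filter_linear_eq_le_max ha hb hab h y) (hφ y)
  · intro p hp
    obtain ⟨h1, h2⟩ := mem_intBox.1 hp
    rw [mem_Icc, ← abs_le]
    push_cast
    calc |p.1 * (a : ℤ) + p.2 * b| ≤ |p.1 * (a : ℤ)| + |p.2 * (b : ℤ)| := abs_add_le _ _
      _ = |p.1| * a + |p.2| * b := by rw [abs_mul, abs_mul, Nat.abs_cast, Nat.abs_cast]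
      _ ≤ h * a + h * b := by gcongr
      _ = _ := by ring

/-- Averaging over translates by a short vector changes a sum over a box only near its edge. -/
lemma norm_sum_intBox_le (φ : ℤ × ℤ → ℂ) (h E : ℤ) (e : ℤ × ℤ) {T : ℕ} (hT : 1 ≤ T)
    (h1 : T * |e.1| ≤ E) (h2 : T * |e.2| ≤ E) :
    ‖∑ p ∈ intBox h, φ p‖ ≤
      1 / T * ‖∑ p ∈ intBox (h - E), ∑ t ∈ range T, φ (p.1 + t * e.1, p.2 + t * e.2)‖ +
      ∑ p ∈ intBox h \ intBox (h - 2 * E), ‖φ p‖ := by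
  have hT0 : (0 : ℝ) < T := by exact_mod_cast hT
  have hstep : ∀ t ∈ range T, ‖∑ p ∈ intBox h, φ p -
      ∑ p ∈ intBox (h - E), φ (p.1 + t * e.1, p.2 + t * e.2)‖ ≤
      ∑ p ∈ intBox h \ intBox (h - 2 * E), ‖φ p‖ := by
    intro t ht
    have htT : (t : ℤ) ≤ T := by exact_mod_cast (mem_range.1 ht).le
    have b1 : |t * e.1| ≤ E := by
      rw [abs_mul, Nat.abs_cast]
      exact (mul_le_mul_of_nonneg_right htT (abs_nonneg _)).trans h1
    have b2 : |t * e.2| ≤ E := by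
      rw [abs_mul, Nat.abs_cast]
      exact (mul_le_mul_of_nonneg_right htT (abs_nonneg _)).trans h2
    rw [abs_le] at b1 b2
    set S := (intBox (h - E)).map (Equiv.addRight (((t : ℤ) * e.1, (t : ℤ) * e.2) : ℤ × ℤ)).toEmbedding
      with hS
    have hsum : ∑ p ∈ intBox (h - E), φ (p.1 + t * e.1, p.2 + t * e.2) = ∑ p ∈ S, φ p := by
      rw [hS, sum_map]
      rfl
    have hSsub : S ⊆ intBox h := by
      intro p hp
      obtain ⟨p', hp', rfl⟩ := mem_map.1 hp
      obtain ⟨a1, a2⟩ := mem_intBox.1 hp'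
      rw [abs_le] at a1 a2
      refine mem_intBox.2 ⟨abs_le.2 ⟨?_, ?_⟩, abs_le.2 ⟨?_, ?_⟩⟩ <;>
        simp only [Equiv.coe_toEmbedding, Equiv.coe_addRight, Prod.fst_add, Prod.snd_add] <;> omega
    have hSsup : intBox (h - 2 * E) ⊆ S := by
      intro p hp
      obtain ⟨a1, a2⟩ := mem_intBox.1 hp
      rw [abs_le] at a1 a2
      refine mem_map.2 ⟨(p.1 - t * e.1, p.2 - t * e.2), mem_intBox.2 ⟨abs_le.2 ⟨?_, ?_⟩,
        abs_le.2 ⟨?_, ?_⟩⟩, ?_⟩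
      · simp only; omega
      · simp only; omega
      · simp only; omega
      · simp only; omega
      · ext <;> simp
    rw [hsum, ← sum_sdiff hSsub, add_sub_cancel_right]
    refine (norm_sum_le _ _).trans (sum_le_sum_of_subset_of_nonneg
      (sdiff_subset_sdiff subset_rfl hSsup) fun _ _ _ => norm_nonneg _)
  set Z := ∑ p ∈ intBox h, φ p with hZ
  set err := ∑ p ∈ intBox h \ intBox (h - 2 * E), ‖φ p‖ with herr
  have hid : (T : ℂ) * Z = ∑ p ∈ intBox (h - E), ∑ t ∈ range T, φ (p.1 + t * e.1, p.2 + t * e.2) +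
      ∑ t ∈ range T, (Z - ∑ p ∈ intBox (h - E), φ (p.1 + t * e.1, p.2 + t * e.2)) := by
    rw [sum_sub_distrib, sum_const, card_range, nsmul_eq_mul,
      sum_comm (s := range T) (t := intBox (h - E))]
    ring
  have hn : T * ‖Z‖ ≤ ‖∑ p ∈ intBox (h - E), ∑ t ∈ range T, φ (p.1 + t * e.1, p.2 + t * e.2)‖ +
      T * err := by
    have h3 : (T : ℝ) * ‖Z‖ = ‖(T : ℂ) * Z‖ := by rw [norm_mul, Complex.norm_natCast]
    rw [h3, hid]
    refine (norm_add_le _ _).trans (add_le_add_right ?_ _)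
    refine (norm_sum_le _ _).trans ((sum_le_sum hstep).trans ?_)
    rw [sum_const, card_range, nsmul_eq_mul]
  have h4 : ‖Z‖ ≤ 1 / T * (‖∑ p ∈ intBox (h - E), ∑ t ∈ range T,
      φ (p.1 + t * e.1, p.2 + t * e.2)‖ + T * err) := by
    rw [one_div, inv_mul_eq_div, le_div_iff₀ hT0]
    linarith
  refine h4.trans (le_of_eq ?_)
  field_simp

lemma sum_norm_mul_norm_le {ι : Type*} (s : Finset ι) (f g : ι → ℂ) :
    ∑ i ∈ s, ‖f i‖ * ‖g i‖ ≤ √(∑ i ∈ s, ‖f i‖ ^ 2) * √(∑ i ∈ s, ‖g i‖ ^ 2) :=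
  Real.sum_mul_le_sqrt_mul_sqrt _ _ _

/-- The linear form `L(p) = p₁ X + p₂ Y + g`. -/
def affineForm (X Y : ℕ) (g : ℤ) (p : ℤ × ℤ) : ℤ := p.1 * X + p.2 * Y + g

/-- The correlation over a box of the values of `F` at two affine forms. The first form is
`W (p₁ a + p₂ b) + g`, and the box is swept out by segments on which the second form is constant,
so that the correlation is governed by sums of `F` along progressions. -/
lemma norm_correlation_le (F : ℤ → ℂ) {W a b : ℕ} (ha : 1 ≤ a) (hb : 1 ≤ b)
    (hab : Nat.Coprime a b) (g : ℤ) (X₂ Y₂ : ℕ) (g₂ : ℤ) {e₁ e₂ : ℕ} (he : e₁ * X₂ = e₂ * Y₂)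
    (h E T : ℕ) (hT : 1 ≤ T) (h1 : T * e₁ ≤ E) (h2 : T * e₂ ≤ E) :
    ‖∑ p ∈ intBox h, F (affineForm (W * a) (W * b) g p) *
        (starRingEnd ℂ) (F (affineForm X₂ Y₂ g₂ p))‖ ≤
      1 / T * √((∑ p ∈ intBox h, ‖F (affineForm X₂ Y₂ g₂ p)‖ ^ 2) *
        (((#(Icc (-(h : ℤ)) h) : ℝ) / max a b + 1) *
          ∑ y ∈ Icc (-((h * (a + b) : ℕ) : ℤ)) (h * (a + b) : ℕ),
            ‖∑ t ∈ range T, progressionValues F g W (h * (a + b))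
              (y + t * ((a : ℤ) * e₁ - b * e₂))‖ ^ 2)) +
      √(∑ p ∈ intBox h \ intBox (h - 2 * E), ‖F (affineForm (W * a) (W * b) g p)‖ ^ 2) *
        √(∑ p ∈ intBox h \ intBox (h - 2 * E), ‖F (affineForm X₂ Y₂ g₂ p)‖ ^ 2) := by
  set q : ℤ := (a : ℤ) * e₁ - b * e₂ with hq
  set f := progressionValues F g W (h * (a + b)) with hf
  refine (norm_sum_intBox_le _ h E ((e₁ : ℤ), -(e₂ : ℤ)) hT ?_ ?_).trans (add_le_add ?_ ?_)
  · simpa using (by exact_mod_cast h1 : (T : ℤ) * e₁ ≤ E)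
  · simpa using (by exact_mod_cast h2 : (T : ℤ) * e₂ ≤ E)
  · refine mul_le_mul_of_nonneg_left ?_ (by positivity)
    have hinner : ∀ p ∈ intBox ((h : ℤ) - E), ∑ t ∈ range T,
        F (affineForm (W * a) (W * b) g (p.1 + t * (e₁ : ℤ), p.2 + t * -(e₂ : ℤ))) *
          (starRingEnd ℂ) (F (affineForm X₂ Y₂ g₂ (p.1 + t * (e₁ : ℤ), p.2 + t * -(e₂ : ℤ)))) =
        (starRingEnd ℂ) (F (affineForm X₂ Y₂ g₂ p)) *
          ∑ t ∈ range T, f (p.1 * a + p.2 * b + t * q) := by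
      intro p hp
      rw [mul_sum]
      refine sum_congr rfl fun t ht => ?_
      have e1 : affineForm X₂ Y₂ g₂ (p.1 + t * (e₁ : ℤ), p.2 + t * -(e₂ : ℤ)) =
          affineForm X₂ Y₂ g₂ p := by
        have : (e₁ : ℤ) * X₂ = e₂ * Y₂ := by exact_mod_cast he
        simp only [affineForm]
        linear_combination (t : ℤ) * this
      rw [e1, mul_comm]
      congr 1
      rw [hf, progressionValues, if_pos]
      · congr 1
        simp only [affineForm, hq]
        push_cast
        ring
      · obtain ⟨a1, a2⟩ := mem_intBox.1 hp
        have htT : (t : ℤ) ≤ T := by exact_mod_cast (mem_range.1 ht).le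
        have c1 : (t : ℤ) * e₁ ≤ E :=
          (mul_le_mul_of_nonneg_right htT (by positivity)).trans (by exact_mod_cast h1)
        have c2 : (t : ℤ) * e₂ ≤ E :=
          (mul_le_mul_of_nonneg_right htT (by positivity)).trans (by exact_mod_cast h2)
        have c3 : 0 ≤ (t : ℤ) * e₁ := by positivity
        have c4 : 0 ≤ (t : ℤ) * e₂ := by positivity
        rw [abs_le] at a1 a2
        have d1 : |p.1 + t * (e₁ : ℤ)| ≤ h := abs_le.2 ⟨by omega, by omega⟩
        have d2 : |p.2 - t * (e₂ : ℤ)| ≤ h := abs_le.2 ⟨by omega, by omega⟩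
        rw [mem_Icc, ← abs_le]
        have e3 : p.1 * (a : ℤ) + p.2 * b + t * q =
            (p.1 + t * (e₁ : ℤ)) * a + (p.2 - t * (e₂ : ℤ)) * b := by rw [hq]; ring
        rw [e3]
        push_cast
        calc _ ≤ |(p.1 + t * (e₁ : ℤ)) * a| + |(p.2 - t * (e₂ : ℤ)) * b| := abs_add_le _ _
          _ = |p.1 + t * (e₁ : ℤ)| * a + |p.2 - t * (e₂ : ℤ)| * b := by
              rw [abs_mul, abs_mul, Nat.abs_cast, Nat.abs_cast]
          _ ≤ h * a + h * b := by gcongr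
          _ = _ := by ring
    rw [sum_congr rfl hinner]
    have hbox : intBox ((h : ℤ) - E) ⊆ intBox h := fun p hp => by
      obtain ⟨a1, a2⟩ := mem_intBox.1 hp
      exact mem_intBox.2 ⟨by omega, by omega⟩
    calc _ ≤ ∑ p ∈ intBox ((h : ℤ) - E), ‖F (affineForm X₂ Y₂ g₂ p)‖ *
            ‖∑ t ∈ range T, f (p.1 * a + p.2 * b + t * q)‖ := by
          refine (norm_sum_le _ _).trans (le_of_eq (sum_congr rfl fun p _ => ?_))
          rw [norm_mul, RCLike.norm_conj]
      _ ≤ √(∑ p ∈ intBox ((h : ℤ) - E), ‖F (affineForm X₂ Y₂ g₂ p)‖ ^ 2) *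
          √(∑ p ∈ intBox ((h : ℤ) - E), ‖∑ t ∈ range T, f (p.1 * a + p.2 * b + t * q)‖ ^ 2) :=
          sum_norm_mul_norm_le _ _ _
      _ ≤ √(∑ p ∈ intBox h, ‖F (affineForm X₂ Y₂ g₂ p)‖ ^ 2) *
          √(∑ p ∈ intBox h, ‖∑ t ∈ range T, f (p.1 * a + p.2 * b + t * q)‖ ^ 2) := by
          gcongr
      _ ≤ √(∑ p ∈ intBox h, ‖F (affineForm X₂ Y₂ g₂ p)‖ ^ 2) * √(((#(Icc (-(h : ℤ)) h) : ℝ) /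
            max a b + 1) * ∑ y ∈ Icc (-((h * (a + b) : ℕ) : ℤ)) (h * (a + b) : ℕ),
              ‖∑ t ∈ range T, f (y + t * q)‖ ^ 2) := by
          gcongr
          exact sum_linear_le (φ := fun y => ‖∑ t ∈ range T, f (y + t * q)‖ ^ 2) ha hb hab h
            fun y => by positivity
      _ = _ := (Real.sqrt_mul (by positivity) _).symm
  · refine le_trans (le_of_eq (sum_congr rfl fun p _ => ?_)) (sum_norm_mul_norm_le _ _ _)
    rw [norm_mul, RCLike.norm_conj]

/-! ### Denominators of the major arcs -/

/-- The relative sizes of the parameters: `Λ` is a large power of `log x`, hence small compared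
with `x`; `N` is the number of values of each variable; and `x ^ (2 d) ≤ H`. -/
structure Scale (d j : ℕ) (Λ x H : ℝ) (N : ℕ) : Prop where
  one_le_j : 1 ≤ j
  j_le_d : j ≤ d
  large : 10 ^ 6 * 64 ^ d * ((d : ℝ) + 3) ^ 2 ≤ Λ
  pow_le : Λ ^ (200 * d ^ 3) ≤ x
  x_le : x ≤ 4 * N
  N_le : (N : ℝ) ≤ x
  x_pow_le : x ^ (2 * d) ≤ H

namespace Scale

variable {d j : ℕ} {Λ x H : ℝ} {N : ℕ}

lemma one_le_d (S : Scale d j Λ x H N) : 1 ≤ d := S.one_le_j.trans S.j_le_d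

lemma const_le (S : Scale d j Λ x H N) : (10 : ℝ) ^ 6 ≤ Λ := by
  refine le_trans ?_ S.large
  have h1 : (1 : ℝ) ≤ 64 ^ d := one_le_pow₀ (by norm_num)
  have h2 : (1 : ℝ) ≤ ((d : ℝ) + 3) ^ 2 := one_le_pow₀ (by linarith [d.cast_nonneg (α := ℝ)])
  nlinarith [mul_le_mul h1 h2 zero_le_one (by positivity)]

lemma pow64_le (S : Scale d j Λ x H N) : (10 : ℝ) ^ 6 * 64 ^ d ≤ Λ := by
  refine le_trans ?_ S.large
  have h2 : (1 : ℝ) ≤ ((d : ℝ) + 3) ^ 2 := one_le_pow₀ (by linarith [d.cast_nonneg (α := ℝ)])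
  have : (0 : ℝ) ≤ 10 ^ 6 * 64 ^ d := by positivity
  nlinarith

lemma d_le (S : Scale d j Λ x H N) : (10 : ℝ) ^ 6 * ((d : ℝ) + 3) ^ 2 ≤ Λ := by
  refine le_trans ?_ S.large
  have h1 : (1 : ℝ) ≤ 64 ^ d := one_le_pow₀ (by norm_num)
  have : (0 : ℝ) ≤ 10 ^ 6 * ((d : ℝ) + 3) ^ 2 := by positivity
  nlinarith

lemma one_le (S : Scale d j Λ x H N) : 1 ≤ Λ := by have := S.const_le; norm_num at this; linarith

lemma pos (S : Scale d j Λ x H N) : 0 < Λ := by linarith [S.one_le]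

lemma pow_le_x (S : Scale d j Λ x H N) {e : ℕ} (he : e ≤ 200 * d ^ 3) : Λ ^ e ≤ x :=
  (pow_le_pow_right₀ S.one_le he).trans S.pow_le

lemma one_le_x (S : Scale d j Λ x H N) : 1 ≤ x := by simpa using S.pow_le_x (Nat.zero_le _)

lemma x_pos (S : Scale d j Λ x H N) : 0 < x := by linarith [S.one_le_x]

lemma x_pow_j_sq_le (S : Scale d j Λ x H N) : x ^ j * x ^ j ≤ H := by
  rw [← pow_add]
  exact (pow_le_pow_right₀ S.one_le_x (by have := S.j_le_d; omega)).trans S.x_pow_le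

lemma one_le_H (S : Scale d j Λ x H N) : 1 ≤ H := (one_le_pow₀ S.one_le_x).trans S.x_pow_le

lemma H_pos (S : Scale d j Λ x H N) : 0 < H := by linarith [S.one_le_H]

lemma x_le_pow_j (S : Scale d j Λ x H N) : x ≤ x ^ j :=
  le_self_pow₀ S.one_le_x (by have := S.one_le_j; omega)

lemma one_le_pow_j (S : Scale d j Λ x H N) : 1 ≤ x ^ j := one_le_pow₀ S.one_le_x

/-- Powers of `Λ` are absorbed by a power of `x ^ j / H`. -/
lemma pow_mul_div_le (S : Scale d j Λ x H N) {e : ℕ} (he : e + 1 ≤ 200 * d ^ 3) :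
    Λ ^ e * x ^ j / H ≤ 1 / Λ := by
  rw [div_le_div_iff₀ S.H_pos S.pos]
  calc Λ ^ e * x ^ j * Λ = Λ ^ (e + 1) * x ^ j := by rw [pow_succ]; ring
    _ ≤ x ^ j * x ^ j := by
        have := S.x_pos
        gcongr
        exact (S.pow_le_x he).trans S.x_le_pow_j
    _ ≤ 1 * H := by rw [one_mul]; exact S.x_pow_j_sq_le

end Scale

lemma pow_le_cube {d : ℕ} (hd : 1 ≤ d) : 1 ≤ d ^ 3 ∧ d ≤ d ^ 3 ∧ d ^ 2 ≤ d ^ 3 :=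
  ⟨Nat.one_le_pow _ _ hd, Nat.le_self_pow (by norm_num) d, Nat.pow_le_pow_right hd (by norm_num)⟩

set_option maxHeartbeats 2000000 in
/-- A frequency `θ` for which `q_v θ` is near an integer for more than `N² / Λ⁶` of the pairs `v`
lies in a major arc. -/
lemma exists_major_denominator {d j : ℕ} {Λ x H : ℝ} {N : ℕ} (S : Scale d j Λ x H N) {a b : ℕ}
    (ha : 1 ≤ a) (hb : 1 ≤ b) (hab : Nat.Coprime a b) (hax : (a : ℝ) ≤ x ^ j)
    (hbx : (b : ℝ) ≤ x ^ j) (hmax : x ^ j / Λ ^ (11 * d) ≤ ((max a b : ℕ) : ℝ))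
    {δ θ : ℝ} (hδ0 : 0 ≤ δ) (hδ : δ ≤ 4 * Λ ^ 6 * x ^ j / H) {Z : Finset (ℕ × ℕ)}
    (hZ : Z ⊆ Icc 1 N ×ˢ Icc 1 N)
    (hnear : ∀ z ∈ Z, NearInt (θ * (a * (z.1 : ℝ) ^ j - b * (z.2 : ℝ) ^ j)) δ)
    (hcard : (N : ℝ) ^ 2 / Λ ^ 6 < #Z) :
    ∃ s : ℕ, 1 ≤ s ∧ (s : ℝ) ≤ Λ ^ (28 * d ^ 2) ∧
      NearInt (s * θ) (Λ ^ (80 * d ^ 3) / (H * x ^ j)) := by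
  have hd1 := S.one_le_d
  obtain ⟨hc1, hc2, hc3⟩ := pow_le_cube hd1
  have hΛ1 := S.one_le
  have hΛ0 := S.pos
  have hx0 := S.x_pos
  have hH0 := S.H_pos
  have hΛc := S.const_le
  have hΛd := S.d_le
  have hj1 := S.one_le_j
  have hjd : (j : ℝ) ≤ d := by exact_mod_cast S.j_le_d
  have hj1R : (1 : ℝ) ≤ j := by exact_mod_cast hj1
  have hNx : x ≤ 4 * N := S.x_le
  have hN0 : (0 : ℝ) < N := by linarith
  have hd0 : (0 : ℝ) ≤ d := d.cast_nonneg
  -- `N` exceeds any power of `Λ` that occurs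
  have hNpow : ∀ e : ℕ, e + 1 ≤ 200 * d ^ 3 → (10 : ℝ) ^ 5 * Λ ^ e ≤ N := by
    intro e he
    have h1 := S.pow_le_x he
    rw [pow_succ] at h1
    have h2 : Λ ^ e * 10 ^ 6 ≤ Λ ^ e * Λ := by gcongr
    norm_num at h2 ⊢
    linarith
  set L : ℕ := ⌊(N : ℝ) / Λ ^ 6⌋₊ with hL
  have hLle : (L : ℝ) ≤ N / Λ ^ 6 := Nat.floor_le (by positivity)
  have hLge : (N : ℝ) / Λ ^ 6 - 1 ≤ L := (Nat.sub_one_lt_floor _).le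
  have hN6 : (10 : ℝ) ^ 5 * Λ ≤ N / Λ ^ 6 := by
    rw [le_div_iff₀ (by positivity), mul_assoc, ← pow_succ']
    exact hNpow 7 (by omega)
  have hLge2 : (N : ℝ) / Λ ^ 6 / 2 ≤ L := by
    norm_num at hN6 ⊢
    linarith
  have hNL : N * L < #Z := by
    have : (N : ℝ) * L ≤ N ^ 2 / Λ ^ 6 := by
      calc (N : ℝ) * L ≤ N * (N / Λ ^ 6) := by gcongr
        _ = _ := by ring
    exact_mod_cast this.trans_lt hcard
  -- the short window: `N / w₁` windows with `j` elements each stay below `L`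
  set w₁ : ℕ := ⌈4 * j * Λ ^ 6⌉₊ with hw₁
  have hw₁ge : 4 * j * Λ ^ 6 ≤ (w₁ : ℝ) := Nat.le_ceil _
  have hw₁le : (w₁ : ℝ) ≤ Λ ^ 7 := by
    have h1 := (Nat.ceil_lt_add_one (by positivity : (0 : ℝ) ≤ 4 * j * Λ ^ 6)).le
    have h2 : (1 : ℝ) ≤ Λ ^ 6 := one_le_pow₀ hΛ1
    have h3 : (4 : ℝ) * j + 1 ≤ Λ := by nlinarith
    calc (w₁ : ℝ) ≤ 4 * j * Λ ^ 6 + 1 := h1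
      _ ≤ 4 * j * Λ ^ 6 + Λ ^ 6 := by linarith
      _ = (4 * j + 1) * Λ ^ 6 := by ring
      _ ≤ Λ * Λ ^ 6 := by gcongr
      _ = Λ ^ 7 := by ring
  have hw₁1 : 1 ≤ w₁ := Nat.one_le_ceil_iff.2 (by positivity)
  have hw₁0 : (0 : ℝ) < w₁ := by exact_mod_cast hw₁1
  have h₁ : j * (N / w₁ + 1) ≤ L := by
    have e1 : ((N / w₁ : ℕ) : ℝ) ≤ N / (4 * j * Λ ^ 6) :=
      Nat.cast_div_le.trans (by gcongr)
    have e2 : (j : ℝ) * (N / (4 * j * Λ ^ 6)) = N / Λ ^ 6 / 4 := by field_simp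
    have e3 : (j : ℝ) ≤ N / Λ ^ 6 / 4 := by
      have : (j : ℝ) ≤ Λ := by nlinarith
      norm_num at hN6
      linarith
    have : ((j * (N / w₁ + 1) : ℕ) : ℝ) ≤ L := by
      rw [Nat.cast_mul, Nat.cast_add, Nat.cast_one]
      calc (j : ℝ) * (((N / w₁ : ℕ) : ℝ) + 1) ≤ j * (N / (4 * j * Λ ^ 6) + 1) := by gcongr
        _ = N / Λ ^ 6 / 4 + j := by rw [mul_add, e2, mul_one]
        _ ≤ L := by linarith
    exact_mod_cast this
  set U : ℝ := (w₁ : ℝ) ^ (j * (j + 1)) with hU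
  have hjj : j * (j + 1) ≤ 2 * d ^ 2 := by nlinarith [S.j_le_d, hj1]
  have hUle : U ≤ Λ ^ (14 * d ^ 2) := by
    calc U ≤ (Λ ^ 7) ^ (j * (j + 1)) := by rw [hU]; gcongr
      _ ≤ (Λ ^ 7) ^ (2 * d ^ 2) := pow_le_pow_right₀ (one_le_pow₀ hΛ1) hjj
      _ = _ := by rw [← pow_mul]; ring_nf
  have hU0 : 0 ≤ U := by positivity
  -- the long window: `J` exceeds a bounded power of `Λ⁻¹` times `N`, while `w₂` is so short that
  -- the error of the first approximation, multiplied by `m ^ j - m₁ ^ j`, stays below `1`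
  obtain ⟨A, hA⟩ : ∃ A, A = 14 * d ^ 2 + 9 := ⟨_, rfl⟩
  set w₂ : ℕ := ⌊(N : ℝ) / Λ ^ A⌋₊ with hw₂
  have hNA : (10 : ℝ) ^ 5 ≤ N / Λ ^ A := by
    rw [le_div_iff₀ (by positivity)]
    exact hNpow A (by omega)
  have hw₂le : (w₂ : ℝ) ≤ N / Λ ^ A := Nat.floor_le (by positivity)
  have hw₂ge : (N : ℝ) / Λ ^ A / 2 ≤ w₂ := by
    have := (Nat.sub_one_lt_floor ((N : ℝ) / Λ ^ A)).le
    norm_num at hNA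
    linarith
  have hw₂0 : (0 : ℝ) < w₂ := lt_of_lt_of_le (by positivity) hw₂ge
  have hw₂1 : 1 ≤ w₂ := by exact_mod_cast hw₂0
  set J : ℕ := ⌊(L : ℝ) / (4 * Λ ^ A)⌋₊ with hJ
  have hLA : (10 : ℝ) ≤ L / (4 * Λ ^ A) := by
    rw [le_div_iff₀ (by positivity)]
    have h1 := hNpow (A + 6) (by omega)
    have h2 : (10 : ℝ) ^ 5 * Λ ^ A ≤ N / Λ ^ 6 := by
      rw [le_div_iff₀ (by positivity), mul_assoc, ← pow_add]
      exact h1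
    have h3 : (0 : ℝ) < Λ ^ A := by positivity
    norm_num at h2
    linarith
  have hJle : (J : ℝ) ≤ L / (4 * Λ ^ A) := Nat.floor_le (by positivity)
  have hJge : (L : ℝ) / (4 * Λ ^ A) / 2 ≤ J := by
    have := (Nat.sub_one_lt_floor ((L : ℝ) / (4 * Λ ^ A))).le
    linarith
  have hJ0 : (0 : ℝ) < J := by linarith
  have hJ1 : 1 ≤ J := by exact_mod_cast hJ0
  have h₂ : J * (N / w₂ + 1) ≤ L := by
    have hP : (1 : ℝ) ≤ Λ ^ A := one_le_pow₀ hΛ1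
    have e1 : ((N / w₂ : ℕ) : ℝ) ≤ 2 * Λ ^ A := by
      refine Nat.cast_div_le.trans ?_
      rw [div_le_iff₀ hw₂0]
      calc (N : ℝ) = 2 * Λ ^ A * (N / Λ ^ A / 2) := by field_simp
        _ ≤ _ := by gcongr
    have : ((J * (N / w₂ + 1) : ℕ) : ℝ) ≤ L := by
      rw [Nat.cast_mul, Nat.cast_add, Nat.cast_one]
      calc (J : ℝ) * (((N / w₂ : ℕ) : ℝ) + 1) ≤ (L / (4 * Λ ^ A)) * (4 * Λ ^ A) := by
            gcongr
            linarith
        _ = L := by field_simp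
    exact_mod_cast this
  have hJlow : x / (64 * Λ ^ (A + 6)) ≤ J := by
    calc x / (64 * Λ ^ (A + 6)) ≤ (4 * N) / (64 * Λ ^ (A + 6)) := by gcongr
      _ = N / Λ ^ 6 / 2 / (4 * Λ ^ A) / 2 := by rw [pow_add]; field_simp; norm_num
      _ ≤ L / (4 * Λ ^ A) / 2 := by gcongr
      _ ≤ J := hJge
  have hδU : U * δ ≤ 4 * Λ ^ (14 * d ^ 2 + 6) * x ^ j / H := by
    calc U * δ ≤ Λ ^ (14 * d ^ 2) * (4 * Λ ^ 6 * x ^ j / H) := by gcongr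
      _ = _ := by rw [pow_add]; ring
  have hinvΛ : 1 / Λ ≤ 1 / 10 ^ 6 := by gcongr
  have hsmall : U * δ * ((j + 1) * (j * (N : ℝ) ^ (j - 1) * w₂) + 2) < 1 := by
    have hNj : (N : ℝ) ^ (j - 1) * w₂ ≤ x ^ j / Λ ^ A := by
      calc (N : ℝ) ^ (j - 1) * w₂ ≤ (N : ℝ) ^ (j - 1) * (N / Λ ^ A) := by gcongr
        _ = (N : ℝ) ^ j / Λ ^ A := by
            rw [← mul_div_assoc, ← pow_succ, Nat.sub_add_cancel hj1]
        _ ≤ _ := by gcongr; exact S.N_le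
    have t1 : U * δ * ((j + 1) * (j * (N : ℝ) ^ (j - 1) * w₂)) ≤ 1 / 4 := by
      have hxx : x ^ j * x ^ j / H ≤ 1 := (div_le_one hH0).2 S.x_pow_j_sq_le
      have hdd : 4 * (((d : ℝ) + 1) * d) ≤ Λ / 4 := by nlinarith
      calc U * δ * ((j + 1) * (j * (N : ℝ) ^ (j - 1) * w₂))
          = (U * δ) * (((j + 1) * j) * ((N : ℝ) ^ (j - 1) * w₂)) := by ring
        _ ≤ (4 * Λ ^ (14 * d ^ 2 + 6) * x ^ j / H) * ((((d : ℝ) + 1) * d) * (x ^ j / Λ ^ A)) := by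
            gcongr
        _ = (4 * (((d : ℝ) + 1) * d)) * (Λ ^ (14 * d ^ 2 + 6) / Λ ^ A) * (x ^ j * x ^ j / H) := by
            ring
        _ = (4 * (((d : ℝ) + 1) * d)) * (1 / Λ ^ 3) * (x ^ j * x ^ j / H) := by
            congr 2
            rw [hA, show 14 * d ^ 2 + 9 = 14 * d ^ 2 + 6 + 3 by ring, pow_add Λ (14 * d ^ 2 + 6) 3]
            field_simp
        _ ≤ (Λ / 4) * (1 / Λ) * 1 := by
            gcongr
            exact le_self_pow₀ hΛ1 (by norm_num)
        _ = 1 / 4 := by field_simp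
    have t2 : U * δ * 2 ≤ 1 / 4 := by
      have := S.pow_mul_div_le (e := 14 * d ^ 2 + 6) (by omega)
      calc U * δ * 2 ≤ (4 * Λ ^ (14 * d ^ 2 + 6) * x ^ j / H) * 2 := by gcongr
        _ = 8 * (Λ ^ (14 * d ^ 2 + 6) * x ^ j / H) := by ring
        _ ≤ 8 * (1 / 10 ^ 6) := by
            have := this.trans hinvΛ
            gcongr
        _ ≤ 1 / 4 := by norm_num
    rw [mul_add]
    linarith
  obtain ⟨B₁, hB₁⟩ : ∃ B₁, B₁ = 28 * d ^ 2 + 7 + (A + 6) * d := ⟨_, rfl⟩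
  have hB₁le : B₁ ≤ 65 * d ^ 3 := by
    have : (A + 6) * d = 14 * d ^ 3 + 15 * d := by rw [hA]; ring
    omega
  have hε : U * (2 * U * δ / (J : ℝ) ^ j) ≤ Λ ^ B₁ / H := by
    have hJj : x ^ j / (64 ^ d * Λ ^ ((A + 6) * d)) ≤ (J : ℝ) ^ j := by
      calc x ^ j / (64 ^ d * Λ ^ ((A + 6) * d)) = x ^ j / (64 * Λ ^ (A + 6)) ^ d := by
            rw [mul_pow, pow_mul]
        _ ≤ x ^ j / (64 * Λ ^ (A + 6)) ^ j := by
            gcongr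
            · have : (1 : ℝ) ≤ Λ ^ (A + 6) := one_le_pow₀ hΛ1
              linarith
            · exact S.j_le_d
        _ = (x / (64 * Λ ^ (A + 6))) ^ j := (div_pow _ _ _).symm
        _ ≤ _ := by gcongr
    have h64 : (8 : ℝ) * 64 ^ d ≤ Λ := by
      have := S.pow64_le
      have h0 : (0 : ℝ) < 64 ^ d := by positivity
      norm_num at this
      linarith
    calc U * (2 * U * δ / (J : ℝ) ^ j)
        = 2 * U * (U * δ) / (J : ℝ) ^ j := by ring
      _ ≤ 2 * Λ ^ (14 * d ^ 2) * (4 * Λ ^ (14 * d ^ 2 + 6) * x ^ j / H) /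
            (x ^ j / (64 ^ d * Λ ^ ((A + 6) * d))) := by gcongr
      _ = (8 * 64 ^ d) * (Λ ^ (14 * d ^ 2) * Λ ^ (14 * d ^ 2 + 6) * Λ ^ ((A + 6) * d)) / H := by
          field_simp
          ring
      _ ≤ Λ * (Λ ^ (14 * d ^ 2) * Λ ^ (14 * d ^ 2 + 6) * Λ ^ ((A + 6) * d)) / H := by gcongr
      _ = Λ ^ B₁ / H := by
          rw [← pow_add, ← pow_add, ← pow_succ', hB₁]
          congr 2
          ring
  have hsmall' : U * (2 * U * δ / (J : ℝ) ^ j) * (a + b) < 1 := by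
    calc U * (2 * U * δ / (J : ℝ) ^ j) * (a + b) ≤ Λ ^ B₁ / H * (x ^ j + x ^ j) := by gcongr
      _ = 2 * (Λ ^ B₁ * x ^ j / H) := by ring
      _ ≤ 2 * (1 / 10 ^ 6) := by
          have := (S.pow_mul_div_le (e := B₁) (by omega)).trans hinvΛ
          gcongr
      _ < 1 := by norm_num
  obtain ⟨s, hs1, hsle, hsn⟩ := exists_nearInt_of_dense_pairs hj1 ha hb hab hZ hδ0 hnear hNL hw₁1 h₁
    hJ1 hw₂1 h₂ hsmall hsmall'
  refine ⟨s, hs1, ?_, hsn.mono ?_⟩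
  · calc (s : ℝ) ≤ U * U := by rw [hU]; exact_mod_cast hsle
      _ ≤ Λ ^ (14 * d ^ 2) * Λ ^ (14 * d ^ 2) := by gcongr
      _ = _ := by rw [← pow_add]; ring_nf
  · calc U * (2 * U * δ / (J : ℝ) ^ j) / ((max a b : ℕ) : ℝ)
        ≤ (Λ ^ B₁ / H) / (x ^ j / Λ ^ (11 * d)) := by gcongr
      _ = Λ ^ (B₁ + 11 * d) / (H * x ^ j) := by rw [pow_add, div_div_div_eq]
      _ ≤ _ := div_le_div_of_nonneg_right (pow_le_pow_right₀ hΛ1 (by omega)) (by positivity)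

/-- If `r / s` is reduced and `s θ` is very close to `r`, then `s` divides every integer `q`, not
too large, for which `q θ` is close to an integer. -/
lemma dvd_of_nearInt_mul {s : ℕ} {r q : ℤ} (hrs : IsCoprime r s) {θ β δ : ℝ}
    (hs : |s * θ - r| ≤ β) (hq : NearInt (q * θ) δ) (hlt : |(q : ℝ)| * β + s * δ < 1) :
    (s : ℤ) ∣ q := by
  obtain ⟨t, ht⟩ := hq
  have h0 : r * q - s * t = 0 := by
    rw [← Int.abs_lt_one_iff]
    have : |((r * q - s * t : ℤ) : ℝ)| < 1 := by
      have e : ((r * q - s * t : ℤ) : ℝ) = s * (q * θ - t) - q * (s * θ - r) := by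
        push_cast; ring
      rw [e]
      calc _ ≤ |s * (q * θ - t)| + |q * (s * θ - r)| := abs_sub _ _
        _ = s * |q * θ - t| + |(q : ℝ)| * |s * θ - r| := by
            rw [abs_mul, abs_mul, Nat.abs_cast]
        _ ≤ s * δ + |(q : ℝ)| * β := by gcongr
        _ < 1 := by linarith
    exact_mod_cast this
  exact hrs.symm.dvd_of_dvd_mul_left ⟨t, by linarith⟩

/-- A major arc is represented by a reduced fraction. -/
lemma exists_reduced_nearInt {s : ℕ} (hs : 1 ≤ s) {θ β : ℝ} (h : NearInt (s * θ) β) :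
    ∃ s₀ : ℕ, ∃ r : ℤ, 1 ≤ s₀ ∧ s₀ ≤ s ∧ IsCoprime r s₀ ∧ |s₀ * θ - r| ≤ β := by
  obtain ⟨r, hr⟩ := h
  have hg : 0 < Int.gcd r s := Int.gcd_pos_of_ne_zero_right _ (by exact_mod_cast (by omega : s ≠ 0))
  obtain ⟨r', t', hco, hr', hs'⟩ := Int.exists_gcd_one hg
  set g := Int.gcd r s with hgdef
  have hgR : (1 : ℝ) ≤ g := by exact_mod_cast hg
  have ht' : 0 < t' := by
    by_contra hc
    have : (s : ℤ) ≤ 0 := by rw [hs']; nlinarith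
    omega
  lift t' to ℕ using ht'.le
  have hs'' : s = t' * g := by exact_mod_cast hs'
  refine ⟨t', r', by omega, ?_, Int.isCoprime_iff_gcd_eq_one.2 hco, ?_⟩
  · rw [hs'']; exact Nat.le_mul_of_pos_right _ hg
  · have e : (s : ℝ) * θ - r = g * (t' * θ - r') := by
      have e1 : (s : ℝ) = t' * g := by exact_mod_cast hs''
      have e2 : (r : ℝ) = r' * g := by exact_mod_cast hr'
      rw [e1, e2]; ring
    rw [e, abs_mul, Nat.abs_cast] at hr
    nlinarith [abs_nonneg (t' * θ - (r' : ℝ))]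

/-- Few pairs have `a m ^ j - b n ^ j` divisible by a prime power `p ^ f`. -/
lemma card_pairs_prime_pow_dvd_le_rpow {p f j N a b : ℕ} (hp : p.Prime) (hj : 1 ≤ j)
    (hab : Nat.Coprime a b) (hN : p ^ f ≤ N) :
    (#((Icc 1 N ×ˢ Icc 1 N).filter fun z : ℕ × ℕ =>
      ((p ^ f : ℕ) : ℤ) ∣ a * (z.1 : ℤ) ^ j - b * (z.2 : ℤ) ^ j) : ℝ) ≤
      2 * j * N ^ 2 * ((p ^ f : ℕ) : ℝ) ^ (-(1 / (j : ℝ))) := by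
  set P : ℝ := ((p ^ f : ℕ) : ℝ) with hP
  have hP1 : (1 : ℝ) ≤ P := by rw [hP]; exact_mod_cast Nat.one_le_pow _ _ hp.pos
  have hj0 : (0 : ℝ) < j := by exact_mod_cast hj
  set ρ : ℝ := P ^ (1 / (j : ℝ)) with hρ
  have hρ1 : 1 ≤ ρ := Real.one_le_rpow hP1 (by positivity)
  have hρj : ρ ^ j = P := by
    rw [hρ, ← Real.rpow_natCast, ← Real.rpow_mul (by linarith), one_div_mul_cancel hj0.ne',
      Real.rpow_one]
  have hρP : ρ ≤ P := by rw [← hρj]; exact le_self_pow₀ hρ1 (by omega)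
  have hρN : ρ ≤ N := hρP.trans (by rw [hP]; exact_mod_cast hN)
  have hw1 : 1 ≤ ⌈ρ⌉₊ := Nat.one_le_ceil_iff.2 (by linarith)
  have hwρ : ρ ≤ ⌈ρ⌉₊ := Nat.le_ceil _
  have hwp : (⌈ρ⌉₊ - 1) ^ j < p ^ f := by
    have h1 : ((⌈ρ⌉₊ - 1 : ℕ) : ℝ) < ρ := by
      rw [Nat.cast_sub hw1]
      have := Nat.ceil_lt_add_one (by linarith : 0 ≤ ρ)
      push_cast
      linarith
    have h2 : ((⌈ρ⌉₊ - 1 : ℕ) : ℝ) ^ j < P := by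
      rw [← hρj]
      exact pow_lt_pow_left₀ h1 (by positivity) (by omega)
    rw [hP] at h2
    exact_mod_cast h2
  refine (Nat.cast_le.2 (card_pairs_prime_pow_dvd_le hp hj hab hw1 hwp)).trans ?_
  push_cast
  have h3 : ((N / ⌈ρ⌉₊ : ℕ) : ℝ) ≤ N / ρ := Nat.cast_div_le.trans (by gcongr)
  have h4 : 1 ≤ N / ρ := (one_le_div (by linarith)).2 hρN
  calc (N : ℝ) * (j * (((N / ⌈ρ⌉₊ : ℕ) : ℝ) + 1)) ≤ N * (j * (N / ρ + N / ρ)) := by gcongr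
    _ = 2 * j * N ^ 2 * P ^ (-(1 / (j : ℝ))) := by
        rw [Real.rpow_neg (by linarith), ← hρ]
        field_simp
        ring

/-- Every frequency `θ` is either minor, i.e. `q_z θ` is near an integer for few pairs `z` only, or
has a good rational approximation with a denominator `s` such that `W s` is not a multiple of any
exceptional prime power. A denominator divisible by a large part of an exceptional prime power is
harmless because it divides `q_z` for few pairs `z`. -/
lemma minor_or_exists_nearInt {d j k i : ℕ} {Λ x H : ℝ} {N : ℕ} (S : Scale d j Λ x H N)
    {a b : ℕ} (ha : 1 ≤ a) (hb : 1 ≤ b) (hab : Nat.Coprime a b) (hax : (a : ℝ) ≤ x ^ j)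
    (hbx : (b : ℝ) ≤ x ^ j) (hmax : x ^ j / Λ ^ (11 * d) ≤ ((max a b : ℕ) : ℝ))
    {Q : Finset ℕ} (hQ : ∀ q ∈ Q, IsPrimePow q) {v : ℕ × ℕ} (hv : ¬ badPrimePow Q k i j v)
    {δ κ : ℝ} (hδ0 : 0 ≤ δ) (hδ : δ ≤ 4 * Λ ^ 6 * x ^ j / H) (hκ : (N : ℝ) ^ 2 / Λ ^ 6 ≤ κ)
    (hκQ : ∀ q ∈ Q, 2 * d * (N : ℝ) ^ 2 * (q : ℝ) ^ (-(1 / (2 * (d : ℝ)))) ≤ κ)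
    {S₀ : ℕ} (hS₀ : S₀ = ⌊Λ ^ (28 * d ^ 2)⌋₊)
    {T₁ : ℕ} (hT₁ : 1 ≤ T₁) (hT₁le : 13 * T₁ * Λ ^ (80 * d ^ 3) ≤ H * x ^ j) (θ : ℝ) :
    (∀ Z ⊆ Icc 1 N ×ˢ Icc 1 N, (∀ z ∈ Z,
      NearInt (((a * (z.1 : ℤ) ^ j - b * (z.2 : ℤ) ^ j : ℤ) : ℝ) * θ) δ) → (#Z : ℝ) ≤ κ) ∨
    ∃ s ∈ (Icc 1 S₀).filter fun s => ∀ q ∈ Q, ¬ q ∣ v.1 ^ k * v.2 ^ i * Nat.gcd v.1 v.2 ^ j * s,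
      NearInt (s * θ) (1 / (13 * T₁)) := by
  refine or_iff_not_imp_right.2 fun hno Z hZ hnear => ?_
  by_contra! hcard
  have hd1 := S.one_le_d
  obtain ⟨hc1, hc2, hc3⟩ := pow_le_cube hd1
  have hΛ1 := S.one_le
  have hΛ0 := S.pos
  have hx0 := S.x_pos
  have hH0 := S.H_pos
  have hT0 : (0 : ℝ) < T₁ := by exact_mod_cast hT₁
  have hinvΛ : 1 / Λ ≤ 1 / 10 ^ 6 := one_div_le_one_div_of_le (by norm_num) S.const_le
  set β : ℝ := Λ ^ (80 * d ^ 3) / (H * x ^ j) with hβ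
  obtain ⟨s, hs1, hsle, hsn⟩ := exists_major_denominator S ha hb hab hax hbx hmax hδ0 hδ hZ
    (fun z hz => by
      have := hnear z hz
      push_cast at this
      rwa [mul_comm]) (hκ.trans_lt hcard)
  obtain ⟨s₀, r, hs₀1, hs₀s, hco, hr⟩ := exists_reduced_nearInt hs1 hsn
  have hs₀le : (s₀ : ℝ) ≤ Λ ^ (28 * d ^ 2) := (Nat.cast_le.2 hs₀s).trans hsle
  have hs₀S : s₀ ≤ S₀ := by rw [hS₀]; exact Nat.le_floor hs₀le
  have hnearβ : NearInt (s₀ * θ) (1 / (13 * T₁)) := by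
    refine NearInt.mono ⟨r, hr⟩ ?_
    rw [div_le_div_iff₀ (by positivity) (by positivity)]
    linarith
  -- some exceptional prime power divides `W s₀`
  have hex : ∃ q ∈ Q, q ∣ v.1 ^ k * v.2 ^ i * Nat.gcd v.1 v.2 ^ j * s₀ := by
    by_contra! hc
    exact hno ⟨s₀, mem_filter.2 ⟨mem_Icc.2 ⟨hs₀1, hs₀S⟩, hc⟩, hnearβ⟩
  obtain ⟨q, hqQ, hqd⟩ := hex
  have hp : q.minFac.Prime := Nat.minFac_prime (hQ q hqQ).one_lt.ne'
  set p := q.minFac with hpdef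
  set e := q.factorization p with he
  have hqe : p ^ e = q := (hQ q hqQ).minFac_pow_factorization_eq
  have hpf : p ^ ((e + 1) / 2) ∣ s₀ := by
    have h1 : ¬ p ^ ((e + 1) / 2) ∣ v.1 ^ k * v.2 ^ i * Nat.gcd v.1 v.2 ^ j :=
      fun hc => hv ⟨q, hqQ, hc⟩
    rw [← hqe] at hqd
    by_contra h2
    exact absurd hqd (fun hdv => by
      obtain ⟨y, z, hy, hz, hyz⟩ := exists_dvd_and_dvd_of_dvd_mul hdv
      obtain ⟨e₁, -, rfl⟩ := (Nat.dvd_prime_pow hp).1 (Dvd.intro z hyz.symm)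
      obtain ⟨e₂, -, rfl⟩ := (Nat.dvd_prime_pow hp).1 (Dvd.intro_left _ hyz.symm)
      rw [← pow_add] at hyz
      have hee := Nat.pow_right_injective hp.two_le hyz
      have l1 : e₁ < (e + 1) / 2 := by
        by_contra hl
        exact h1 ((pow_dvd_pow p (not_lt.1 hl)).trans hy)
      have l2 : e₂ < (e + 1) / 2 := by
        by_contra hl
        exact h2 ((pow_dvd_pow p (not_lt.1 hl)).trans hz)
      omega)
  set f := (e + 1) / 2 with hf
  have hNpow : Λ ^ (28 * d ^ 2) ≤ N := by
    have h1 := S.pow_le_x (e := 28 * d ^ 2 + 1) (by omega)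
    rw [pow_succ] at h1
    have h2 : Λ ^ (28 * d ^ 2) * 10 ^ 6 ≤ Λ ^ (28 * d ^ 2) * Λ := by
      have := S.const_le; gcongr
    have h3 := S.x_le
    have h4 : 0 < Λ ^ (28 * d ^ 2) := by positivity
    norm_num at h2
    linarith
  have hfN : p ^ f ≤ N := by
    have h1 : p ^ f ≤ s₀ := Nat.le_of_dvd (by omega) hpf
    exact_mod_cast (Nat.cast_le.2 h1).trans (hs₀le.trans hNpow)
  have hsub : Z ⊆ (Icc 1 N ×ˢ Icc 1 N).filter fun z : ℕ × ℕ =>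
      ((p ^ f : ℕ) : ℤ) ∣ a * (z.1 : ℤ) ^ j - b * (z.2 : ℤ) ^ j := by
    intro z hz
    have hzV := hZ hz
    refine mem_filter.2 ⟨hzV, (Int.natCast_dvd_natCast.2 hpf).trans ?_⟩
    refine dvd_of_nearInt_mul hco hr (hnear z hz) ?_
    have hz1 : (z.1 : ℝ) ≤ x := (Nat.cast_le.2 (mem_Icc.1 (mem_product.1 hzV).1).2).trans S.N_le
    have hz2 : (z.2 : ℝ) ≤ x := (Nat.cast_le.2 (mem_Icc.1 (mem_product.1 hzV).2).2).trans S.N_le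
    have hqz : |((a * (z.1 : ℤ) ^ j - b * (z.2 : ℤ) ^ j : ℤ) : ℝ)| ≤ x ^ j * x ^ j := by
      push_cast
      have h1 : (a : ℝ) * (z.1 : ℝ) ^ j ≤ x ^ j * x ^ j := by gcongr
      have h2 : (b : ℝ) * (z.2 : ℝ) ^ j ≤ x ^ j * x ^ j := by gcongr
      have h3 : 0 ≤ (a : ℝ) * (z.1 : ℝ) ^ j := by positivity
      have h4 : 0 ≤ (b : ℝ) * (z.2 : ℝ) ^ j := by positivity
      exact abs_le.2 ⟨by linarith, by linarith⟩
    have t1 := (S.pow_mul_div_le (e := 80 * d ^ 3) (by omega)).trans hinvΛ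
    have t2 := (S.pow_mul_div_le (e := 28 * d ^ 2 + 6) (by omega)).trans hinvΛ
    calc _ ≤ x ^ j * x ^ j * β + Λ ^ (28 * d ^ 2) * (4 * Λ ^ 6 * x ^ j / H) := by gcongr
      _ = Λ ^ (80 * d ^ 3) * x ^ j / H + 4 * (Λ ^ (28 * d ^ 2 + 6) * x ^ j / H) := by
          rw [hβ, pow_add]
          field_simp
      _ < 1 := by
          norm_num at t1 t2
          linarith
  have hfin : (#Z : ℝ) ≤ κ := by
    refine (Nat.cast_le.2 (card_le_card hsub)).trans ?_
    refine (card_pairs_prime_pow_dvd_le_rpow hp S.one_le_j hab hfN).trans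
      (le_trans ?_ (hκQ q hqQ))
    have hj0 : (0 : ℝ) < j := by exact_mod_cast S.one_le_j
    have hjd : (j : ℝ) ≤ d := by exact_mod_cast S.j_le_d
    have hp1 : (1 : ℝ) ≤ p := by exact_mod_cast hp.one_lt.le
    have hq : ((p ^ f : ℕ) : ℝ) ^ (-(1 / (j : ℝ))) ≤ (q : ℝ) ^ (-(1 / (2 * (d : ℝ)))) := by
      rw [← hqe]
      push_cast
      rw [← Real.rpow_natCast, ← Real.rpow_natCast, ← Real.rpow_mul (by linarith),
        ← Real.rpow_mul (by linarith)]
      refine Real.rpow_le_rpow_of_exponent_le hp1 ?_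
      have hef : (e : ℝ) ≤ 2 * f := by exact_mod_cast (by omega : e ≤ 2 * f)
      rw [mul_neg, mul_neg, neg_le_neg_iff, mul_one_div, mul_one_div,
        div_le_div_iff₀ (by linarith) hj0]
      have hf0 : (0 : ℝ) ≤ f := f.cast_nonneg
      nlinarith [mul_le_mul hef hjd hj0.le (by positivity)]
    gcongr
  exact absurd hcard (not_lt.2 hfin)

/-! ### Correlations with a generic pair -/

lemma abs_binaryForm_le {d : ℕ} {c : Fin (d + 1) → ℤ} {H x : ℝ} (hc : ∀ i, |(c i : ℝ)| ≤ H)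
    {m n : ℕ} (hm : (m : ℝ) ≤ x) (hn : (n : ℝ) ≤ x) :
    |(binaryForm d c m n : ℝ)| ≤ ((d : ℝ) + 1) * H * x ^ d := by
  have hx : 0 ≤ x := m.cast_nonneg.trans hm
  rw [binaryForm, Int.cast_sum]
  refine (abs_sum_le_sum_abs _ _).trans ?_
  calc _ ≤ ∑ _i : Fin (d + 1), H * x ^ d := by
        refine sum_le_sum fun i _ => ?_
        push_cast
        rw [abs_mul, abs_mul, abs_pow, abs_pow, Nat.abs_cast, Nat.abs_cast, mul_assoc]
        refine mul_le_mul (hc i) ?_ (by positivity) ((abs_nonneg _).trans (hc i))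
        calc (m : ℝ) ^ (i : ℕ) * (n : ℝ) ^ (d - (i : ℕ)) ≤ x ^ (i : ℕ) * x ^ (d - (i : ℕ)) := by
              gcongr
          _ = x ^ d := by rw [← pow_add]; congr 1; omega
    _ = _ := by simp; ring

/-- The length `T` of the averages over shifts, and the length `T₁` of the progressions to which
equidistribution is applied. -/
structure ShiftLengths (d j : ℕ) (Λ x H L : ℝ) (E T T₁ : ℕ) : Prop where
  E_eq : E = ⌊H / Λ ^ 3⌋₊
  T_eq : T = ⌊(E : ℝ) / x ^ j⌋₊
  T₁_eq : T₁ = ⌊H * x ^ j / (13 * Λ ^ (120 * d ^ 3))⌋₊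
  L_lt : L * (26 * Λ ^ (120 * d ^ 3)) < H * x ^ j

namespace ShiftLengths

variable {d j : ℕ} {Λ x H L : ℝ} {N E T T₁ : ℕ}

lemma E_le (P : ShiftLengths d j Λ x H L E T T₁) (S : Scale d j Λ x H N) : (E : ℝ) ≤ H / Λ ^ 3 := by
  have := S.H_pos
  have := S.pos
  rw [P.E_eq]; exact Nat.floor_le (by positivity)

lemma le_T (P : ShiftLengths d j Λ x H L E T T₁) (S : Scale d j Λ x H N) :
    H / (4 * Λ ^ 3 * x ^ j) ≤ T := by
  have hH := S.H_pos
  have hΛ := S.pos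
  have hx := S.x_pos
  have hΛc := S.const_le
  obtain ⟨hc1, hc2, hc3⟩ := pow_le_cube S.one_le_d
  have hxj : 0 < x ^ j := by positivity
  have h1 : 10 ^ 6 ≤ H / (Λ ^ 3 * x ^ j) := by
    rw [le_div_iff₀ (by positivity)]
    have h2 := S.pow_mul_div_le (e := 3) (by omega)
    rw [div_le_div_iff₀ hH hΛ] at h2
    have h3 : 10 ^ 6 * (Λ ^ 3 * x ^ j) ≤ Λ * (Λ ^ 3 * x ^ j) := by gcongr
    linarith
  have h2 : H / Λ ^ 3 - 1 ≤ E := by rw [P.E_eq]; exact (Nat.sub_one_lt_floor _).le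
  have h3 : (E : ℝ) / x ^ j - 1 ≤ T := by rw [P.T_eq]; exact (Nat.sub_one_lt_floor _).le
  have h4 : (H / Λ ^ 3 - 1) / x ^ j ≤ E / x ^ j := by gcongr
  have h5 : (H / Λ ^ 3 - 1) / x ^ j = H / (Λ ^ 3 * x ^ j) - 1 / x ^ j := by
    rw [sub_div, div_div]
  have h6 : 1 / x ^ j ≤ 1 := (div_le_one hxj).2 S.one_le_pow_j
  have h7 : H / (4 * Λ ^ 3 * x ^ j) = H / (Λ ^ 3 * x ^ j) / 4 := by field_simp
  rw [h7]
  norm_num at h1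
  linarith

lemma T_pos (P : ShiftLengths d j Λ x H L E T T₁) (S : Scale d j Λ x H N) : 1 ≤ T := by
  have h := P.le_T S
  have hH := S.H_pos
  have hΛ := S.pos
  have hx := S.x_pos
  have : (0 : ℝ) < T := lt_of_lt_of_le (by positivity) h
  exact_mod_cast this

lemma T_mul_le (P : ShiftLengths d j Λ x H L E T T₁) (S : Scale d j Λ x H N) {e : ℕ}
    (he : (e : ℝ) ≤ x ^ j) : T * e ≤ E := by
  have hx := S.x_pos
  have h1 : (T : ℝ) ≤ E / x ^ j := by rw [P.T_eq]; exact Nat.floor_le (by positivity)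
  rw [le_div_iff₀ (by positivity)] at h1
  have : (T : ℝ) * e ≤ E := le_trans (by gcongr) h1
  exact_mod_cast this

lemma T₁_le (P : ShiftLengths d j Λ x H L E T T₁) (S : Scale d j Λ x H N) :
    (T₁ : ℝ) ≤ H * x ^ j / (13 * Λ ^ (120 * d ^ 3)) := by
  have := S.H_pos
  have := S.pos
  have := S.x_pos
  rw [P.T₁_eq]; exact Nat.floor_le (by positivity)

lemma le_T₁ (P : ShiftLengths d j Λ x H L E T T₁) (S : Scale d j Λ x H N) :
    H * x ^ j / (26 * Λ ^ (120 * d ^ 3)) ≤ T₁ := by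
  have hH := S.H_pos
  have hΛ := S.pos
  have hx := S.x_pos
  obtain ⟨hc1, hc2, hc3⟩ := pow_le_cube S.one_le_d
  have h1 : 10 ^ 6 ≤ H * x ^ j / Λ ^ (120 * d ^ 3) := by
    rw [le_div_iff₀ (by positivity)]
    have h2 := S.pow_le_x (e := 120 * d ^ 3 + 1) (by omega)
    have h3 : 10 ^ 6 * Λ ^ (120 * d ^ 3) ≤ Λ * Λ ^ (120 * d ^ 3) := by
      have := S.const_le; gcongr
    rw [← pow_succ'] at h3
    have h4 := S.x_le_pow_j
    have h5 : 1 * x ^ j ≤ H * x ^ j := by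
      have := S.one_le_H; gcongr
    linarith
  have h2 : H * x ^ j / (13 * Λ ^ (120 * d ^ 3)) - 1 ≤ T₁ := by
    rw [P.T₁_eq]; exact (Nat.sub_one_lt_floor _).le
  have h3 : H * x ^ j / (13 * Λ ^ (120 * d ^ 3)) = H * x ^ j / Λ ^ (120 * d ^ 3) / 13 := by
    field_simp
  have h4 : H * x ^ j / (26 * Λ ^ (120 * d ^ 3)) = H * x ^ j / Λ ^ (120 * d ^ 3) / 26 := by
    field_simp
  rw [h3] at h2
  rw [h4]
  norm_num at h1
  linarith

lemma T₁_pos (P : ShiftLengths d j Λ x H L E T T₁) (S : Scale d j Λ x H N) : 1 ≤ T₁ := by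
  have h := P.le_T₁ S
  have hH := S.H_pos
  have hΛ := S.pos
  have hx := S.x_pos
  have : (0 : ℝ) < T₁ := lt_of_lt_of_le (by positivity) h
  exact_mod_cast this

lemma L_lt_T₁ (P : ShiftLengths d j Λ x H L E T T₁) (S : Scale d j Λ x H N) : L < T₁ := by
  have hΛ := S.pos
  refine lt_of_lt_of_le ?_ (P.le_T₁ S)
  rw [lt_div_iff₀ (by positivity)]
  exact P.L_lt

end ShiftLengths

lemma le_of_sq_le_of_one_le {r H : ℝ} (hr : 1 ≤ r) (h : r * r ≤ H) : r ≤ H := by nlinarith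

lemma window_identity {κ ν Λ T : ℝ} (hΛ : 0 < Λ) (hT : 0 < T) :
    κ * T ^ 2 + ν * (1 / (2 * (Λ ^ 3 / T))) ^ 2 = T ^ 2 * (κ + ν / (4 * Λ ^ 6)) := by
  field_simp; ring

lemma mul_div_mul_cancel_six {H μ : ℝ} (hμ : 0 < μ) : 4 * H / μ * (6 * (H * μ)) = 24 * H ^ 2 := by
  field_simp; ring

lemma sq_div_mul_sq {T T₁ ν σ ι δ₀ : ℝ} (hT : 0 < T₁) :
    4 * ν * (T / T₁) ^ 2 * (σ * (ι * (δ₀ * (4 * T₁)) ^ 2)) =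
      64 * ν * T ^ 2 * σ * ι * δ₀ ^ 2 := by
  field_simp; ring

lemma one_div_mul_mul_cancel {T : ℝ} (hT : 0 < T) (r s : ℝ) : 1 / T * (r * (T * s)) = r * s := by
  field_simp

set_option maxHeartbeats 1000000 in
/-- The correlations of the values at a generic pair `v` with those at all other pairs are small on
average. -/
lemma sum_norm_correlation_le {F : ℤ → ℂ} {Q : Finset ℕ} {d j k i : ℕ} {Λ x H L δ₀ κ : ℝ}
    {N E T T₁ : ℕ} (S : Scale d j Λ x H N) (P : ShiftLengths d j Λ x H L E T T₁)
    (hQ : ∀ q ∈ Q, IsPrimePow q)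
    (hF : EquidistributedOutside F Q d x L (((d : ℝ) + 3) * H * x ^ d) δ₀)
    {a b W : ℕ} (ha : 1 ≤ a) (hb : 1 ≤ b) (hW1 : 1 ≤ W) (hab : Nat.Coprime a b)
    (hax : (a : ℝ) ≤ x ^ j)
    (hbx : (b : ℝ) ≤ x ^ j) (hmax : x ^ j / Λ ^ (11 * d) ≤ ((max a b : ℕ) : ℝ))
    (hWa : (W : ℝ) * a ≤ x ^ d) (hWb : (W : ℝ) * b ≤ x ^ d)
    {v : ℕ × ℕ} (hW : W = v.1 ^ k * v.2 ^ i * Nat.gcd v.1 v.2 ^ j)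
    (hv : ¬ badPrimePow Q k i j v) (hκ : (N : ℝ) ^ 2 / Λ ^ 6 ≤ κ)
    (hκQ : ∀ q ∈ Q, 2 * d * (N : ℝ) ^ 2 * (q : ℝ) ^ (-(1 / (2 * (d : ℝ)))) ≤ κ)
    {g : ℤ} (hg : |(g : ℝ)| ≤ ((d : ℝ) + 1) * H * x ^ d)
    (hgcd : (Nat.gcd g.natAbs W : ℝ) * Λ ^ (28 * d ^ 2) ≤ gcdThreshold x)
    {h : ℕ} (hh : (h : ℝ) ≤ H) (X₂ Y₂ : ℕ × ℕ → ℕ) (g₂ : ℕ × ℕ → ℤ)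
    (hXY : ∀ z, z.1 ^ j * X₂ z = z.2 ^ j * Y₂ z) {M m₁ e₀ : ℝ}
    (hM : ∑ z ∈ Icc 1 N ×ˢ Icc 1 N, ∑ p ∈ intBox h, ‖F (affineForm (X₂ z) (Y₂ z) (g₂ z) p)‖ ^ 2
      ≤ M)
    (hm₁ : ((#(Icc (-(h : ℤ)) h) : ℝ) / max a b + 1) *
      ∑ y ∈ Icc (-((h * (a + b) : ℕ) : ℤ)) (h * (a + b) : ℕ),
        ‖progressionValues F g W (h * (a + b)) y‖ ^ 2 ≤ m₁)
    (he₀ : ∑ p ∈ intBox h \ intBox (h - 2 * E), ‖F (affineForm (W * a) (W * b) g p)‖ ^ 2 ≤ e₀) :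
    ∑ z ∈ Icc 1 N ×ˢ Icc 1 N,
      ‖∑ p ∈ intBox h, F (affineForm (W * a) (W * b) g p) *
        (starRingEnd ℂ) (F (affineForm (X₂ z) (Y₂ z) (g₂ z) p))‖ ≤
      √M * √((κ + N ^ 2 / (4 * Λ ^ 6)) * m₁ + 1536 * N ^ 2 * H ^ 2 * Λ ^ (28 * d ^ 2) * δ₀ ^ 2) +
      √e₀ * ∑ z ∈ Icc 1 N ×ˢ Icc 1 N,
        √(∑ p ∈ intBox h \ intBox (h - 2 * E),
          ‖F (affineForm (X₂ z) (Y₂ z) (g₂ z) p)‖ ^ 2) := by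
  have hd1 := S.one_le_d
  obtain ⟨hc1, hc2, hc3⟩ := pow_le_cube hd1
  have hΛ1 := S.one_le
  have hΛ0 := S.pos
  have hx0 := S.x_pos
  have hx1 := S.one_le_x
  have hH0 := S.H_pos
  have hH1 := S.one_le_H
  have hT1 := P.T_pos S
  have hT₁1 := P.T₁_pos S
  have hT0 : (0 : ℝ) < T := by exact_mod_cast hT1
  have hT₁0 : (0 : ℝ) < T₁ := by exact_mod_cast hT₁1
  have hmx1 : (1 : ℝ) ≤ ((max a b : ℕ) : ℝ) := by exact_mod_cast ha.trans (le_max_left a b)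
  have hκ0 : 0 ≤ κ := le_trans (by positivity) hκ
  set V := Icc 1 N ×ˢ Icc 1 N with hV
  have hVc : (#V : ℝ) = (N : ℝ) ^ 2 := by simp [hV, sq]
  set Y := h * (a + b) with hY
  set S₀ : ℕ := ⌊Λ ^ (28 * d ^ 2)⌋₊ with hS₀
  have hS₀le : (S₀ : ℝ) ≤ Λ ^ (28 * d ^ 2) := Nat.floor_le (by positivity)
  set SS := (Icc 1 S₀).filter fun s => ∀ q ∈ Q, ¬ q ∣ v.1 ^ k * v.2 ^ i * Nat.gcd v.1 v.2 ^ j * s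
    with hSS
  have hSSc : (#SS : ℝ) ≤ Λ ^ (28 * d ^ 2) := by
    refine le_trans ?_ hS₀le
    exact_mod_cast (card_filter_le _ _).trans (by simp)
  set f := progressionValues F g W Y with hf
  set I := Icc (-(Y : ℤ)) (Y : ℤ) with hI
  set I₁ := Icc (-(Y : ℤ) - T₁ * S₀) (Y : ℤ) with hI₁
  set δ : ℝ := Λ ^ 3 / T with hδ
  have hδ0 : 0 < δ := by positivity
  have hδle : δ ≤ 4 * Λ ^ 6 * x ^ j / H := by
    have h1 := P.le_T S
    rw [div_le_iff₀ (by positivity)] at h1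
    rw [hδ, div_le_div_iff₀ hT0 hH0]
    calc Λ ^ 3 * H ≤ Λ ^ 3 * (T * (4 * Λ ^ 3 * x ^ j)) := by gcongr
      _ = _ := by ring
  have hT₁le : 13 * T₁ * Λ ^ (80 * d ^ 3) ≤ H * x ^ j := by
    have h1 := P.T₁_le S
    rw [le_div_iff₀ (by positivity)] at h1
    calc 13 * (T₁ : ℝ) * Λ ^ (80 * d ^ 3) ≤ 13 * (T₁ : ℝ) * Λ ^ (120 * d ^ 3) := by
          gcongr
          norm_num
      _ ≤ _ := by linarith
  -- the size of `I₁` against the multiplicity of the values `a p.1 + b p.2`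
  have hYle : (Y : ℝ) ≤ 2 * (H * ((max a b : ℕ) : ℝ)) := by
    have h1 : ((a + b : ℕ) : ℝ) ≤ 2 * ((max a b : ℕ) : ℝ) := by
      have : a + b ≤ 2 * max a b := by
        have := le_max_left a b
        have := le_max_right a b
        omega
      exact_mod_cast this
    calc (Y : ℝ) = h * ((a + b : ℕ) : ℝ) := by rw [hY]; push_cast; ring
      _ ≤ H * (2 * ((max a b : ℕ) : ℝ)) := by gcongr
      _ = _ := by ring
  have hTS : (T₁ : ℝ) * S₀ ≤ H * ((max a b : ℕ) : ℝ) := by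
    calc (T₁ : ℝ) * S₀ ≤ (H * x ^ j / (13 * Λ ^ (120 * d ^ 3))) * Λ ^ (28 * d ^ 2) := by
          have := P.T₁_le S
          gcongr
      _ ≤ H * (x ^ j / Λ ^ (11 * d)) := by
          rw [div_mul_eq_mul_div, ← mul_div_assoc, div_le_div_iff₀ (by positivity) (by positivity)]
          calc H * x ^ j * Λ ^ (28 * d ^ 2) * Λ ^ (11 * d)
              = H * x ^ j * Λ ^ (28 * d ^ 2 + 11 * d) := by rw [pow_add]; ring
            _ ≤ H * x ^ j * (1 * Λ ^ (120 * d ^ 3)) := by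
                rw [one_mul]
                gcongr
                omega
            _ ≤ H * x ^ j * (13 * Λ ^ (120 * d ^ 3)) := by gcongr; norm_num
      _ ≤ _ := by gcongr
  have hI₁c : (#I₁ : ℝ) ≤ 6 * (H * ((max a b : ℕ) : ℝ)) := by
    have h1 : (#I₁ : ℝ) = 2 * Y + 1 + T₁ * S₀ := by
      have : #I₁ = 2 * Y + 1 + T₁ * S₀ := by
        rw [hI₁, Int.card_Icc]
        have : (Y : ℤ) + 1 - (-(Y : ℤ) - T₁ * S₀) = ((2 * Y + 1 + T₁ * S₀ : ℕ) : ℤ) := by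
          push_cast; ring
        rw [this, Int.toNat_natCast]
      rw [this]; push_cast; ring
    have h2 : 1 ≤ H * ((max a b : ℕ) : ℝ) := one_le_mul_of_one_le_of_one_le hH1 hmx1
    rw [h1]
    linarith
  set mult : ℝ := (#(Icc (-(h : ℤ)) h) : ℝ) / ((max a b : ℕ) : ℝ) + 1 with hmult
  have hmult0 : 0 ≤ mult := by positivity
  have hmultle : mult ≤ 4 * H / ((max a b : ℕ) : ℝ) := by
    have h1 : (#(Icc (-(h : ℤ)) h) : ℝ) ≤ 3 * H := by
      have : #(Icc (-(h : ℤ)) h) = 2 * h + 1 := by rw [Int.card_Icc]; omega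
      rw [this]; push_cast; linarith
    have h2 : ((max a b : ℕ) : ℝ) ≤ H := by
      rw [Nat.cast_max]
      have h3 : x ^ j ≤ H := le_of_sq_le_of_one_le S.one_le_pow_j S.x_pow_j_sq_le
      exact (max_le hax hbx).trans h3
    have hm0 : 0 < ((max a b : ℕ) : ℝ) := by linarith
    rw [hmult, div_add_one hm0.ne']
    gcongr
    linarith
  have hmultI : mult * #I₁ ≤ 24 * H ^ 2 := by
    have hm0 : 0 < ((max a b : ℕ) : ℝ) := by linarith
    calc mult * #I₁ ≤ (4 * H / ((max a b : ℕ) : ℝ)) * (6 * (H * ((max a b : ℕ) : ℝ))) := by gcongr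
      _ = 24 * H ^ 2 := mul_div_mul_cancel_six hm0
  -- the sums over long progressions
  have hmajor : ∀ s ∈ SS, ∀ y : ℤ, ‖∑ t ∈ range T₁, f (y + t * (s : ℤ))‖ ≤ δ₀ * (4 * T₁) := by
    intro s hs y
    obtain ⟨hs1, hs2⟩ := mem_filter.1 hs
    obtain ⟨hs3, hs4⟩ := mem_Icc.1 hs1
    have hsR : (s : ℝ) ≤ Λ ^ (28 * d ^ 2) := (Nat.cast_le.2 hs4).trans hS₀le
    have hs1R : (1 : ℝ) ≤ s := by exact_mod_cast hs3
    have hWR : (1 : ℝ) ≤ W := by exact_mod_cast hW1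
    have hWx : (W : ℝ) * x ^ j ≤ Λ ^ (11 * d) * x ^ d := by
      have h1 : (W : ℝ) * ((max a b : ℕ) : ℝ) ≤ x ^ d := by
        rcases max_choice a b with hm | hm <;> rw [hm] <;> assumption
      rw [div_le_iff₀ (by positivity)] at hmax
      calc (W : ℝ) * x ^ j ≤ W * (((max a b : ℕ) : ℝ) * Λ ^ (11 * d)) := by gcongr
        _ = (W * ((max a b : ℕ) : ℝ)) * Λ ^ (11 * d) := by ring
        _ ≤ x ^ d * Λ ^ (11 * d) := by gcongr
        _ = _ := by ring
    refine norm_sum_progressionValues_le hF hW1 hs3 hT₁1 ?_ ?_ ?_ ?_ ?_ ?_ y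
    · have h1 : Λ ^ (28 * d ^ 2 + 11 * d) ≤ x ^ j :=
        (S.pow_le_x (by omega)).trans S.x_le_pow_j
      have h2 : (W : ℝ) * s * x ^ j ≤ x ^ d * x ^ j := by
        calc (W : ℝ) * s * x ^ j = s * (W * x ^ j) := by ring
          _ ≤ Λ ^ (28 * d ^ 2) * (Λ ^ (11 * d) * x ^ d) := by gcongr
          _ = Λ ^ (28 * d ^ 2 + 11 * d) * x ^ d := by rw [pow_add]; ring
          _ ≤ x ^ j * x ^ d := by gcongr
          _ = _ := by ring
      exact le_of_mul_le_mul_right h2 (by positivity)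
    · rw [hW]; exact hs2
    · exact le_trans (by gcongr) hgcd
    · calc L < T₁ := P.L_lt_T₁ S
        _ ≤ W * s * T₁ := le_mul_of_one_le_left hT₁0.le (one_le_mul_of_one_le_of_one_le hWR hs1R)
    · have h2 := P.T₁_le S
      calc 4 * ((W : ℝ) * s * T₁)
          ≤ 4 * (W * Λ ^ (28 * d ^ 2) * (H * x ^ j / (13 * Λ ^ (120 * d ^ 3)))) := by gcongr
        _ = 4 * (W * x ^ j) * H * Λ ^ (28 * d ^ 2) / (13 * Λ ^ (120 * d ^ 3)) := by ring
        _ ≤ 4 * (Λ ^ (11 * d) * x ^ d) * H * Λ ^ (28 * d ^ 2) / (13 * Λ ^ (120 * d ^ 3)) := by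
            gcongr
        _ = (4 * (H * x ^ d)) * Λ ^ (28 * d ^ 2 + 11 * d) / (13 * Λ ^ (120 * d ^ 3)) := by
            rw [pow_add]; ring
        _ ≤ (4 * (H * x ^ d)) * Λ ^ (120 * d ^ 3) / (13 * Λ ^ (120 * d ^ 3)) := by
            gcongr
            omega
        _ = 4 / 13 * (H * x ^ d) := by
            rw [mul_div_mul_right _ _ (pow_pos hΛ0 _).ne']; ring
        _ ≤ (d + 3) * (H * x ^ d) := by
            have hd0 : (0 : ℝ) ≤ d := d.cast_nonneg
            gcongr
            linarith
        _ = _ := by ring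
    · have h1 : (W : ℝ) * Y ≤ 2 * H * x ^ d := by
        calc (W : ℝ) * Y = h * (W * a + W * b) := by rw [hY]; push_cast; ring
          _ ≤ H * (x ^ d + x ^ d) := by gcongr
          _ = _ := by ring
      linarith
  -- the mean square over the shifts
  have hfour : ∑ z ∈ V, ∑ y ∈ I, ‖∑ t ∈ range T, f (y + t * ((a : ℤ) * (z.1 ^ j : ℕ) -
      b * (z.2 ^ j : ℕ)))‖ ^ 2 ≤
      (κ * T ^ 2 + N ^ 2 * (1 / (2 * δ)) ^ 2) * ∑ y ∈ I, ‖f y‖ ^ 2 +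
      64 * N ^ 2 * T ^ 2 * Λ ^ (28 * d ^ 2) * #I₁ * δ₀ ^ 2 := by
    have h1 := sum_sum_norm_sq_shift_le (I := I) (I₁ := I₁) (f := f)
      (fun y hy => by rw [hf, progressionValues, if_neg hy]) V
      (fun z => (a : ℤ) * (z.1 : ℤ) ^ j - b * (z.2 : ℤ) ^ j) I (T := T) hT₁1 SS hδ0 hκ0
      (fun s hs y t ht hy => by
        obtain ⟨hy1, hy2⟩ := mem_Icc.1 hy
        obtain ⟨hs3, hs4⟩ := mem_Icc.1 (mem_filter.1 hs).1
        have hts : (t : ℤ) * s ≤ T₁ * S₀ := by exact_mod_cast Nat.mul_le_mul ht.le hs4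
        have hts0 : 0 ≤ (t : ℤ) * s := by positivity
        exact mem_Icc.2 ⟨by linarith, by linarith⟩)
      (minor_or_exists_nearInt S ha hb hab hax hbx hmax hQ hv hδ0.le hδle hκ hκQ hS₀ hT₁1 hT₁le)
    rw [hVc] at h1
    push_cast
    refine h1.trans (add_le_add le_rfl ?_)
    calc 4 * (N : ℝ) ^ 2 * ((T : ℝ) / T₁) ^ 2 *
          ∑ s ∈ SS, ∑ y ∈ I₁, ‖∑ t ∈ range T₁, f (y + t * (s : ℤ))‖ ^ 2
        ≤ 4 * (N : ℝ) ^ 2 * ((T : ℝ) / T₁) ^ 2 *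
          ∑ s ∈ SS, ∑ y ∈ I₁, (δ₀ * (4 * T₁)) ^ 2 := by
          gcongr with s hs y hy
          exact hmajor s hs y
      _ = 64 * N ^ 2 * T ^ 2 * #SS * #I₁ * δ₀ ^ 2 := by
          rw [sum_const, sum_const, nsmul_eq_mul, nsmul_eq_mul]
          exact sq_div_mul_sq hT₁0
      _ ≤ _ := by gcongr
  have hmain : mult * ∑ z ∈ V, ∑ y ∈ I, ‖∑ t ∈ range T, f (y + t * ((a : ℤ) * (z.1 ^ j : ℕ) -
      b * (z.2 ^ j : ℕ)))‖ ^ 2 ≤ T ^ 2 *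
      ((κ + N ^ 2 / (4 * Λ ^ 6)) * m₁ + 1536 * N ^ 2 * H ^ 2 * Λ ^ (28 * d ^ 2) * δ₀ ^ 2) := by
    have e1 : κ * (T : ℝ) ^ 2 + (N : ℝ) ^ 2 * (1 / (2 * δ)) ^ 2 =
        (T : ℝ) ^ 2 * (κ + N ^ 2 / (4 * Λ ^ 6)) := by
      rw [hδ]; exact window_identity hΛ0 hT0
    calc _ ≤ mult * ((κ * T ^ 2 + N ^ 2 * (1 / (2 * δ)) ^ 2) * ∑ y ∈ I, ‖f y‖ ^ 2 +
          64 * N ^ 2 * T ^ 2 * Λ ^ (28 * d ^ 2) * #I₁ * δ₀ ^ 2) := by gcongr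
      _ = T ^ 2 * ((κ + N ^ 2 / (4 * Λ ^ 6)) * (mult * ∑ y ∈ I, ‖f y‖ ^ 2) +
          64 * N ^ 2 * (mult * #I₁) * Λ ^ (28 * d ^ 2) * δ₀ ^ 2) := by rw [e1]; ring
      _ ≤ T ^ 2 * ((κ + N ^ 2 / (4 * Λ ^ 6)) * m₁ +
          64 * N ^ 2 * (24 * H ^ 2) * Λ ^ (28 * d ^ 2) * δ₀ ^ 2) := by gcongr
      _ = _ := by ring
  -- shift and apply Cauchy–Schwarz
  set Mz : ℕ × ℕ → ℝ := fun z => ∑ p ∈ intBox h, ‖F (affineForm (X₂ z) (Y₂ z) (g₂ z) p)‖ ^ 2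
    with hMz
  set Sz : ℕ × ℕ → ℝ := fun z => ∑ y ∈ I, ‖∑ t ∈ range T, f (y + t * ((a : ℤ) * (z.1 ^ j : ℕ) -
      b * (z.2 ^ j : ℕ)))‖ ^ 2 with hSz
  have hMz0 : ∀ z, 0 ≤ Mz z := fun z => sum_nonneg fun _ _ => sq_nonneg _
  have hSz0 : ∀ z, 0 ≤ mult * Sz z := fun z =>
    mul_nonneg hmult0 (sum_nonneg fun _ _ => sq_nonneg _)
  have hT0' : 0 ≤ 1 / (T : ℝ) := by positivity
  have hzj : ∀ {t : ℕ}, t ∈ Icc 1 N → ((t ^ j : ℕ) : ℝ) ≤ x ^ j := by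
    intro t ht
    have : (t : ℝ) ≤ x := (Nat.cast_le.2 (mem_Icc.1 ht).2).trans S.N_le
    push_cast
    gcongr
  have hcorr : ∀ z ∈ V, ‖∑ p ∈ intBox h, F (affineForm (W * a) (W * b) g p) *
        (starRingEnd ℂ) (F (affineForm (X₂ z) (Y₂ z) (g₂ z) p))‖ ≤
      1 / T * (√(Mz z) * √(mult * Sz z)) + √e₀ *
        √(∑ p ∈ intBox h \ intBox (h - 2 * E), ‖F (affineForm (X₂ z) (Y₂ z) (g₂ z) p)‖ ^ 2) := by
    intro z hz
    obtain ⟨hz1, hz2⟩ := mem_product.1 hz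
    have h1 := norm_correlation_le F (W := W) ha hb hab g (X₂ z) (Y₂ z) (g₂ z)
      (e₁ := z.1 ^ j) (e₂ := z.2 ^ j) (hXY z) h E T hT1 (P.T_mul_le S (hzj hz1))
      (P.T_mul_le S (hzj hz2))
    rw [Real.sqrt_mul (hMz0 z)] at h1
    refine h1.trans (add_le_add le_rfl ?_)
    gcongr
  refine (sum_le_sum hcorr).trans ?_
  rw [sum_add_distrib, ← mul_sum, ← mul_sum]
  refine add_le_add ?_ le_rfl
  calc 1 / (T : ℝ) * ∑ z ∈ V, √(Mz z) * √(mult * Sz z)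
      ≤ 1 / (T : ℝ) * (√(∑ z ∈ V, Mz z) * √(∑ z ∈ V, mult * Sz z)) := by
        exact mul_le_mul_of_nonneg_left (Real.sum_sqrt_mul_sqrt_le _ hMz0 hSz0) hT0'
    _ ≤ 1 / (T : ℝ) * (√M * √(T ^ 2 * ((κ + N ^ 2 / (4 * Λ ^ 6)) * m₁ +
          1536 * N ^ 2 * H ^ 2 * Λ ^ (28 * d ^ 2) * δ₀ ^ 2))) := by
        refine mul_le_mul_of_nonneg_left (mul_le_mul (Real.sqrt_le_sqrt hM) (Real.sqrt_le_sqrt ?_)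
          (Real.sqrt_nonneg _) (Real.sqrt_nonneg _)) hT0'
        rw [← mul_sum]
        exact hmain
    _ = _ := by
        rw [Real.sqrt_mul (sq_nonneg _), Real.sqrt_sq hT0.le]
        exact one_div_mul_mul_cancel hT0 _ _

/-! ### Second moments over boxes -/

/-- For fixed second coordinate the values of the form run through a progression of difference `X`.
-/
lemma sum_norm_sq_affineForm_le {F : ℤ → ℂ} {B : ℝ} (hB : 1 ≤ B)
    (hF : ∀ n : ℤ, ‖F n‖ ≤ tauGen B n.natAbs) {K : ℕ} (hK : B ^ 4 ≤ K) {X : ℕ} (hX : X ≠ 0)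
    (Y : ℕ) (g : ℤ) {M : ℕ} (hM : 1 ≤ M) (p r : ℤ) (J : Finset ℤ)
    (hle : ∀ a ∈ Icc p r, ∀ b ∈ J, (affineForm X Y g (a, b)).natAbs ≤ M)
    (hlen : M ≤ #(Icc p r) ^ 2) :
    ∑ q ∈ Icc p r ×ˢ J, ‖F (affineForm X Y g q)‖ ^ 2 ≤
      #J * (3 * B ^ 2 * tauGen B X ^ 2 * #(Icc p r) * (1 + Real.log M) ^ K) := by
  rw [sum_product_right, ← nsmul_eq_mul]
  refine sum_le_card_nsmul _ _ _ fun b hb => ?_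
  refine le_trans (sum_le_sum fun a _ => ?_) (sum_sq_tauGen_progression_le hB hK hX
    (b * Y + g) p r hM (fun a ha => ?_) hlen)
  · have : affineForm X Y g (a, b) = a * X + (b * Y + g) := by rw [affineForm]; ring
    rw [this]
    gcongr
    exact hF _
  · have h := hle a ha b hb
    rwa [affineForm, add_assoc] at h

lemma card_Icc_neg_self (h : ℕ) : #(Icc (-(h : ℤ)) h) = 2 * h + 1 := by rw [Int.card_Icc]; omega

/-- The points near the edge of the box are covered by four rectangles. The moment bound is applied
to each along the first coordinate, whose range has length at least `2 E`. -/
lemma sum_edge_norm_sq_le {F : ℤ → ℂ} {B : ℝ} (hB : 1 ≤ B)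
    (hF : ∀ n : ℤ, ‖F n‖ ≤ tauGen B n.natAbs) {K : ℕ} (hK : B ^ 4 ≤ K) {X : ℕ} (hX : X ≠ 0)
    (Y : ℕ) (g : ℤ) {M h E : ℕ} (hM : 1 ≤ M)
    (hle : ∀ p ∈ intBox h, (affineForm X Y g p).natAbs ≤ M) (hEh : E ≤ h)
    (hlen : M ≤ (2 * E) ^ 2) :
    ∑ p ∈ intBox h \ intBox (h - 2 * E), ‖F (affineForm X Y g p)‖ ^ 2 ≤
      24 * E * (2 * h + 1) * B ^ 2 * tauGen B X ^ 2 * (1 + Real.log M) ^ K := by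
  set I := Icc (-(h : ℤ)) h with hI
  set L := Icc (-(h : ℤ)) (-(h - 2 * E) - 1) with hL
  set R := Icc ((h : ℤ) - 2 * E + 1) h with hR
  -- the strips have width `2 E`, so that they are long enough for the moment bound
  have hIc : #I = 2 * h + 1 := card_Icc_neg_self h
  have hLc : #L = 2 * E := by rw [hL, Int.card_Icc]; omega
  have hRc : #R = 2 * E := by rw [hR, Int.card_Icc]; omega
  have hLI : L ⊆ I := Icc_subset_Icc le_rfl (by omega)
  have hRI : R ⊆ I := Icc_subset_Icc (by omega) le_rfl
  have hcov : intBox h \ intBox (h - 2 * E) ⊆ (L ×ˢ I ∪ R ×ˢ I) ∪ (I ×ˢ L ∪ I ×ˢ R) := by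
    intro p hp
    rw [mem_sdiff, intBox, intBox, mem_product, mem_product] at hp
    simp only [mem_union, mem_product, hI, hL, hR, mem_Icc] at hp ⊢
    omega
  have hbox : ∀ {a b : ℤ}, a ∈ I → b ∈ I → (affineForm X Y g (a, b)).natAbs ≤ M :=
    fun ha hb => hle _ (mem_product.2 ⟨ha, hb⟩)
  have hlenI : M ≤ #I ^ 2 := hlen.trans (by rw [hIc]; exact Nat.pow_le_pow_left (by omega) 2)
  set f : ℤ × ℤ → ℝ := fun p => ‖F (affineForm X Y g p)‖ ^ 2 with hf
  have hf0 : ∀ p, 0 ≤ f p := fun p => sq_nonneg _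
  have hunion : ∀ s t : Finset (ℤ × ℤ), ∑ p ∈ s ∪ t, f p ≤ ∑ p ∈ s, f p + ∑ p ∈ t, f p :=
    fun s t => by
      have := sum_union_inter (s₁ := s) (s₂ := t) (f := f)
      have h2 : 0 ≤ ∑ p ∈ s ∩ t, f p := sum_nonneg fun p _ => hf0 p
      linarith
  have h1 := sum_norm_sq_affineForm_le hB hF hK hX Y g hM (-(h : ℤ)) (-(h - 2 * E) - 1) I
    (fun a ha b hb => hbox (hLI ha) hb) (by rw [hLc]; exact hlen)
  have h2 := sum_norm_sq_affineForm_le hB hF hK hX Y g hM ((h : ℤ) - 2 * E + 1) h I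
    (fun a ha b hb => hbox (hRI ha) hb) (by rw [hRc]; exact hlen)
  have h3 := sum_norm_sq_affineForm_le hB hF hK hX Y g hM (-(h : ℤ)) h L
    (fun a ha b hb => hbox ha (hLI hb)) hlenI
  have h4 := sum_norm_sq_affineForm_le hB hF hK hX Y g hM (-(h : ℤ)) h R
    (fun a ha b hb => hbox ha (hRI hb)) hlenI
  rw [← hL, hLc, hIc] at h1
  rw [← hR, hRc, hIc] at h2
  rw [← hI, hLc, hIc] at h3
  rw [← hI, hRc, hIc] at h4
  push_cast at h1 h2 h3 h4
  calc _ ≤ ∑ p ∈ (L ×ˢ I ∪ R ×ˢ I) ∪ (I ×ˢ L ∪ I ×ˢ R), f p :=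
        sum_le_sum_of_subset_of_nonneg hcov fun p _ _ => hf0 p
    _ ≤ (∑ p ∈ L ×ˢ I, f p + ∑ p ∈ R ×ˢ I, f p) + (∑ p ∈ I ×ˢ L, f p + ∑ p ∈ I ×ˢ R, f p) :=
        (hunion _ _).trans (add_le_add (hunion _ _) (hunion _ _))
    _ ≤ _ := (add_le_add (add_le_add h1 h2) (add_le_add h3 h4)).trans (by
        apply le_of_eq; ring)

/-- The data of the moment bounds: `F` is bounded by `τ_B`, all arguments are at most `M`, and `P`
is the resulting bound for second moments, up to the factor `τ_B(X) ^ 2`. -/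
structure MomentData (F : ℤ → ℂ) (d : ℕ) (x H B P : ℝ) (h K M : ℕ) : Prop where
  one_le_B : 1 ≤ B
  norm_le : ∀ n : ℤ, ‖F n‖ ≤ tauGen B n.natAbs
  pow_le : B ^ 4 ≤ K
  h_eq : h = ⌊H⌋₊
  M_eq : M = ⌊((d : ℝ) + 3) * H * x ^ d⌋₊
  P_eq : P = 60 * B ^ 2 * H ^ 2 * (1 + Real.log M) ^ K

namespace MomentData

variable {F : ℤ → ℂ} {d j : ℕ} {Λ x H L B P : ℝ} {N E T T₁ h K M : ℕ}

lemma h_le (D : MomentData F d x H B P h K M) (S : Scale d j Λ x H N) : (h : ℝ) ≤ H := by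
  rw [D.h_eq]; exact Nat.floor_le S.H_pos.le

lemma le_h (D : MomentData F d x H B P h K M) : H - 1 ≤ h := by
  rw [D.h_eq]; exact (Nat.sub_one_lt_floor _).le

lemma one_le_M (D : MomentData F d x H B P h K M) (S : Scale d j Λ x H N) : 1 ≤ M := by
  rw [D.M_eq]
  refine Nat.le_floor ?_
  have h1 := S.one_le_H
  have h2 : 1 ≤ x ^ d := one_le_pow₀ S.one_le_x
  have h3 : (1 : ℝ) ≤ (d : ℝ) + 3 := by linarith [d.cast_nonneg (α := ℝ)]
  rw [Nat.cast_one]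
  exact one_le_mul_of_one_le_of_one_le (one_le_mul_of_one_le_of_one_le h3 h1) h2

lemma log_nonneg (D : MomentData F d x H B P h K M) (S : Scale d j Λ x H N) :
    0 ≤ (1 + Real.log M) ^ K := by
  have : 0 ≤ Real.log M := Real.log_nonneg (by exact_mod_cast D.one_le_M S)
  positivity

lemma P_nonneg (D : MomentData F d x H B P h K M) (S : Scale d j Λ x H N) : 0 ≤ P := by
  rw [D.P_eq]
  have := D.log_nonneg S
  positivity

lemma M_le (D : MomentData F d x H B P h K M) (S : Scale d j Λ x H N) :
    (M : ℝ) ≤ H ^ 2 / Λ ^ 6 := by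
  have hΛ := S.pos
  have hH := S.H_pos
  have hx := S.x_pos
  have h1 : (M : ℝ) ≤ ((d : ℝ) + 3) * H * x ^ d := by
    rw [D.M_eq]; exact Nat.floor_le (by positivity)
  refine h1.trans ?_
  rw [le_div_iff₀ (by positivity)]
  obtain ⟨hc1, hc2, hc3⟩ := pow_le_cube S.one_le_d
  have h2 : (d : ℝ) + 3 ≤ Λ := by nlinarith [S.d_le, d.cast_nonneg (α := ℝ)]
  have h3 : Λ ^ 7 ≤ x ^ d :=
    (S.pow_le_x (by omega)).trans (le_self_pow₀ S.one_le_x (by have := S.one_le_d; omega))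
  have h4 : x ^ d * x ^ d ≤ H := by
    rw [← pow_add, ← two_mul]; exact S.x_pow_le
  calc ((d : ℝ) + 3) * H * x ^ d * Λ ^ 6 ≤ Λ * H * x ^ d * Λ ^ 6 := by gcongr
    _ = H * (x ^ d * Λ ^ 7) := by ring
    _ ≤ H * (x ^ d * x ^ d) := by gcongr
    _ ≤ H * H := by gcongr
    _ = _ := by ring

lemma natAbs_le (D : MomentData F d x H B P h K M) {n : ℤ}
    (hn : |(n : ℝ)| ≤ ((d : ℝ) + 3) * H * x ^ d) : n.natAbs ≤ M := by
  rw [D.M_eq]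
  refine Nat.le_floor ?_
  rwa [Nat.cast_natAbs, Int.cast_abs]

lemma natAbs_affineForm_le (D : MomentData F d x H B P h K M) (S : Scale d j Λ x H N) {X Y : ℕ}
    (hX : (X : ℝ) ≤ x ^ d) (hY : (Y : ℝ) ≤ x ^ d) {g : ℤ}
    (hg : |(g : ℝ)| ≤ ((d : ℝ) + 1) * H * x ^ d) {p : ℤ × ℤ} (hp : p ∈ intBox h) :
    (affineForm X Y g p).natAbs ≤ M := by
  refine D.natAbs_le ?_
  obtain ⟨h1, h2⟩ := mem_intBox.1 hp
  have hH := S.H_pos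
  have hx := S.x_pos
  have h1' : |(p.1 : ℝ)| ≤ H := (show |(p.1 : ℝ)| ≤ (h : ℝ) by exact_mod_cast h1).trans (D.h_le S)
  have h2' : |(p.2 : ℝ)| ≤ H := (show |(p.2 : ℝ)| ≤ (h : ℝ) by exact_mod_cast h2).trans (D.h_le S)
  rw [affineForm]
  push_cast
  calc _ ≤ |(p.1 : ℝ) * X| + |(p.2 : ℝ) * Y| + |(g : ℝ)| := abs_add_three _ _ _
    _ ≤ H * x ^ d + H * x ^ d + ((d : ℝ) + 1) * H * x ^ d := by
        rw [abs_mul, abs_mul, Nat.abs_cast, Nat.abs_cast]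
        gcongr
    _ = _ := by ring

lemma three_mul_le (D : MomentData F d x H B P h K M) (S : Scale d j Λ x H N) :
    2 * (h : ℝ) + 1 ≤ 3 * H := by
  linarith [D.h_le S, S.one_le_H]

/-- The box is long enough for the moment bound. -/
lemma M_le_sq (D : MomentData F d x H B P h K M) (S : Scale d j Λ x H N) :
    M ≤ (2 * h + 1) ^ 2 := by
  have h1 := D.M_le S
  have h2 : H ^ 2 / Λ ^ 6 ≤ H ^ 2 := div_le_self (sq_nonneg _) (one_le_pow₀ S.one_le)
  have h3 : H ≤ 2 * h + 1 := by linarith [D.le_h, h.cast_nonneg (α := ℝ)]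
  have h4 : (M : ℝ) ≤ (2 * h + 1) ^ 2 := h1.trans (h2.trans (by have := S.H_pos; gcongr))
  exact_mod_cast h4

/-- The second moment over the whole box. -/
lemma mass_le (D : MomentData F d x H B P h K M) (S : Scale d j Λ x H N) {X Y : ℕ} (hX0 : X ≠ 0)
    (hX : (X : ℝ) ≤ x ^ d) (hY : (Y : ℝ) ≤ x ^ d) {g : ℤ}
    (hg : |(g : ℝ)| ≤ ((d : ℝ) + 1) * H * x ^ d) :
    ∑ p ∈ intBox h, ‖F (affineForm X Y g p)‖ ^ 2 ≤ P * tauGen B X ^ 2 := by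
  have h1 := sum_norm_sq_affineForm_le D.one_le_B D.norm_le D.pow_le hX0 Y g (D.one_le_M S)
    (-(h : ℤ)) h (Icc (-(h : ℤ)) h) (fun a ha b hb => D.natAbs_affineForm_le S hX hY hg
      (mem_product.2 ⟨ha, hb⟩)) (by rw [card_Icc_neg_self]; exact D.M_le_sq S)
  rw [intBox]
  refine h1.trans ?_
  rw [card_Icc_neg_self, D.P_eq]
  push_cast
  have h2 := D.three_mul_le S
  have h3 := D.log_nonneg S
  have hH := S.H_pos
  calc _ = 3 * ((2 * (h : ℝ) + 1) * (2 * h + 1)) * (B ^ 2 * tauGen B X ^ 2 *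
        (1 + Real.log M) ^ K) := by ring
    _ ≤ 3 * ((3 * H) * (3 * H)) * (B ^ 2 * tauGen B X ^ 2 * (1 + Real.log M) ^ K) := by gcongr
    _ = 27 * (B ^ 2 * H ^ 2 * tauGen B X ^ 2 * (1 + Real.log M) ^ K) := by ring
    _ ≤ 60 * (B ^ 2 * H ^ 2 * tauGen B X ^ 2 * (1 + Real.log M) ^ K) := by
        gcongr
        norm_num
    _ = _ := by ring

/-- The second moment over the points near the edge, which are a proportion `O(Λ⁻³)` of the box. -/
lemma edge_le (D : MomentData F d x H B P h K M) (S : Scale d j Λ x H N)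
    (Sh : ShiftLengths d j Λ x H L E T T₁) {X Y : ℕ} (hX0 : X ≠ 0)
    (hX : (X : ℝ) ≤ x ^ d) (hY : (Y : ℝ) ≤ x ^ d) {g : ℤ}
    (hg : |(g : ℝ)| ≤ ((d : ℝ) + 1) * H * x ^ d) :
    ∑ p ∈ intBox h \ intBox (h - 2 * E), ‖F (affineForm X Y g p)‖ ^ 2 ≤
      2 / Λ ^ 3 * P * tauGen B X ^ 2 := by
  have hH := S.H_pos
  have hΛ := S.pos
  have hΛc := S.const_le
  have hE := Sh.E_le S
  have hH6 : 10 ^ 6 ≤ H / Λ ^ 3 := by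
    obtain ⟨hc1, hc2, hc3⟩ := pow_le_cube S.one_le_d
    have h2 := S.pow_mul_div_le (e := 3) (by omega)
    rw [div_le_div_iff₀ hH hΛ] at h2
    rw [le_div_iff₀ (by positivity)]
    have h3 : Λ ^ 3 * 1 ≤ Λ ^ 3 * x ^ j := by
      have := S.one_le_pow_j
      gcongr
    have h4 : 0 < Λ ^ 3 := by positivity
    calc (10 : ℝ) ^ 6 * Λ ^ 3 ≤ Λ * Λ ^ 3 := by gcongr
      _ ≤ Λ ^ 3 * x ^ j * Λ := by rw [mul_comm]; gcongr; linarith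
      _ ≤ H := by linarith
  have hEge : H / Λ ^ 3 / 2 ≤ E := by
    have : H / Λ ^ 3 - 1 ≤ E := by rw [Sh.E_eq]; exact (Nat.sub_one_lt_floor _).le
    norm_num at hH6
    linarith
  have hEh : E ≤ h := by
    have h1 : H / Λ ^ 3 ≤ H := div_le_self hH.le (one_le_pow₀ S.one_le)
    rw [Sh.E_eq, D.h_eq]
    exact Nat.floor_le_floor h1
  have hlen : M ≤ (2 * E) ^ 2 := by
    have h1 : (M : ℝ) ≤ (2 * E) ^ 2 := by
      calc (M : ℝ) ≤ H ^ 2 / Λ ^ 6 := D.M_le S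
        _ = (2 * (H / Λ ^ 3 / 2)) ^ 2 := by field_simp
        _ ≤ _ := by gcongr
    exact_mod_cast h1
  refine (sum_edge_norm_sq_le D.one_le_B D.norm_le D.pow_le hX0 Y g (D.one_le_M S)
    (fun p hp => D.natAbs_affineForm_le S hX hY hg hp) hEh hlen).trans ?_
  rw [D.P_eq]
  have h2 := D.three_mul_le S
  have h3 := D.log_nonneg S
  calc 24 * (E : ℝ) * (2 * h + 1) * B ^ 2 * tauGen B X ^ 2 * (1 + Real.log M) ^ K
      ≤ 24 * (H / Λ ^ 3) * (3 * H) * B ^ 2 * tauGen B X ^ 2 * (1 + Real.log M) ^ K := by gcongr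
    _ = 72 * (1 / Λ ^ 3 * (B ^ 2 * H ^ 2 * tauGen B X ^ 2 * (1 + Real.log M) ^ K)) := by ring
    _ ≤ 120 * (1 / Λ ^ 3 * (B ^ 2 * H ^ 2 * tauGen B X ^ 2 * (1 + Real.log M) ^ K)) := by
        gcongr
        norm_num
    _ = _ := by ring

/-- The second moment of `F` along `g + W y` for `|y| ≤ Y`, weighted by the largest number of points
`(a, b)` of the box with the same `y`. -/
lemma progression_le (D : MomentData F d x H B P h K M) (S : Scale d j Λ x H N) {a b W : ℕ}
    (ha : 1 ≤ a) (hW : 1 ≤ W) (hax : (a : ℝ) ≤ x ^ j) (hbx : (b : ℝ) ≤ x ^ j)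
    (hWa : (W : ℝ) * a ≤ x ^ d) (hWb : (W : ℝ) * b ≤ x ^ d) {g : ℤ}
    (hg : |(g : ℝ)| ≤ ((d : ℝ) + 1) * H * x ^ d) :
    ((#(Icc (-(h : ℤ)) h) : ℝ) / max a b + 1) *
      ∑ y ∈ Icc (-((h * (a + b) : ℕ) : ℤ)) (h * (a + b) : ℕ),
        ‖progressionValues F g W (h * (a + b)) y‖ ^ 2 ≤ P * tauGen B (W * a) ^ 2 := by
  have hH := S.H_pos
  have hH1 := S.one_le_H
  have hx := S.x_pos
  have h3 := D.log_nonneg S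
  have hh := D.h_le S
  obtain ⟨μ, hμ⟩ : ∃ μ, μ = max a b := ⟨_, rfl⟩
  rw [← hμ]
  obtain ⟨Y, hY⟩ : ∃ Y, Y = h * (a + b) := ⟨_, rfl⟩
  rw [← hY]
  have haμ : a ≤ μ := hμ ▸ le_max_left a b
  have hbμ : b ≤ μ := hμ ▸ le_max_right a b
  have hμ1 : (1 : ℝ) ≤ μ := by exact_mod_cast ha.trans haμ
  have hμ0 : (0 : ℝ) < μ := by linarith
  have hμH : (μ : ℝ) ≤ H := by
    rw [hμ, Nat.cast_max]
    exact (max_le hax hbx).trans (le_of_sq_le_of_one_le S.one_le_pow_j S.x_pow_j_sq_le)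
  have hYR : (Y : ℝ) = h * (a + b) := by rw [hY]; push_cast; ring
  have hYle : (Y : ℝ) ≤ 2 * (H * μ) := by
    have h1 : (a : ℝ) + b ≤ 2 * μ := by exact_mod_cast (by omega : a + b ≤ 2 * μ)
    rw [hYR]
    calc (h : ℝ) * (a + b) ≤ H * (2 * μ) := by gcongr
      _ = _ := by ring
  have hhY : h ≤ Y := by rw [hY]; exact Nat.le_mul_of_pos_right _ (by omega)
  have hsum : ∑ y ∈ Icc (-(Y : ℤ)) Y, ‖progressionValues F g W Y y‖ ^ 2 ≤
      3 * B ^ 2 * tauGen B W ^ 2 * #(Icc (-(Y : ℤ)) Y) * (1 + Real.log M) ^ K := by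
    refine le_trans (sum_le_sum fun y hy => ?_) (sum_sq_tauGen_progression_le D.one_le_B D.pow_le
      (by omega : W ≠ 0) g (-(Y : ℤ)) Y (D.one_le_M S) (fun y hy => ?_) ?_)
    · rw [progressionValues, if_pos hy, show y * (W : ℤ) + g = g + W * y by ring]
      gcongr
      exact D.norm_le _
    · refine D.natAbs_le ?_
      have hy' : |(y : ℝ)| ≤ Y := by exact_mod_cast abs_le.2 (mem_Icc.1 hy)
      push_cast
      calc _ ≤ |(y : ℝ) * W| + |(g : ℝ)| := abs_add_le _ _
        _ ≤ Y * W + ((d : ℝ) + 1) * H * x ^ d := by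
            rw [abs_mul, Nat.abs_cast]; gcongr
        _ = h * (W * a + W * b) + ((d : ℝ) + 1) * H * x ^ d := by rw [hYR]; ring
        _ ≤ H * (x ^ d + x ^ d) + ((d : ℝ) + 1) * H * x ^ d := by gcongr
        _ = _ := by ring
    · rw [card_Icc_neg_self]
      exact (D.M_le_sq S).trans (Nat.pow_le_pow_left (by omega) 2)
  have hτ : tauGen B W ≤ tauGen B (W * a) :=
    tauGen_le_of_dvd D.one_le_B (Nat.mul_ne_zero (by omega) (by omega)) (Dvd.intro _ rfl)
  have hτ0 : 0 ≤ tauGen B W := tauGen_nonneg (by linarith [D.one_le_B]) _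
  have hHμ : 1 ≤ H * μ := one_le_mul_of_one_le_of_one_le hH1 hμ1
  rw [card_Icc_neg_self] at hsum ⊢
  push_cast at hsum ⊢
  have h2 := D.three_mul_le S
  calc _ ≤ (3 * H / μ + H / μ) * (3 * B ^ 2 * tauGen B (W * a) ^ 2 * (4 * (H * μ) + H * μ) *
        (1 + Real.log M) ^ K) := by
        refine mul_le_mul ?_ (hsum.trans ?_) (sum_nonneg fun _ _ => sq_nonneg _) (by positivity)
        · gcongr
          exact (one_le_div hμ0).2 hμH
        · have hY5 : 2 * (Y : ℝ) + 1 ≤ 4 * (H * μ) + H * μ := by linarith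
          gcongr
    _ = P * tauGen B (W * a) ^ 2 := by
        rw [D.P_eq]
        field_simp
        ring

end MomentData

/-! ### Generic pairs -/

/-- `g(m, n)` and `m ^ k n ^ i gcd(m, n) ^ j` have a small gcd as soon as `gcd(m, n)`, `gcd(c₀, m)`
and `gcd(c_d, n)` are small. -/
lemma gcd_binaryForm_le {d k i j : ℕ} (hd : k + i + j = d) {c : Fin (d + 1) → ℤ} {m n : ℕ}
    (hm : 1 ≤ m) (hn : 1 ≤ n) {y G : ℝ} (hy : 1 ≤ y) (hG : 1 ≤ G)
    (h0 : (Nat.gcd (c 0).natAbs m : ℝ) ≤ y) (h1 : (Nat.gcd (c (Fin.last d)).natAbs n : ℝ) ≤ y)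
    (hg : (Nat.gcd m n : ℝ) ≤ G) :
    (Nat.gcd (binaryForm d c m n).natAbs (m ^ k * n ^ i * Nat.gcd m n ^ j) : ℝ) ≤
      y ^ d * G ^ (d ^ 2 + d) := by
  have hpos : 1 ≤ Nat.gcd m n := Nat.gcd_pos_of_pos_left _ hm
  have hc0 : 1 ≤ Nat.gcd (c 0).natAbs m := Nat.gcd_pos_of_pos_right _ hm
  have hc1 : 1 ≤ Nat.gcd (c (Fin.last d)).natAbs n := Nat.gcd_pos_of_pos_right _ hn
  have hdvd := gcd_binaryForm_dvd d k i c m n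
  have hle1 := Nat.le_of_dvd (by positivity) hdvd
  have hle2 : Nat.gcd (binaryForm d c m n).natAbs (m ^ k * n ^ i * Nat.gcd m n ^ j) ≤
      Nat.gcd (binaryForm d c m n).natAbs (m ^ k * n ^ i) * Nat.gcd m n ^ j := by
    refine Nat.le_of_dvd (Nat.mul_pos (Nat.gcd_pos_of_pos_right _ (by positivity))
      (by positivity)) ?_
    exact (Nat.gcd_mul_right_dvd_mul_gcd _ _ _).trans (mul_dvd_mul_left _ (Nat.gcd_dvd_right _ _))
  have hle3 := hle2.trans (Nat.mul_le_mul_right _ hle1)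
  refine (Nat.cast_le.2 hle3).trans ?_
  push_cast
  have hyG : 1 ≤ y * G ^ d := one_le_mul_of_one_le_of_one_le hy (one_le_pow₀ hG)
  calc _ ≤ (y * G ^ d) ^ k * (y * G ^ d) ^ i * G ^ j := by gcongr
    _ = (y * G ^ d) ^ (k + i) * G ^ j := by rw [pow_add]
    _ ≤ (y * G ^ d) ^ d * G ^ d := by
        gcongr <;> omega
    _ = _ := by rw [mul_pow, ← pow_mul, pow_add, ← sq]; ring

/-- The pairs `(m, n)` to which the equidistribution of `F` can be applied: the gcd is small, the
pair is not too close to `0`, the leading coefficients of the form have small common factors with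
`m` and `n`, and no large part of an exceptional prime power divides `m ^ k n ^ i gcd(m, n) ^ j`. -/
structure GenericPair (Q : Finset ℕ) (d k i j : ℕ) (c : Fin (d + 1) → ℤ) (Λ y : ℝ) (N : ℕ)
    (v : ℕ × ℕ) : Prop where
  gcd_le : (Nat.gcd v.1 v.2 : ℝ) ≤ Λ ^ 6
  le_max : (N : ℝ) / Λ ^ 4 ≤ ((max v.1 v.2 : ℕ) : ℝ)
  gcd_zero_le : (Nat.gcd (c 0).natAbs v.1 : ℝ) ≤ y
  gcd_last_le : (Nat.gcd (c (Fin.last d)).natAbs v.2 : ℝ) ≤ y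
  not_bad : ¬ badPrimePow Q k i j v

open Classical in
/-- Each condition of `GenericPair` fails for `O(N ^ 2 / Λ ^ 6)` pairs. -/
lemma card_not_genericPair_le {Q : Finset ℕ} (hQ : ∀ q ∈ Q, IsPrimePow q) {d k i j : ℕ}
    {Λ x H : ℝ} {N : ℕ} (S : Scale d j Λ x H N) (hd : k + i + j = d) {c : Fin (d + 1) → ℤ}
    (hc0 : c 0 ≠ 0) (hc1 : c (Fin.last d) ≠ 0) {C : ℝ}
    (hsum : ∑ q ∈ Q, (q : ℝ) ^ (-(1 / (4 * (d : ℝ)))) ≤ C / Λ ^ 3)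
    (hlogN : 1 + Real.log N ≤ 2 * Λ) (hlog0 : (Nat.log 2 (c 0).natAbs : ℝ) ≤ 2 * Λ)
    (hlog1 : (Nat.log 2 (c (Fin.last d)).natAbs : ℝ) ≤ 2 * Λ) {R ν : ℕ} (hR : Λ ^ 7 ≤ R)
    (hν : Λ ^ 8 ≤ 2 ^ ν) :
    (#((Icc 1 N ×ˢ Icc 1 N).filter fun v =>
      ¬ GenericPair Q d k i j c Λ ((R : ℝ) ^ (3 * ν)) N v) : ℝ) ≤
      (17 + 2 * C ^ 2) * (N ^ 2 / Λ ^ 6) := by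
  have hΛ := S.pos
  have hΛ1 := S.one_le
  have hΛc := S.const_le
  have hN1 : 1 ≤ N := by
    have h1 := S.x_le
    have h2 := S.one_le_x
    have : (0 : ℝ) < N := by linarith
    exact_mod_cast this
  have hR1 : 1 ≤ R := by
    have : (1 : ℝ) ≤ R := (one_le_pow₀ hΛ1).trans hR
    exact_mod_cast this
  set V := Icc 1 N ×ˢ Icc 1 N with hV
  set G : ℕ := ⌊Λ ^ 6⌋₊ with hG
  -- one exceptional set for each condition of `GenericPair`
  set B₁ := V.filter fun v => G < Nat.gcd v.1 v.2 with hB₁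
  set B₂ := Icc 1 ⌊(N : ℝ) / Λ ^ 4⌋₊ ×ˢ Icc 1 ⌊(N : ℝ) / Λ ^ 4⌋₊ with hB₂
  set B₃ := ((Icc 1 N).filter fun m => R ^ (3 * ν) < Nat.gcd (c 0).natAbs m) ×ˢ Icc 1 N with hB₃
  set B₄ := Icc 1 N ×ˢ ((Icc 1 N).filter fun m => R ^ (3 * ν) < Nat.gcd (c (Fin.last d)).natAbs m)
    with hB₄
  set B₅ := V.filter (badPrimePow Q k i j) with hB₅
  have hcov : (V.filter fun v => ¬ GenericPair Q d k i j c Λ ((R : ℝ) ^ (3 * ν)) N v) ⊆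
      (B₁ ∪ B₂) ∪ (B₃ ∪ B₄) ∪ B₅ := by
    intro v hv
    obtain ⟨hvV, hvg⟩ := mem_filter.1 hv
    obtain ⟨hv1, hv2⟩ := mem_product.1 hvV
    by_contra hno
    simp only [mem_union, not_or] at hno
    obtain ⟨⟨⟨n1, n2⟩, n3, n4⟩, n5⟩ := hno
    refine hvg ⟨?_, ?_, ?_, ?_, ?_⟩
    · by_contra hc
      refine n1 (mem_filter.2 ⟨hvV, ?_⟩)
      exact (Nat.floor_lt (by positivity)).2 (not_le.1 hc)
    · by_contra hc
      rw [not_le, Nat.cast_max] at hc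
      refine n2 (mem_product.2 ⟨mem_Icc.2 ⟨(mem_Icc.1 hv1).1, Nat.le_floor ?_⟩,
        mem_Icc.2 ⟨(mem_Icc.1 hv2).1, Nat.le_floor ?_⟩⟩)
      · exact (le_max_left _ _).trans hc.le
      · exact (le_max_right _ _).trans hc.le
    · by_contra hc
      refine n3 (mem_product.2 ⟨mem_filter.2 ⟨hv1, ?_⟩, hv2⟩)
      exact_mod_cast not_le.1 hc
    · by_contra hc
      refine n4 (mem_product.2 ⟨hv1, mem_filter.2 ⟨hv2, ?_⟩⟩)
      exact_mod_cast not_le.1 hc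
    · exact fun hc => n5 (mem_filter.2 ⟨hvV, hc⟩)
  set ρ : ℝ := (N : ℝ) ^ 2 / Λ ^ 6 with hρ
  have hG2 : Λ ^ 6 / 2 ≤ G := by
    have h1 : Λ ^ 6 - 1 ≤ G := (Nat.sub_one_lt_floor _).le
    have h2 : Λ ≤ Λ ^ 6 := le_self_pow₀ hΛ1 (by norm_num)
    norm_num at hΛc
    linarith
  have hG1 : 1 ≤ G := by
    have : (0 : ℝ) < G := lt_of_lt_of_le (by positivity) hG2
    exact_mod_cast this
  have c1 : (#B₁ : ℝ) ≤ 2 * ρ := by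
    refine (card_filter_lt_gcd_le hG1).trans ?_
    calc (N : ℝ) ^ 2 / G ≤ N ^ 2 / (Λ ^ 6 / 2) := by gcongr
      _ = 2 * ρ := by rw [hρ]; field_simp
  have c2 : (#B₂ : ℝ) ≤ ρ := by
    have h1 : (⌊(N : ℝ) / Λ ^ 4⌋₊ : ℝ) ≤ N / Λ ^ 4 := Nat.floor_le (by positivity)
    rw [hB₂, card_product, Nat.card_Icc, Nat.add_sub_cancel, Nat.cast_mul]
    calc _ ≤ (N : ℝ) / Λ ^ 4 * (N / Λ ^ 4) := by gcongr
      _ = N ^ 2 / Λ ^ 8 := by rw [div_mul_div_comm, ← sq, ← pow_add]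
      _ ≤ ρ := by
          rw [hρ]
          gcongr
          norm_num
  have hconst : ∀ c' : ℕ, c' ≠ 0 → (Nat.log 2 c' : ℝ) ≤ 2 * Λ →
      (#((Icc 1 N).filter fun m => R ^ (3 * ν) < Nat.gcd c' m) : ℝ) * N ≤ 7 * ρ := by
    intro c' hc' hlog
    have h1 := card_filter_lt_gcd_const_le hc' hN1 hR1 (ν := ν)
    have hl0 : 0 ≤ 1 + Real.log N := by
      have : 0 ≤ Real.log N := Real.log_nonneg (by exact_mod_cast hN1)
      linarith
    have t1 : (1 + Real.log N) ^ 2 / 2 ^ ν ≤ 4 / Λ ^ 6 := by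
      calc (1 + Real.log N) ^ 2 / 2 ^ ν ≤ (2 * Λ) ^ 2 / Λ ^ 8 := by gcongr
        _ = 4 / Λ ^ 6 := by field_simp; norm_num
    have t2 : (Nat.log 2 c' : ℝ) / R ≤ 2 / Λ ^ 6 := by
      calc (Nat.log 2 c' : ℝ) / R ≤ 2 * Λ / Λ ^ 7 := by gcongr
        _ = 2 / Λ ^ 6 := by field_simp
    have t3 : 1 / (R : ℝ) ≤ 1 / Λ ^ 6 := by
      have : Λ ^ 6 ≤ Λ ^ 7 := pow_le_pow_right₀ hΛ1 (by norm_num)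
      gcongr
      linarith
    calc _ ≤ (N * ((1 + Real.log N) ^ 2 / 2 ^ ν + Nat.log 2 c' / R + 1 / R)) * (N : ℝ) := by gcongr
      _ ≤ (N * (4 / Λ ^ 6 + 2 / Λ ^ 6 + 1 / Λ ^ 6)) * (N : ℝ) := by gcongr
      _ = 7 * ρ := by rw [hρ]; ring
  have c3 : (#B₃ : ℝ) ≤ 7 * ρ := by
    rw [hB₃, card_product, Nat.cast_mul, Nat.card_Icc, Nat.add_sub_cancel]
    exact hconst _ (Int.natAbs_ne_zero.2 hc0) hlog0
  have c4 : (#B₄ : ℝ) ≤ 7 * ρ := by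
    rw [hB₄, card_product, Nat.cast_mul, Nat.card_Icc, Nat.add_sub_cancel, mul_comm]
    exact hconst _ (Int.natAbs_ne_zero.2 hc1) hlog1
  have c5 : (#B₅ : ℝ) ≤ 2 * C ^ 2 * ρ := by
    refine (card_badPrimePow_le hQ S.one_le_d hd N).trans ?_
    have h0 : 0 ≤ ∑ q ∈ Q, (q : ℝ) ^ (-(1 / (4 * (d : ℝ)))) :=
      sum_nonneg fun q _ => by positivity
    calc _ ≤ 2 * (N : ℝ) ^ 2 * (C / Λ ^ 3) ^ 2 := by gcongr
      _ = 2 * C ^ 2 * ρ := by rw [hρ, div_pow, ← pow_mul]; ring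
  calc _ ≤ (#((B₁ ∪ B₂) ∪ (B₃ ∪ B₄) ∪ B₅) : ℝ) := by exact_mod_cast card_le_card hcov
    _ ≤ ((#B₁ + #B₂ + (#B₃ + #B₄) + #B₅ : ℕ) : ℝ) := by
        refine Nat.cast_le.2 ((card_union_le _ _).trans (Nat.add_le_add ?_ le_rfl))
        exact (card_union_le _ _).trans (Nat.add_le_add (card_union_le _ _) (card_union_le _ _))
    _ ≤ (17 + 2 * C ^ 2) * ρ := by push_cast; linarith

/-- The factor `τ_B(X) ^ 2` of the second moments is bounded on average over `v`, where `X` is the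
coefficient of `a`. -/
lemma sum_tauGen_sq_monomial_le {B : ℝ} (hB : 1 ≤ B) {d k e K : ℕ} (hd : k + e = d)
    (hK : B ^ (2 * d) ≤ K) {N : ℕ} (hN : 1 ≤ N) :
    ∑ v ∈ Icc 1 N ×ˢ Icc 1 N, tauGen B (v.1 ^ k * v.2 ^ e) ^ 2 ≤
      N ^ 2 * (1 + Real.log N) ^ (2 * K) := by
  have hB0 : 0 ≤ B := by linarith
  have h1 : ∀ r ≤ d, ∀ n, n ≠ 0 → tauGen B (n ^ r) ^ 2 ≤ tauGen K n := by
    intro r hr n hn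
    calc tauGen B (n ^ r) ^ 2 ≤ (tauGen B n ^ r) ^ 2 := by
          have := tauGen_nonneg hB0 (n ^ r)
          have := tauGen_pow_right_le hB hn r
          gcongr
      _ = tauGen B n ^ (r * 2) := (pow_mul _ _ _).symm
      _ ≤ tauGen (B ^ (r * 2)) n := tauGen_pow_le hB n _
      _ ≤ tauGen K n := by
          refine tauGen_mono_left (by positivity) (le_trans ?_ hK) n
          exact pow_le_pow_right₀ hB (by omega)
  calc _ ≤ ∑ v ∈ Icc 1 N ×ˢ Icc 1 N, tauGen K v.1 * tauGen K v.2 := by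
        refine sum_le_sum fun v hv => ?_
        obtain ⟨hv1, hv2⟩ := mem_product.1 hv
        have hm : v.1 ≠ 0 := by have := (mem_Icc.1 hv1).1; omega
        have hn : v.2 ≠ 0 := by have := (mem_Icc.1 hv2).1; omega
        calc tauGen B (v.1 ^ k * v.2 ^ e) ^ 2
            ≤ (tauGen B (v.1 ^ k) * tauGen B (v.2 ^ e)) ^ 2 := by
              have := tauGen_nonneg hB0 (v.1 ^ k * v.2 ^ e)
              have := tauGen_mul_le hB (pow_ne_zero k hm) (pow_ne_zero e hn)
              gcongr
          _ = tauGen B (v.1 ^ k) ^ 2 * tauGen B (v.2 ^ e) ^ 2 := mul_pow _ _ _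
          _ ≤ _ := mul_le_mul (h1 k (by omega) _ hm) (h1 e (by omega) _ hn) (sq_nonneg _)
              (tauGen_nonneg K.cast_nonneg _)
    _ = (∑ m ∈ Icc 1 N, tauGen K m) * ∑ n ∈ Icc 1 N, tauGen K n := by
        rw [sum_product, sum_mul_sum]
    _ ≤ (N * (1 + Real.log N) ^ K) * (N * (1 + Real.log N) ^ K) := by
        have h2 := sum_tauGen_le K hN
        exact mul_le_mul h2 h2 (sum_nonneg fun _ _ => tauGen_nonneg K.cast_nonneg _)
          ((sum_nonneg fun _ _ => tauGen_nonneg K.cast_nonneg _).trans h2)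
    _ = _ := by ring

/-! ### The sum over all pairs -/

/-- The argument `a m ^ k n ^ (i + j) + b m ^ (k + j) n ^ i + g(m, n)` for `v = (m, n)` and
`p = (a, b)`. -/
def formValue (d k i j : ℕ) (c : Fin (d + 1) → ℤ) (v : ℕ × ℕ) (p : ℤ × ℤ) : ℤ :=
  affineForm (v.1 ^ k * v.2 ^ (i + j)) (v.1 ^ (k + j) * v.2 ^ i) (binaryForm d c v.1 v.2) p

lemma monomial_le {x : ℝ} {N m n e f d : ℕ} (hN : (N : ℝ) ≤ x) (hd : e + f = d) (hm : m ≤ N)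
    (hn : n ≤ N) : ((m ^ e * n ^ f : ℕ) : ℝ) ≤ x ^ d := by
  have h1 : (m : ℝ) ≤ x := (Nat.cast_le.2 hm).trans hN
  have h2 : (n : ℝ) ≤ x := (Nat.cast_le.2 hn).trans hN
  have hx : 0 ≤ x := m.cast_nonneg.trans h1
  push_cast
  rw [← hd, pow_add]
  gcongr

/-- The correlations of the values at a generic pair `v` with those at all pairs, with the second
moments inserted. -/
lemma sum_norm_correlation_formValue_le {F : ℤ → ℂ} {Q : Finset ℕ} {d j k i : ℕ}
    {Λ x H L δ₀ κ B P y Δ : ℝ} {N E T T₁ h K M : ℕ} (S : Scale d j Λ x H N)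
    (Sh : ShiftLengths d j Λ x H L E T T₁) (D : MomentData F d x H B P h K M)
    (hQ : ∀ q ∈ Q, IsPrimePow q)
    (hF : EquidistributedOutside F Q d x L (((d : ℝ) + 3) * H * x ^ d) δ₀)
    (hd : k + i + j = d) {c : Fin (d + 1) → ℤ} (hc : ∀ i, |(c i : ℝ)| ≤ H)
    (hκ : (N : ℝ) ^ 2 / Λ ^ 6 ≤ κ)
    (hκQ : ∀ q ∈ Q, 2 * d * (N : ℝ) ^ 2 * (q : ℝ) ^ (-(1 / (2 * (d : ℝ)))) ≤ κ)
    (hy : 1 ≤ y) (hyx : y ^ d * Λ ^ (34 * d ^ 2 + 6 * d) ≤ gcdThreshold x)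
    (hΔ : ∑ z ∈ Icc 1 N ×ˢ Icc 1 N, tauGen B (z.1 ^ k * z.2 ^ (i + j)) ^ 2 ≤ Δ)
    {v : ℕ × ℕ} (hvN : v ∈ Icc 1 N ×ˢ Icc 1 N) (hv : GenericPair Q d k i j c Λ y N v) :
    ∑ z ∈ Icc 1 N ×ˢ Icc 1 N, ‖∑ p ∈ intBox h, F (formValue d k i j c v p) *
        (starRingEnd ℂ) (F (formValue d k i j c z p))‖ ≤
      √(P * Δ) * √((κ + N ^ 2 / (4 * Λ ^ 6)) * (P * tauGen B (v.1 ^ k * v.2 ^ (i + j)) ^ 2) +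
        1536 * N ^ 2 * H ^ 2 * Λ ^ (28 * d ^ 2) * δ₀ ^ 2) +
      √(2 / Λ ^ 3 * P * tauGen B (v.1 ^ k * v.2 ^ (i + j)) ^ 2) *
        ∑ z ∈ Icc 1 N ×ˢ Icc 1 N,
          √(2 / Λ ^ 3 * P * tauGen B (z.1 ^ k * z.2 ^ (i + j)) ^ 2) := by
  obtain ⟨m, n⟩ := v
  obtain ⟨hm, hn⟩ := mem_product.1 hvN
  obtain ⟨hm1, hmN⟩ := mem_Icc.1 hm
  obtain ⟨hn1, hnN⟩ := mem_Icc.1 hn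
  have hΛ := S.pos
  have hΛ1 := S.one_le
  have hx := S.x_pos
  have hP := D.P_nonneg S
  obtain ⟨γ, m', n', hγ, hcop, rfl, rfl⟩ := Nat.exists_coprime' (m := m) (n := n)
    (Nat.gcd_pos_of_pos_left _ hm1)
  have hγgcd : Nat.gcd (m' * γ) (n' * γ) = γ := by
    rw [Nat.gcd_mul_right, hcop, one_mul]
  have hm'1 : 1 ≤ m' := Nat.pos_of_mul_pos_right hm1
  have hn'1 : 1 ≤ n' := Nat.pos_of_mul_pos_right hn1
  obtain ⟨hgγ, hgmax, hg0, hg1, hgQ⟩ := hv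
  dsimp only at hgγ hgmax hg0 hg1 hgQ hm1 hmN hn1 hnN ⊢
  set W := (m' * γ) ^ k * (n' * γ) ^ i * γ ^ j with hW
  have hWa : W * n' ^ j = (m' * γ) ^ k * (n' * γ) ^ (i + j) := by rw [hW]; ring
  have hWb : W * m' ^ j = (m' * γ) ^ (k + j) * (n' * γ) ^ i := by rw [hW]; ring
  have hX : (((m' * γ) ^ k * (n' * γ) ^ (i + j) : ℕ) : ℝ) ≤ x ^ d :=
    monomial_le S.N_le (by omega) hmN hnN
  have hY : (((m' * γ) ^ (k + j) * (n' * γ) ^ i : ℕ) : ℝ) ≤ x ^ d :=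
    monomial_le S.N_le (by omega) hmN hnN
  have hX0 : (m' * γ) ^ k * (n' * γ) ^ (i + j) ≠ 0 := by positivity
  have hbin : ∀ z ∈ Icc 1 N ×ˢ Icc 1 N,
      |(binaryForm d c z.1 z.2 : ℝ)| ≤ ((d : ℝ) + 1) * H * x ^ d := fun z hz =>
    abs_binaryForm_le hc
      ((Nat.cast_le.2 (mem_Icc.1 (mem_product.1 hz).1).2).trans S.N_le)
      ((Nat.cast_le.2 (mem_Icc.1 (mem_product.1 hz).2).2).trans S.N_le)
  have hg := hbin _ hvN
  dsimp only at hg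
  have hm'N : (m' : ℝ) ≤ x :=
    (Nat.cast_le.2 ((Nat.le_mul_of_pos_right _ hγ).trans hmN)).trans S.N_le
  have hn'N : (n' : ℝ) ≤ x :=
    (Nat.cast_le.2 ((Nat.le_mul_of_pos_right _ hγ).trans hnN)).trans S.N_le
  rw [hγgcd] at hgγ
  -- `max (m', n') ≥ N / Λ ^ 10`, and the constant is absorbed by one more factor `Λ`
  have hmax' : x ^ j / Λ ^ (11 * d) ≤ ((max (n' ^ j) (m' ^ j) : ℕ) : ℝ) := by
    have h1 : x / Λ ^ 11 ≤ ((max m' n' : ℕ) : ℝ) := by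
      rw [← max_mul_of_nonneg m' n' γ.zero_le, Nat.cast_mul, div_le_iff₀ (by positivity)] at hgmax
      rw [div_le_iff₀ (by positivity)]
      have hμ0 : (0 : ℝ) ≤ ((max m' n' : ℕ) : ℝ) := Nat.cast_nonneg _
      have h4 : (4 : ℝ) ≤ Λ := by have := S.const_le; norm_num at this; linarith
      calc x ≤ 4 * N := S.x_le
        _ ≤ Λ * (((max m' n' : ℕ) : ℝ) * Λ ^ 6 * Λ ^ 4) := by
            have : (N : ℝ) ≤ ((max m' n' : ℕ) : ℝ) * Λ ^ 6 * Λ ^ 4 := hgmax.trans (by gcongr)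
            gcongr
        _ = _ := by ring
    have h2 : max (n' ^ j) (m' ^ j) = (max m' n') ^ j := by
      rw [max_comm]
      exact ((Nat.pow_left_strictMono (by have := S.one_le_j; omega)).monotone.map_max).symm
    rw [h2, Nat.cast_pow]
    calc x ^ j / Λ ^ (11 * d) ≤ x ^ j / Λ ^ (11 * j) := by
          gcongr
          exact S.j_le_d
      _ = (x / Λ ^ 11) ^ j := by rw [div_pow, pow_mul]
      _ ≤ _ := by gcongr
  have hgcd : (Nat.gcd (binaryForm d c ((m' * γ : ℕ) : ℤ) ((n' * γ : ℕ) : ℤ)).natAbs W : ℝ) *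
      Λ ^ (28 * d ^ 2) ≤ gcdThreshold x := by
    have h1 := gcd_binaryForm_le (c := c) hd hm1 hn1 hy (one_le_pow₀ hΛ1 : 1 ≤ Λ ^ 6) hg0 hg1
      (by rw [hγgcd]; exact hgγ)
    rw [hγgcd] at h1
    refine le_trans ?_ hyx
    calc _ ≤ y ^ d * (Λ ^ 6) ^ (d ^ 2 + d) * Λ ^ (28 * d ^ 2) := by gcongr
      _ = _ := by rw [← pow_mul, mul_assoc, ← pow_add]; congr 2; ring
  have key := sum_norm_correlation_le (F := F) (a := n' ^ j) (b := m' ^ j) (W := W)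
    (v := (m' * γ, n' * γ)) (k := k) (i := i) S Sh hQ hF (Nat.one_le_pow _ _ hn'1)
    (Nat.one_le_pow _ _ hm'1) (by rw [hW]; exact Nat.one_le_iff_ne_zero.2 (by positivity))
    (hcop.symm.pow j j) (by push_cast; gcongr) (by push_cast; gcongr) hmax'
    (by rw [← Nat.cast_mul, hWa]; exact hX) (by rw [← Nat.cast_mul, hWb]; exact hY)
    (by rw [hW]; dsimp only; rw [hγgcd]) hgQ hκ hκQ hg hgcd (D.h_le S)
    (fun z => z.1 ^ k * z.2 ^ (i + j)) (fun z => z.1 ^ (k + j) * z.2 ^ i)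
    (fun z => binaryForm d c z.1 z.2) (fun z => by ring) (M := P * Δ)
    (m₁ := P * tauGen B ((m' * γ) ^ k * (n' * γ) ^ (i + j)) ^ 2)
    (e₀ := 2 / Λ ^ 3 * P * tauGen B ((m' * γ) ^ k * (n' * γ) ^ (i + j)) ^ 2)
    (by
      refine le_trans (sum_le_sum fun z hz => ?_)
        ((mul_sum _ _ _).symm.le.trans (mul_le_mul_of_nonneg_left hΔ hP))
      obtain ⟨hz1, hz2⟩ := mem_product.1 hz
      rw [mem_Icc] at hz1 hz2
      have hz10 : z.1 ≠ 0 := by omega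
      have hz20 : z.2 ≠ 0 := by omega
      exact D.mass_le S (by positivity) (monomial_le S.N_le (by omega) hz1.2 hz2.2)
        (monomial_le S.N_le (by omega) hz1.2 hz2.2) (hbin z hz))
    (by
      rw [← hWa]
      exact D.progression_le S (Nat.one_le_pow _ _ hn'1)
        (by rw [hW]; exact Nat.one_le_iff_ne_zero.2 (by positivity))
        (by push_cast; gcongr) (by push_cast; gcongr)
        (by rw [← Nat.cast_mul, hWa]; exact hX) (by rw [← Nat.cast_mul, hWb]; exact hY) hg)
    (by rw [hWa, hWb]; exact D.edge_le S Sh hX0 hX hY hg)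
  rw [hWa, hWb] at key
  refine key.trans (add_le_add le_rfl (mul_le_mul_of_nonneg_left (sum_le_sum fun z hz =>
    Real.sqrt_le_sqrt ?_) (Real.sqrt_nonneg _)))
  obtain ⟨hz1, hz2⟩ := mem_product.1 hz
  rw [mem_Icc] at hz1 hz2
  have hz10 : z.1 ≠ 0 := by omega
  have hz20 : z.2 ≠ 0 := by omega
  exact D.edge_le S Sh (by positivity) (monomial_le S.N_le (by omega) hz1.2 hz2.2)
    (monomial_le S.N_le (by omega) hz1.2 hz2.2) (hbin z hz)

/-- Expanding the square: the coefficients disappear from the correlations. -/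
lemma sum_norm_sq_le_sum_norm_correlation {ι κ : Type*} (V : Finset ι) (Ω : Finset κ) (α : ι → ℂ)
    (hα : ∀ v ∈ V, ‖α v‖ ≤ 1) (f : ι → κ → ℂ) :
    ∑ p ∈ Ω, ‖∑ v ∈ V, α v * f v p‖ ^ 2 ≤
      ∑ v ∈ V, ∑ z ∈ V, ‖∑ p ∈ Ω, f v p * (starRingEnd ℂ) (f z p)‖ := by
  have h1 : ((∑ p ∈ Ω, ‖∑ v ∈ V, α v * f v p‖ ^ 2 : ℝ) : ℂ) =
      ∑ v ∈ V, ∑ z ∈ V, α v * (starRingEnd ℂ) (α z) *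
        ∑ p ∈ Ω, f v p * (starRingEnd ℂ) (f z p) := by
    push_cast
    simp_rw [← Complex.mul_conj', map_sum, sum_mul_sum, mul_sum]
    rw [sum_comm]
    refine sum_congr rfl fun v _ => ?_
    rw [sum_comm]
    refine sum_congr rfl fun z _ => sum_congr rfl fun p _ => ?_
    rw [map_mul]
    ring
  have h0 : 0 ≤ ∑ p ∈ Ω, ‖∑ v ∈ V, α v * f v p‖ ^ 2 := sum_nonneg fun _ _ => sq_nonneg _
  rw [← abs_of_nonneg h0, ← Real.norm_eq_abs, ← Complex.norm_real, h1]
  refine (norm_sum_le _ _).trans (sum_le_sum fun v hv => (norm_sum_le _ _).trans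
    (sum_le_sum fun z hz => ?_))
  rw [norm_mul, norm_mul, RCLike.norm_conj]
  exact mul_le_of_le_one_left (norm_nonneg _)
    (mul_le_one₀ (hα v hv) (norm_nonneg _) (hα z hz))

lemma norm_sum_mul_conj_le {κ : Type*} (Ω : Finset κ) (f g : κ → ℂ) :
    ‖∑ p ∈ Ω, f p * (starRingEnd ℂ) (g p)‖ ≤ √(∑ p ∈ Ω, ‖f p‖ ^ 2) * √(∑ p ∈ Ω, ‖g p‖ ^ 2) := by
  refine (norm_sum_le _ _).trans ?_
  simp_rw [norm_mul, RCLike.norm_conj]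
  exact sum_norm_mul_norm_le Ω f g

lemma sum_sqrt_le_sqrt_card_mul {ι : Type*} (s : Finset ι) {f : ι → ℝ} (hf : ∀ v, 0 ≤ f v) :
    ∑ v ∈ s, √(f v) ≤ √(#s) * √(∑ v ∈ s, f v) := by
  have := Real.sum_sqrt_mul_sqrt_le s (f := fun _ => (1 : ℝ)) (fun _ => zero_le_one) hf
  simpa using this

/-- The final numerical estimate: `q ^ 2` is the total mass, `b` the number of bad pairs. -/
lemma combined_bound_le {H N Λ κ J q b cP cκ cJ cb : ℝ} (hH : 0 < H) (hN : 0 < N) (hΛ : 0 < Λ)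
    (hq0 : 0 ≤ q) (hcP : 0 ≤ cP) (hcκ : 0 ≤ cκ) (hcb : 0 ≤ cb) (hcJ : 0 ≤ cJ)
    (hq : q ≤ cP * (H ^ 2 * N ^ 2 * Λ ^ 2)) (hκ : κ ≤ cκ * (N ^ 2 / Λ ^ 6))
    (hJ : J ≤ cJ * (N ^ 2 * H ^ 2 / Λ ^ 4)) (hb : b ≤ cb * (N ^ 2 / Λ ^ 6)) :
    √q * (N * √(κ * q + N ^ 2 * J)) + 2 / Λ ^ 3 * (N * √q) ^ 2 + √b * √q * (N * √q) ≤
      (√cP * √(cκ * cP + cJ) + 2 * cP + √cb * cP) * (H ^ 2 * N ^ 4 / Λ) := by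
  have hsq : √q ≤ √cP * (H * N * Λ) := by
    refine (Real.sqrt_le_sqrt hq).trans (le_of_eq ?_)
    rw [show H ^ 2 * N ^ 2 * Λ ^ 2 = (H * N * Λ) ^ 2 by ring, Real.sqrt_mul hcP,
      Real.sqrt_sq (by positivity)]
  have hsb : √b ≤ √cb * (N / Λ ^ 3) := by
    refine (Real.sqrt_le_sqrt hb).trans (le_of_eq ?_)
    rw [show N ^ 2 / Λ ^ 6 = (N / Λ ^ 3) ^ 2 by ring, Real.sqrt_mul hcb,
      Real.sqrt_sq (by positivity)]
  have hin : √(κ * q + N ^ 2 * J) ≤ √(cκ * cP + cJ) * (H * N ^ 2 / Λ ^ 2) := by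
    have h1 : κ * q + N ^ 2 * J ≤ (cκ * cP + cJ) * (H * N ^ 2 / Λ ^ 2) ^ 2 := by
      calc κ * q + N ^ 2 * J ≤ cκ * (N ^ 2 / Λ ^ 6) * (cP * (H ^ 2 * N ^ 2 * Λ ^ 2)) +
            N ^ 2 * (cJ * (N ^ 2 * H ^ 2 / Λ ^ 4)) := by gcongr
        _ = _ := by field_simp
    refine (Real.sqrt_le_sqrt h1).trans (le_of_eq ?_)
    rw [Real.sqrt_mul (by positivity), Real.sqrt_sq (by positivity)]
  have hsq0 := Real.sqrt_nonneg q
  have hqq : √q * √q = q := Real.mul_self_sqrt hq0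
  have t1 : √q * (N * √(κ * q + N ^ 2 * J)) ≤
      √cP * √(cκ * cP + cJ) * (H ^ 2 * N ^ 4 / Λ) := by
    calc _ ≤ (√cP * (H * N * Λ)) * (N * (√(cκ * cP + cJ) * (H * N ^ 2 / Λ ^ 2))) := by gcongr
      _ = _ := by field_simp
  have t2 : 2 / Λ ^ 3 * (N * √q) ^ 2 ≤ 2 * cP * (H ^ 2 * N ^ 4 / Λ) := by
    calc _ = 2 / Λ ^ 3 * N ^ 2 * q := by rw [mul_pow, Real.sq_sqrt hq0]; ring
      _ ≤ 2 / Λ ^ 3 * N ^ 2 * (cP * (H ^ 2 * N ^ 2 * Λ ^ 2)) := by gcongr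
      _ = _ := by field_simp
  have t3 : √b * √q * (N * √q) ≤ √cb * cP * (H ^ 2 * N ^ 4 / Λ) := by
    calc _ = √b * N * q := by rw [← hqq, Real.sqrt_mul_self hsq0]; ring
      _ ≤ √cb * (N / Λ ^ 3) * N * (cP * (H ^ 2 * N ^ 2 * Λ ^ 2)) := by gcongr
      _ = _ := by field_simp
  calc _ ≤ _ := add_le_add (add_le_add t1 t2) t3
    _ = _ := by ring

/-- The bound in terms of the parameters: `q = P Δ` is the total mass. Generic pairs `v` are treated
by `sum_norm_correlation_formValue_le`, the exceptional ones by Cauchy–Schwarz. -/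
lemma sum_norm_sq_formValue_le {F : ℤ → ℂ} {Q : Finset ℕ} {d j k i : ℕ}
    {Λ x H L δ₀ κ B P y Δ cP cκ cJ cb : ℝ} {N E T T₁ h K M : ℕ} (S : Scale d j Λ x H N)
    (Sh : ShiftLengths d j Λ x H L E T T₁) (D : MomentData F d x H B P h K M)
    (hQ : ∀ q ∈ Q, IsPrimePow q)
    (hF : EquidistributedOutside F Q d x L (((d : ℝ) + 3) * H * x ^ d) δ₀)
    (hd : k + i + j = d) {c : Fin (d + 1) → ℤ} (hc : ∀ i, |(c i : ℝ)| ≤ H)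
    (hκ : (N : ℝ) ^ 2 / Λ ^ 6 ≤ κ)
    (hκQ : ∀ q ∈ Q, 2 * d * (N : ℝ) ^ 2 * (q : ℝ) ^ (-(1 / (2 * (d : ℝ)))) ≤ κ)
    (hy : 1 ≤ y) (hyx : y ^ d * Λ ^ (34 * d ^ 2 + 6 * d) ≤ gcdThreshold x)
    (hΔ : ∑ z ∈ Icc 1 N ×ˢ Icc 1 N, tauGen B (z.1 ^ k * z.2 ^ (i + j)) ^ 2 ≤ Δ)
    (hcP : 0 ≤ cP) (hcκ : 0 ≤ cκ) (hcJ : 0 ≤ cJ) (hcb : 0 ≤ cb)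
    (hPΔ : P * Δ ≤ cP * (H ^ 2 * N ^ 2 * Λ ^ 2))
    (hκle : κ + (N : ℝ) ^ 2 / (4 * Λ ^ 6) ≤ cκ * (N ^ 2 / Λ ^ 6))
    (hJ : 1536 * (N : ℝ) ^ 2 * H ^ 2 * Λ ^ (28 * d ^ 2) * δ₀ ^ 2 ≤ cJ * (N ^ 2 * H ^ 2 / Λ ^ 4))
    {bad : Finset (ℕ × ℕ)}
    (hbad : ∀ v ∈ Icc 1 N ×ˢ Icc 1 N, v ∉ bad → GenericPair Q d k i j c Λ y N v)
    (hbadV : bad ⊆ Icc 1 N ×ˢ Icc 1 N) (hbc : (#bad : ℝ) ≤ cb * (N ^ 2 / Λ ^ 6))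
    (α : ℕ × ℕ → ℂ) (hα : ∀ v, ‖α v‖ ≤ 1) :
    ∑ p ∈ intBox h, ‖∑ v ∈ Icc 1 N ×ˢ Icc 1 N, α v * F (formValue d k i j c v p)‖ ^ 2 ≤
      (√cP * √(cκ * cP + cJ) + 2 * cP + √cb * cP) * (H ^ 2 * N ^ 4 / Λ) := by
  have hΛ := S.pos
  have hP := D.P_nonneg S
  have hN0 : (0 : ℝ) < N := by linarith [S.x_le, S.one_le_x]
  have hκ0 : 0 ≤ κ + (N : ℝ) ^ 2 / (4 * Λ ^ 6) := by
    have : 0 ≤ κ := le_trans (by positivity) hκ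
    positivity
  set V := Icc 1 N ×ˢ Icc 1 N with hV
  have hVc : √(#V : ℝ) = N := by
    rw [hV, card_product, Nat.card_Icc, Nat.add_sub_cancel, Nat.cast_mul,
      Real.sqrt_mul_self hN0.le]
  set u : ℕ × ℕ → ℝ := fun v => P * tauGen B (v.1 ^ k * v.2 ^ (i + j)) ^ 2 with hu
  have hu0 : ∀ v, 0 ≤ u v := fun v => mul_nonneg hP (sq_nonneg _)
  have huΔ : ∑ v ∈ V, u v ≤ P * Δ := by
    rw [hu, ← mul_sum]; exact mul_le_mul_of_nonneg_left hΔ hP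
  have hPΔ0 : 0 ≤ P * Δ := (sum_nonneg fun v _ => hu0 v).trans huΔ
  have hsumu : ∀ s ⊆ V, ∑ v ∈ s, √(u v) ≤ √(#s) * √(P * Δ) := fun s hs =>
    (sum_sqrt_le_sqrt_card_mul s hu0).trans (mul_le_mul_of_nonneg_left (Real.sqrt_le_sqrt
      ((sum_le_sum_of_subset_of_nonneg hs fun v _ _ => hu0 v).trans huΔ)) (Real.sqrt_nonneg _))
  have hsumV : ∑ v ∈ V, √(u v) ≤ N * √(P * Δ) := by
    have := hsumu V subset_rfl
    rwa [hVc] at this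
  have hsumV0 : 0 ≤ ∑ v ∈ V, √(u v) := sum_nonneg fun _ _ => Real.sqrt_nonneg _
  set J := 1536 * (N : ℝ) ^ 2 * H ^ 2 * Λ ^ (28 * d ^ 2) * δ₀ ^ 2 with hJdef
  have hJ0 : 0 ≤ J := by positivity
  set κ' := κ + (N : ℝ) ^ 2 / (4 * Λ ^ 6) with hκ'
  set corr : ℕ × ℕ → ℝ := fun v => ∑ z ∈ V, ‖∑ p ∈ intBox h, F (formValue d k i j c v p) *
        (starRingEnd ℂ) (F (formValue d k i j c z p))‖ with hcorr
  have hgood : ∀ v ∈ V \ bad, corr v ≤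
      √(P * Δ) * √(κ' * u v + J) + √(2 / Λ ^ 3) * √(u v) * (√(2 / Λ ^ 3) * ∑ z ∈ V, √(u z)) := by
    intro v hv
    obtain ⟨hvV, hvb⟩ := mem_sdiff.1 hv
    have h1 := sum_norm_correlation_formValue_le S Sh D hQ hF hd hc hκ hκQ hy hyx hΔ hvV
      (hbad v hvV hvb)
    have h2 : ∀ z : ℕ × ℕ, √(2 / Λ ^ 3 * P * tauGen B (z.1 ^ k * z.2 ^ (i + j)) ^ 2) =
        √(2 / Λ ^ 3) * √(u z) := fun z => by
      rw [mul_assoc, Real.sqrt_mul (by positivity)]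
    simp_rw [h2] at h1
    rw [← mul_sum] at h1
    exact h1
  have hmass : ∀ v ∈ V, ∑ p ∈ intBox h, ‖F (formValue d k i j c v p)‖ ^ 2 ≤ u v := by
    intro v hv
    obtain ⟨hv1, hv2⟩ := mem_product.1 hv
    rw [mem_Icc] at hv1 hv2
    have hv10 : v.1 ≠ 0 := by omega
    have hv20 : v.2 ≠ 0 := by omega
    exact D.mass_le S (by positivity) (monomial_le S.N_le (by omega) hv1.2 hv2.2)
      (monomial_le S.N_le (by omega) hv1.2 hv2.2)
      (abs_binaryForm_le hc ((Nat.cast_le.2 hv1.2).trans S.N_le)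
        ((Nat.cast_le.2 hv2.2).trans S.N_le))
  have hbadv : ∀ v ∈ bad, corr v ≤ √(u v) * ∑ z ∈ V, √(u z) := by
    intro v hv
    rw [mul_sum]
    exact sum_le_sum fun z hz => (norm_sum_mul_conj_le _ _ _).trans
      (mul_le_mul (Real.sqrt_le_sqrt (hmass v (hbadV hv))) (Real.sqrt_le_sqrt (hmass z hz))
        (Real.sqrt_nonneg _) (Real.sqrt_nonneg _))
  have hgv0 : ∀ v, 0 ≤ κ' * u v + J := fun v => add_nonneg (mul_nonneg hκ0 (hu0 v)) hJ0
  have hgoodsum : ∑ v ∈ V \ bad, corr v ≤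
      √(P * Δ) * (N * √(κ' * (P * Δ) + N ^ 2 * J)) + 2 / Λ ^ 3 * (N * √(P * Δ)) ^ 2 := by
    have h1 : ∑ v ∈ V, √(κ' * u v + J) ≤ N * √(κ' * (P * Δ) + N ^ 2 * J) := by
      have h2 := sum_sqrt_le_sqrt_card_mul V hgv0
      rw [hVc, sum_add_distrib, ← mul_sum, sum_const, nsmul_eq_mul] at h2
      have hc2 : (#V : ℝ) = (N : ℝ) ^ 2 := by
        rw [hV, card_product, Nat.card_Icc, Nat.add_sub_cancel, Nat.cast_mul, sq]
      rw [hc2] at h2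
      refine h2.trans (mul_le_mul_of_nonneg_left (Real.sqrt_le_sqrt ?_) hN0.le)
      exact add_le_add (mul_le_mul_of_nonneg_left huΔ hκ0) le_rfl
    have h3 : √(2 / Λ ^ 3) * √(2 / Λ ^ 3) = 2 / Λ ^ 3 := Real.mul_self_sqrt (by positivity)
    have hs2 := Real.sqrt_nonneg (2 / Λ ^ 3)
    have hterm0 : ∀ v, 0 ≤ √(P * Δ) * √(κ' * u v + J) + √(2 / Λ ^ 3) * √(u v) *
        (√(2 / Λ ^ 3) * ∑ z ∈ V, √(u z)) := fun v =>
      add_nonneg (mul_nonneg (Real.sqrt_nonneg _) (Real.sqrt_nonneg _))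
        (mul_nonneg (mul_nonneg hs2 (Real.sqrt_nonneg _)) (mul_nonneg hs2 hsumV0))
    calc _ ≤ ∑ v ∈ V \ bad, (√(P * Δ) * √(κ' * u v + J) + √(2 / Λ ^ 3) * √(u v) *
          (√(2 / Λ ^ 3) * ∑ z ∈ V, √(u z))) := sum_le_sum hgood
      _ ≤ ∑ v ∈ V, (√(P * Δ) * √(κ' * u v + J) + √(2 / Λ ^ 3) * √(u v) *
          (√(2 / Λ ^ 3) * ∑ z ∈ V, √(u z))) :=
          sum_le_sum_of_subset_of_nonneg sdiff_subset fun v _ _ => hterm0 v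
      _ = √(P * Δ) * ∑ v ∈ V, √(κ' * u v + J) +
          √(2 / Λ ^ 3) * √(2 / Λ ^ 3) * (∑ v ∈ V, √(u v)) ^ 2 := by
          rw [sum_add_distrib, ← mul_sum, ← sum_mul, ← mul_sum]; ring
      _ ≤ _ := by
          rw [h3]
          refine add_le_add (mul_le_mul_of_nonneg_left h1 (Real.sqrt_nonneg _))
            (mul_le_mul_of_nonneg_left (pow_le_pow_left₀ hsumV0 hsumV 2) (by positivity))
  have hbadsum : ∑ v ∈ bad, corr v ≤ √(#bad : ℝ) * √(P * Δ) * (N * √(P * Δ)) := by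
    refine (sum_le_sum hbadv).trans ?_
    rw [← sum_mul]
    exact mul_le_mul (hsumu bad hbadV) hsumV hsumV0
      (mul_nonneg (Real.sqrt_nonneg _) (Real.sqrt_nonneg _))
  have hall : ∑ p ∈ intBox h, ‖∑ v ∈ V, α v * F (formValue d k i j c v p)‖ ^ 2 ≤
      ∑ v ∈ V \ bad, corr v + ∑ v ∈ bad, corr v := by
    rw [sum_sdiff hbadV]
    exact sum_norm_sq_le_sum_norm_correlation V (intBox h) α (fun v _ => hα v)
      fun v p => F (formValue d k i j c v p)
  refine hall.trans ((add_le_add hgoodsum hbadsum).trans ?_)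
  exact combined_bound_le S.H_pos hN0 hΛ hPΔ0 hcP hcκ hcb hcJ hPΔ hκle hJ hbc

/-! ### Asymptotics in `log x` -/

open Filter Asymptotics in
/-- The conditions on `log x` under which all parameters are in the required order of size. -/
lemma eventually_logarithmic_conditions (A ε D₀ D₁ : ℝ) (hA : 0 < A) (hε : 0 < ε) (r s : ℕ) :
    ∀ᶠ u : ℝ in atTop, D₀ ≤ u ^ A ∧ (u ^ A) ^ r ≤ Real.exp u ∧
      26 * (u ^ A) ^ s < Real.exp (ε * u) ∧ D₁ * Real.log u ^ 3 ≤ √u := by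
  have h1 : ∀ᶠ u : ℝ in atTop, D₀ ≤ u ^ A := (tendsto_rpow_atTop hA).eventually_ge_atTop D₀
  have h2 := (isLittleO_rpow_exp_pos_mul_atTop (A * r) one_pos).bound one_pos
  have h3 := (isLittleO_rpow_exp_pos_mul_atTop (A * s) hε).bound (by norm_num : (0 : ℝ) < 1 / 27)
  have h4 := (isLittleO_log_rpow_rpow_atTop (3 : ℝ) (by norm_num : (0 : ℝ) < 1 / 2)).bound
    (by positivity : 0 < 1 / (|D₁| + 1))
  filter_upwards [h1, h2, h3, h4, eventually_ge_atTop 1] with u k1 k2 k3 k4 hu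
  have hu0 : 0 ≤ u := by linarith
  have hpow : ∀ n : ℕ, (u ^ A) ^ n = u ^ (A * n) := fun n => by
    rw [← Real.rpow_natCast, ← Real.rpow_mul hu0]
  refine ⟨k1, ?_, ?_, ?_⟩
  · rw [hpow]
    rw [Real.norm_of_nonneg (by positivity), Real.norm_of_nonneg (Real.exp_nonneg _), one_mul,
      one_mul] at k2
    exact k2
  · rw [hpow]
    rw [Real.norm_of_nonneg (by positivity), Real.norm_of_nonneg (Real.exp_nonneg _)] at k3
    have := Real.exp_pos (ε * u)
    linarith
  · have hl : 0 ≤ Real.log u := Real.log_nonneg hu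
    rw [Real.norm_of_nonneg (by positivity), Real.norm_of_nonneg (by positivity),
      ← Real.sqrt_eq_rpow, one_div_mul_eq_div, le_div_iff₀ (by positivity)] at k4
    have h5 : Real.log u ^ (3 : ℝ) = Real.log u ^ 3 := by
      exact_mod_cast Real.rpow_natCast (Real.log u) 3
    rw [h5] at k4
    have h6 : 0 ≤ Real.log u ^ 3 := by positivity
    nlinarith [le_abs_self D₁]

/-- The bound `y` for the common factors, which is `exp (O((log Λ) ^ 2))`, is below the gcd
threshold `exp (√u / log u)`, where `u = log x`. -/
lemma threshold_bound {A u Λ : ℝ} (hA : 1 ≤ A) (d : ℕ) (hu : Real.exp 1 ≤ u) (hΛ : Λ = u ^ A)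
    (hΛ6 : 10 ^ 6 ≤ Λ)
    (hD : (336 * d * A ^ 2 + (34 * d ^ 2 + 6 * d) * A) * Real.log u ^ 3 ≤ √u) :
    (((⌈Λ ^ 7⌉₊ : ℝ)) ^ (3 * Nat.clog 2 ⌈Λ ^ 8⌉₊)) ^ d * Λ ^ (34 * d ^ 2 + 6 * d) ≤
      Real.exp (√u / Real.log u) := by
  have hu0 : 0 < u := (Real.exp_pos 1).trans_le hu
  have hlu : 1 ≤ Real.log u := by rw [Real.le_log_iff_exp_le hu0]; exact hu
  have hΛ0 : 0 < Λ := by linarith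
  have hΛ1 : 1 ≤ Λ := by norm_num at hΛ6; linarith
  set ℓ := Real.log Λ with hℓ
  have hℓA : ℓ = A * Real.log u := by rw [hℓ, hΛ, Real.log_rpow hu0]
  have hℓ0 : 0 ≤ ℓ := Real.log_nonneg hΛ1
  have hexp : Λ = Real.exp ℓ := (Real.exp_log hΛ0).symm
  set ν := Nat.clog 2 ⌈Λ ^ 8⌉₊ with hν
  have hceil : ∀ n : ℕ, (⌈Λ ^ n⌉₊ : ℝ) ≤ 2 * Λ ^ n := fun n => by
    have h1 := (Nat.ceil_lt_add_one (by positivity : 0 ≤ Λ ^ n)).le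
    have h2 : 1 ≤ Λ ^ n := one_le_pow₀ hΛ1
    linarith
  have hR : (⌈Λ ^ 7⌉₊ : ℝ) ≤ Real.exp (8 * ℓ) := by
    have h1 : Real.exp (8 * ℓ) = Λ ^ 8 := by
      rw [hexp, ← Real.exp_nat_mul]; norm_num
    rw [h1]
    calc _ ≤ 2 * Λ ^ 7 := hceil 7
      _ ≤ Λ * Λ ^ 7 := by gcongr; norm_num at hΛ6; linarith
      _ = _ := by ring
  have hν14 : (ν : ℝ) ≤ 14 * ℓ := by
    have hc2 : 1 < ⌈Λ ^ 8⌉₊ := by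
      have h1 : (1 : ℝ) < ⌈Λ ^ 8⌉₊ := by
        have h2 : Λ ≤ Λ ^ 8 := le_self_pow₀ hΛ1 (by norm_num)
        have h3 := Nat.le_ceil (Λ ^ 8)
        norm_num at hΛ6
        linarith
      exact_mod_cast h1
    have h1 : 2 ^ (ν - 1) < ⌈Λ ^ 8⌉₊ := Nat.pow_pred_clog_lt_self (by norm_num) hc2
    have hν1 : 1 ≤ ν := Nat.clog_pos (by norm_num) hc2
    have h2 : (2 : ℝ) ^ ν ≤ Λ ^ 9 := by
      have h3 : (2 : ℝ) ^ (ν - 1) ≤ ⌈Λ ^ 8⌉₊ := by exact_mod_cast h1.le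
      calc (2 : ℝ) ^ ν = 2 * 2 ^ (ν - 1) := by rw [← pow_succ', Nat.sub_add_cancel hν1]
        _ ≤ 2 * (2 * Λ ^ 8) := by have := hceil 8; gcongr; linarith
        _ = 4 * Λ ^ 8 := by ring
        _ ≤ Λ * Λ ^ 8 := by gcongr; norm_num at hΛ6; linarith
        _ = _ := by ring
    have h4 := Real.log_le_log (by positivity) h2
    rw [Real.log_pow, Real.log_pow] at h4
    push_cast at h4
    have h5 := Real.log_two_gt_d9
    have hν0 : (0 : ℝ) ≤ ν := ν.cast_nonneg
    nlinarith
  have hpowR : (((⌈Λ ^ 7⌉₊ : ℝ)) ^ (3 * ν)) ^ d ≤ Real.exp (336 * d * ℓ ^ 2) := by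
    calc (((⌈Λ ^ 7⌉₊ : ℝ)) ^ (3 * ν)) ^ d ≤ ((Real.exp (8 * ℓ)) ^ (3 * ν)) ^ d := by gcongr
      _ = Real.exp (24 * d * ℓ * ν) := by
          rw [← pow_mul, ← Real.exp_nat_mul]; congr 1; push_cast; ring
      _ ≤ Real.exp (336 * d * ℓ ^ 2) := by
          refine Real.exp_le_exp.2 ?_
          calc 24 * d * ℓ * ν ≤ 24 * d * ℓ * (14 * ℓ) := by gcongr
            _ = _ := by ring
  have hpowΛ : Λ ^ (34 * d ^ 2 + 6 * d) = Real.exp ((34 * d ^ 2 + 6 * d) * ℓ) := by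
    nth_rewrite 1 [hexp]
    rw [← Real.exp_nat_mul]
    push_cast
    rfl
  calc _ ≤ Real.exp (336 * d * ℓ ^ 2) * Real.exp ((34 * d ^ 2 + 6 * d) * ℓ) := by
        rw [hpowΛ]; gcongr
    _ = Real.exp (336 * d * ℓ ^ 2 + (34 * d ^ 2 + 6 * d) * ℓ) := (Real.exp_add _ _).symm
    _ ≤ _ := by
        refine Real.exp_le_exp.2 ?_
        rw [le_div_iff₀ (by linarith), hℓA]
        refine le_trans ?_ hD
        have h1 : Real.log u ^ 2 ≤ Real.log u ^ 3 := pow_le_pow_right₀ hlu (by norm_num)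
        calc _ = 336 * d * A ^ 2 * Real.log u ^ 3 + (34 * d ^ 2 + 6 * d) * A * Real.log u ^ 2 := by
              ring
          _ ≤ 336 * d * A ^ 2 * Real.log u ^ 3 + (34 * d ^ 2 + 6 * d) * A * Real.log u ^ 3 := by
              gcongr
          _ = _ := by ring

/-- The logarithmic powers in the second moments cost at most `Λ ^ 2`, thanks to the largeness of
`A` compared with `B`. -/
lemma moment_product_le {A B u Λ H M : ℝ} {d N : ℕ} (hA : 1 ≤ A) (hd : 1 ≤ d) (hB : 1 ≤ B)
    (hBA : 200 * B ^ (2 * d + 4) ≤ A) (hu : 1 ≤ u) (hΛ : Λ = u ^ A) (hM : 0 ≤ Real.log M)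
    (hlogM : 1 + Real.log M ≤ 3 * u ^ 100) (hN : 0 ≤ Real.log N)
    (hlogN : 1 + Real.log N ≤ 2 * u) :
    60 * B ^ 2 * H ^ 2 * (1 + Real.log M) ^ ⌈B ^ 4⌉₊ *
      (N ^ 2 * (1 + Real.log N) ^ (2 * ⌈B ^ (2 * d)⌉₊)) ≤
      60 * A ^ 2 * 12 ^ ⌈A⌉₊ * (H ^ 2 * N ^ 2 * Λ ^ 2) := by
  set K := ⌈B ^ 4⌉₊ with hK
  set K' := ⌈B ^ (2 * d)⌉₊ with hK'
  have hB0 : 0 < B := by linarith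
  have p1 : B ^ 4 ≤ B ^ (2 * d + 4) := pow_le_pow_right₀ hB (by omega)
  have p2 : B ^ (2 * d) ≤ B ^ (2 * d + 4) := pow_le_pow_right₀ hB (by omega)
  have p3 : B ≤ B ^ (2 * d + 4) := le_self_pow₀ hB (by omega)
  have p4 : 1 ≤ B ^ (2 * d + 4) := one_le_pow₀ hB
  have p5 : B ^ 2 * B ^ 4 ≤ B ^ (2 * d + 4) := by
    rw [← pow_add]; exact pow_le_pow_right₀ hB (by omega)
  have hKle : (K : ℝ) ≤ B ^ 4 + 1 := (Nat.ceil_lt_add_one (by positivity)).le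
  have hK'le : (K' : ℝ) ≤ B ^ (2 * d) + 1 := (Nat.ceil_lt_add_one (by positivity)).le
  have hBA' : B ≤ A := by linarith
  have hAceil := Nat.le_ceil A
  have hKA : K ≤ ⌈A⌉₊ := by
    have : (K : ℝ) ≤ ⌈A⌉₊ := by linarith
    exact_mod_cast this
  have hK'A : K' ≤ ⌈A⌉₊ := by
    have : (K' : ℝ) ≤ ⌈A⌉₊ := by linarith
    exact_mod_cast this
  have hexp : u ^ (100 * K + 2 * K') ≤ Λ ^ 2 := by
    rw [hΛ, ← Real.rpow_natCast, ← Real.rpow_natCast, ← Real.rpow_mul (by linarith)]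
    refine Real.rpow_le_rpow_of_exponent_le hu ?_
    push_cast
    linarith
  calc _ ≤ 60 * A ^ 2 * H ^ 2 * (3 * u ^ 100) ^ K * (N ^ 2 * (2 * u) ^ (2 * K')) := by gcongr
    _ = 60 * A ^ 2 * (3 ^ K * 4 ^ K') * (H ^ 2 * N ^ 2 * u ^ (100 * K + 2 * K')) := by
        rw [mul_pow, mul_pow, pow_add, ← pow_mul, pow_mul 2 2 K']
        norm_num
        ring
    _ ≤ 60 * A ^ 2 * (3 ^ ⌈A⌉₊ * 4 ^ ⌈A⌉₊) * (H ^ 2 * N ^ 2 * Λ ^ 2) := by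
        gcongr <;> norm_num
    _ = _ := by rw [← mul_pow]; norm_num

/-! ### Assembling the bound -/

/-- The sum of the theorem as a sum over pairs `p = (a, b)` of squares of sums over pairs
`v = (m, n)`. -/
lemma sum_eq_sum_formValue (F : ℤ → ℂ) {d k l : ℕ} (hkl : k < l) (hld : l ≤ d)
    (c : Fin (d + 1) → ℤ) (α : ℕ → ℕ → ℂ) {H : ℝ} (hH : 0 ≤ H) (N : ℕ) :
    ∑ a ∈ Icc (-⌊H⌋) ⌊H⌋, ∑ b ∈ Icc (-⌊H⌋) ⌊H⌋,
      ‖∑ m ∈ Icc 1 N, ∑ n ∈ Icc 1 N, α m n * F (a * (m : ℤ) ^ k * (n : ℤ) ^ (d - k)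
        + b * (m : ℤ) ^ l * (n : ℤ) ^ (d - l) + binaryForm d c m n)‖ ^ 2 =
    ∑ p ∈ intBox ⌊H⌋₊, ‖∑ v ∈ Icc 1 N ×ˢ Icc 1 N,
      α v.1 v.2 * F (formValue d k (d - l) (l - k) c v p)‖ ^ 2 := by
  rw [intBox, Int.natCast_floor_eq_floor hH, sum_product]
  refine sum_congr rfl fun a _ => sum_congr rfl fun b _ => ?_
  rw [sum_product]
  congr 2
  refine sum_congr rfl fun m _ => sum_congr rfl fun n _ => ?_
  rw [formValue, affineForm, show d - l + (l - k) = d - k by omega, show k + (l - k) = l by omega]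
  push_cast
  congr 2
  ring

/-- For bounded `H` the sum is bounded trivially. -/
lemma sum_norm_sq_le_of_bounded (A : ℝ) {d : ℕ} (hd : 1 ≤ d) (H₁ : ℝ) :
    ∃ C : ℝ, 0 ≤ C ∧ ∀ H x : ℝ, 1 ≤ H → H ≤ H₁ → 1 ≤ x → x ^ (2 * d) ≤ H → ∀ F : ℤ → ℂ,
      (∀ n : ℤ, ‖F n‖ ≤ tauGen A n.natAbs) → ∀ k i j : ℕ, k + i + j = d →
      ∀ c : Fin (d + 1) → ℤ, (∀ i, |(c i : ℝ)| ≤ H) → ∀ α : ℕ × ℕ → ℂ, (∀ v, ‖α v‖ ≤ 1) →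
      ∀ N : ℕ, (N : ℝ) ≤ x → ∑ p ∈ intBox ⌊H⌋₊, ‖∑ v ∈ Icc 1 N ×ˢ Icc 1 N,
        α v * F (formValue d k i j c v p)‖ ^ 2 ≤ C * (H ^ 2 * x ^ 4) := by
  set M := ⌊((d : ℝ) + 3) * H₁ * H₁⌋₊ with hM
  set τ := ∑ n ∈ range (M + 1), |tauGen A n| with hτ
  have hτ0 : 0 ≤ τ := sum_nonneg fun _ _ => abs_nonneg _
  refine ⟨9 * τ ^ 2, by positivity, fun H x hH hHH₁ hx hxH F hF k i j hd' c hc α hα N hN => ?_⟩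
  have hH0 : 0 < H := by linarith
  have hxd : x ^ d ≤ H := (pow_le_pow_right₀ hx (by omega)).trans hxH
  have hbound : ∀ p ∈ intBox ⌊H⌋₊, ∀ v ∈ Icc 1 N ×ˢ Icc 1 N,
      ‖F (formValue d k i j c v p)‖ ≤ τ := by
    intro p hp v hv
    obtain ⟨hv1, hv2⟩ := mem_product.1 hv
    rw [mem_Icc] at hv1 hv2
    obtain ⟨hp1, hp2⟩ := mem_intBox.1 hp
    have hh : ((⌊H⌋₊ : ℕ) : ℝ) ≤ H := Nat.floor_le hH0.le
    have hp1' : |(p.1 : ℝ)| ≤ H :=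
      (show |(p.1 : ℝ)| ≤ ((⌊H⌋₊ : ℕ) : ℝ) by exact_mod_cast hp1).trans hh
    have hp2' : |(p.2 : ℝ)| ≤ H :=
      (show |(p.2 : ℝ)| ≤ ((⌊H⌋₊ : ℕ) : ℝ) by exact_mod_cast hp2).trans hh
    have hX : ((v.1 ^ k * v.2 ^ (i + j) : ℕ) : ℝ) ≤ x ^ d :=
      monomial_le hN (by omega) hv1.2 hv2.2
    have hY : ((v.1 ^ (k + j) * v.2 ^ i : ℕ) : ℝ) ≤ x ^ d :=
      monomial_le hN (by omega) hv1.2 hv2.2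
    have hg := abs_binaryForm_le hc ((Nat.cast_le.2 hv1.2).trans hN)
      ((Nat.cast_le.2 hv2.2).trans hN)
    have habs : |(formValue d k i j c v p : ℝ)| ≤ ((d : ℝ) + 3) * H₁ * H₁ := by
      rw [formValue, affineForm]
      rw [Int.cast_add, Int.cast_add, Int.cast_mul, Int.cast_mul, Int.cast_natCast,
        Int.cast_natCast]
      calc _ ≤ |(p.1 : ℝ) * (v.1 ^ k * v.2 ^ (i + j) : ℕ)| +
            |(p.2 : ℝ) * (v.1 ^ (k + j) * v.2 ^ i : ℕ)| + |(binaryForm d c v.1 v.2 : ℝ)| :=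
            abs_add_three _ _ _
        _ ≤ H * x ^ d + H * x ^ d + ((d : ℝ) + 1) * H * x ^ d := by
            rw [abs_mul, abs_mul, Nat.abs_cast, Nat.abs_cast]
            gcongr
        _ = ((d : ℝ) + 3) * H * x ^ d := by ring
        _ ≤ _ := by
            have := hxd.trans hHH₁
            have : 0 ≤ H₁ := by linarith
            gcongr
    have hmem : (formValue d k i j c v p).natAbs ∈ range (M + 1) := by
      rw [mem_range, Nat.lt_succ_iff, hM]
      refine Nat.le_floor ?_
      rwa [Nat.cast_natAbs, Int.cast_abs]
    exact (hF _).trans ((le_abs_self _).trans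
      (single_le_sum (f := fun n => |tauGen A n|) (fun _ _ => abs_nonneg _) hmem))
  have hinner : ∀ p ∈ intBox ⌊H⌋₊, ‖∑ v ∈ Icc 1 N ×ˢ Icc 1 N,
      α v * F (formValue d k i j c v p)‖ ^ 2 ≤ (x ^ 2 * τ) ^ 2 := by
    intro p hp
    refine pow_le_pow_left₀ (norm_nonneg _) ((norm_sum_le _ _).trans ?_) 2
    calc _ ≤ ∑ v ∈ Icc 1 N ×ˢ Icc 1 N, τ := by
          refine sum_le_sum fun v hv => ?_
          rw [norm_mul]
          exact (mul_le_of_le_one_left (norm_nonneg _) (hα v)).trans (hbound p hp v hv)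
      _ = (N : ℝ) ^ 2 * τ := by simp [sq]
      _ ≤ _ := by gcongr
  refine (sum_le_sum hinner).trans ?_
  rw [sum_const, nsmul_eq_mul, intBox, card_product, card_Icc_neg_self]
  have h3 : 2 * ((⌊H⌋₊ : ℕ) : ℝ) + 1 ≤ 3 * H := by linarith [Nat.floor_le hH0.le]
  push_cast
  calc (2 * ((⌊H⌋₊ : ℕ) : ℝ) + 1) * (2 * ((⌊H⌋₊ : ℕ) : ℝ) + 1) * (x ^ 2 * τ) ^ 2
      ≤ (3 * H) * (3 * H) * (x ^ 2 * τ) ^ 2 := by gcongr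
    _ = _ := by ring

lemma natLog_two_le {n : ℕ} {H t : ℝ} (h0 : n ≠ 0) (hn : (n : ℝ) ≤ H) (hH : Real.log H ≤ t) :
    (Nat.log 2 n : ℝ) ≤ 2 * t := by
  have h1 : (2 : ℝ) ^ Nat.log 2 n ≤ H := by
    have h2 : ((2 ^ Nat.log 2 n : ℕ) : ℝ) ≤ n := Nat.cast_le.2 (Nat.pow_log_le_self 2 h0)
    push_cast at h2
    exact h2.trans hn
  have h3 := Real.log_le_log (by positivity) h1
  rw [Real.log_pow] at h3
  have h4 := Real.log_two_gt_d9
  have h5 : (Nat.log 2 n : ℝ) * (1 / 2) ≤ Nat.log 2 n * Real.log 2 := by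
    gcongr
    linarith
  linarith

set_option maxHeartbeats 1000000 in
/-- The bound when `log x` is large in terms of all the fixed parameters. -/
lemma sum_norm_sq_le_of_large {A : ℝ} (hA : 1 ≤ A) {d k l : ℕ} (hkl : k < l) (hld : l ≤ d)
    {ε C₁ C₂ H x : ℝ} (hu : Real.exp 1 ≤ Real.log x)
    (hc0 : 10 ^ 6 * 64 ^ d * ((d : ℝ) + 3) ^ 2 ≤ Real.log x ^ A)
    (hc1 : (Real.log x ^ A) ^ (200 * d ^ 3) ≤ Real.exp (Real.log x))
    (hc2 : 26 * (Real.log x ^ A) ^ (120 * d ^ 3) < Real.exp (ε * Real.log x)) (hε : 0 < ε)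
    (hc3 : (336 * d * A ^ 2 + (34 * d ^ 2 + 6 * d) * A) * Real.log (Real.log x) ^ 3 ≤
      √(Real.log x)) (hx : 1 ≤ x) (hxH : x ^ (2 * d) ≤ H)
    (hlogH : Real.log H ≤ Real.log x ^ 100) {F : ℤ → ℂ} {B : ℝ} (hB : 1 ≤ B)
    (hBA : 200 * B ^ (2 * d + 4) ≤ A) (hF : ∀ n : ℤ, ‖F n‖ ≤ tauGen B n.natAbs) {Q : Finset ℕ}
    (hQ : ∀ q ∈ Q, IsPrimePow q)
    (hQs : ∑ q ∈ Q, (q : ℝ) ^ (-(1 / (4 * (d : ℝ)))) ≤ C₁ * Real.log x ^ (-(3 * (A + 1))))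
    (hE : EquidistributedOutside F Q d x (H ^ (1 - ε) * x ^ (l - k)) (((d : ℝ) + 3) * H * x ^ d)
      (C₂ * Real.log H ^ (-(40 * A * (d : ℝ) ^ 2)))) {c : Fin (d + 1) → ℤ}
    (hc : ∀ i, |(c i : ℝ)| ≤ H) (hcc : c 0 * c (Fin.last d) ≠ 0) (α : ℕ × ℕ → ℂ)
    (hα : ∀ v, ‖α v‖ ≤ 1) {x' : ℝ} (hx1 : x / 2 ≤ x') (hx2 : x' ≤ x) :
    ∑ p ∈ intBox ⌊H⌋₊, ‖∑ v ∈ Icc 1 ⌊x'⌋₊ ×ˢ Icc 1 ⌊x'⌋₊,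
      α v * F (formValue d k (d - l) (l - k) c v p)‖ ^ 2 ≤
    (√(60 * A ^ 2 * 12 ^ ⌈A⌉₊) * √((5 / 4 + 2 * d * C₁ ^ 2) * (60 * A ^ 2 * 12 ^ ⌈A⌉₊) +
      1536 * C₂ ^ 2) + 2 * (60 * A ^ 2 * 12 ^ ⌈A⌉₊) + √(17 + 2 * C₁ ^ 2) *
      (60 * A ^ 2 * 12 ^ ⌈A⌉₊)) * (H ^ 2 * ⌊x'⌋₊ ^ 4 / Real.log x ^ A) := by
  classical
  have hd1 : 1 ≤ d := by omega
  obtain ⟨hcb1, hcb2, hcb3⟩ := pow_le_cube hd1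
  set u := Real.log x with hudef
  set Λ := u ^ A with hΛ
  set N := ⌊x'⌋₊ with hN
  set h := ⌊H⌋₊ with hh
  have hx0 : 0 < x := by linarith
  have hxu : Real.exp u = x := Real.exp_log hx0
  have hu1 : 1 ≤ u := le_trans (by linarith [Real.add_one_le_exp (1 : ℝ)]) hu
  have hu0 : 0 < u := by linarith
  have hA200 : 200 ≤ A := by
    have : 1 ≤ B ^ (2 * d + 4) := one_le_pow₀ hB
    linarith
  have hΛc : (10 : ℝ) ^ 6 ≤ Λ := by
    refine le_trans ?_ hc0
    have h1 : (1 : ℝ) ≤ 64 ^ d := one_le_pow₀ (by norm_num)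
    have h2 : (1 : ℝ) ≤ ((d : ℝ) + 3) ^ 2 := one_le_pow₀ (by linarith [d.cast_nonneg (α := ℝ)])
    rw [mul_assoc]
    exact le_mul_of_one_le_right (by norm_num) (one_le_mul_of_one_le_of_one_le h1 h2)
  have hΛ1 : 1 ≤ Λ := by norm_num at hΛc; linarith
  have hΛ0 : 0 < Λ := by linarith
  have huΛ : u ^ 100 ≤ Λ := by
    rw [hΛ, ← Real.rpow_natCast]
    refine Real.rpow_le_rpow_of_exponent_le hu1 ?_
    push_cast
    linarith
  have huΛ1 : u ≤ Λ := (le_self_pow₀ hu1 (by norm_num)).trans huΛ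
  rw [hxu] at hc1
  have hxΛ : Λ ≤ x := (le_self_pow₀ hΛ1 (by omega)).trans hc1
  have hNx : (N : ℝ) ≤ x := (Nat.floor_le (by linarith)).trans hx2
  have hxN : x ≤ 4 * N := by
    have h1 : x' - 1 ≤ N := (Nat.sub_one_lt_floor x').le
    norm_num at hΛc
    linarith
  have hN1 : 1 ≤ N := by
    have : (0 : ℝ) < N := by linarith
    exact_mod_cast this
  have S : Scale d (l - k) Λ x H N := ⟨by omega, by omega, hc0, hc1, hxN, hNx, hxH⟩
  have hH0 := S.H_pos
  have hH1 := S.one_le_H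
  have hxH1 : x ≤ H := (le_self_pow₀ hx (by omega)).trans hxH
  have hulogH : u ≤ Real.log H := Real.log_le_log hx0 hxH1
  have hL : H ^ (1 - ε) * x ^ (l - k) * (26 * Λ ^ (120 * d ^ 3)) < H * x ^ (l - k) := by
    have h1 : Real.exp (ε * u) ≤ H ^ ε := by
      rw [mul_comm, Real.exp_mul, hxu]
      exact Real.rpow_le_rpow hx0.le hxH1 hε.le
    have h2 : H ^ (1 - ε) * H ^ ε = H := by
      rw [← Real.rpow_add hH0, sub_add_cancel, Real.rpow_one]
    calc _ = H ^ (1 - ε) * (26 * Λ ^ (120 * d ^ 3)) * x ^ (l - k) := by ring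
      _ < H ^ (1 - ε) * H ^ ε * x ^ (l - k) := by
          have := hc2.trans_le h1
          gcongr
      _ = _ := by rw [h2]
  have Sh : ShiftLengths d (l - k) Λ x H (H ^ (1 - ε) * x ^ (l - k)) ⌊H / Λ ^ 3⌋₊
      ⌊(⌊H / Λ ^ 3⌋₊ : ℝ) / x ^ (l - k)⌋₊ ⌊H * x ^ (l - k) / (13 * Λ ^ (120 * d ^ 3))⌋₊ :=
    ⟨rfl, rfl, rfl, hL⟩
  set M := ⌊((d : ℝ) + 3) * H * x ^ d⌋₊ with hM
  set P := 60 * B ^ 2 * H ^ 2 * (1 + Real.log M) ^ ⌈B ^ 4⌉₊ with hP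
  have D : MomentData F d x H B P h ⌈B ^ 4⌉₊ M := ⟨hB, hF, Nat.le_ceil _, rfl, rfl, rfl⟩
  have hlogN0 : 0 ≤ Real.log N := Real.log_nonneg (by exact_mod_cast hN1)
  have hlogN : 1 + Real.log N ≤ 2 * u := by
    have : Real.log N ≤ u := Real.log_le_log (by exact_mod_cast hN1) hNx
    linarith
  have hM1 := D.one_le_M S
  have hlogM0 : 0 ≤ Real.log M := Real.log_nonneg (by exact_mod_cast hM1)
  have hlogM : 1 + Real.log M ≤ 3 * u ^ 100 := by
    have h1 : (M : ℝ) ≤ H ^ 2 :=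
      (D.M_le S).trans (div_le_self (sq_nonneg _) (one_le_pow₀ hΛ1))
    have h2 := Real.log_le_log (by exact_mod_cast hM1) h1
    rw [Real.log_pow] at h2
    push_cast at h2
    have h3 : 1 ≤ u ^ 100 := one_le_pow₀ hu1
    linarith
  have hQC : ∑ q ∈ Q, (q : ℝ) ^ (-(1 / (4 * (d : ℝ)))) ≤ |C₁| / Λ ^ 3 := by
    refine hQs.trans ?_
    calc C₁ * u ^ (-(3 * (A + 1))) ≤ |C₁| * u ^ (-(3 * (A + 1))) := by
          gcongr
          exact le_abs_self _
      _ ≤ |C₁| * u ^ (-(A * 3)) := by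
          refine mul_le_mul_of_nonneg_left (Real.rpow_le_rpow_of_exponent_le hu1 ?_) (abs_nonneg _)
          linarith
      _ = |C₁| / Λ ^ 3 := by
          rw [Real.rpow_neg hu0.le, hΛ, ← Real.rpow_natCast, ← Real.rpow_mul hu0.le]
          norm_num
          rfl
  set κ : ℝ := (1 + 2 * d * C₁ ^ 2) * (N ^ 2 / Λ ^ 6) with hκ
  have hκ1 : (N : ℝ) ^ 2 / Λ ^ 6 ≤ κ := by
    rw [hκ]
    refine le_mul_of_one_le_left (by positivity) ?_
    have : 0 ≤ 2 * d * C₁ ^ 2 := by positivity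
    linarith
  have hκQ : ∀ q ∈ Q, 2 * d * (N : ℝ) ^ 2 * (q : ℝ) ^ (-(1 / (2 * (d : ℝ)))) ≤ κ := by
    intro q hq
    have h1 : (q : ℝ) ^ (-(1 / (4 * (d : ℝ)))) ≤ |C₁| / Λ ^ 3 :=
      (single_le_sum (f := fun q : ℕ => (q : ℝ) ^ (-(1 / (4 * (d : ℝ)))))
        (fun q _ => by positivity) hq).trans hQC
    have h2 : (q : ℝ) ^ (-(1 / (2 * (d : ℝ)))) = ((q : ℝ) ^ (-(1 / (4 * (d : ℝ))))) ^ 2 := by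
      rw [← Real.rpow_natCast, ← Real.rpow_mul q.cast_nonneg]
      congr 1
      have : (d : ℝ) ≠ 0 := by positivity
      push_cast
      field_simp
      norm_num
    rw [h2]
    calc _ ≤ 2 * d * (N : ℝ) ^ 2 * (|C₁| / Λ ^ 3) ^ 2 := by gcongr
      _ = 2 * d * C₁ ^ 2 * (N ^ 2 / Λ ^ 6) := by rw [div_pow, sq_abs, ← pow_mul]; ring
      _ ≤ κ := by
          rw [hκ]
          gcongr
          linarith
  have hR : Λ ^ 7 ≤ (⌈Λ ^ 7⌉₊ : ℝ) := Nat.le_ceil _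
  have hν : Λ ^ 8 ≤ (2 : ℝ) ^ Nat.clog 2 ⌈Λ ^ 8⌉₊ := by
    refine (Nat.le_ceil _).trans ?_
    exact_mod_cast Nat.le_pow_clog (by norm_num) _
  set y : ℝ := (⌈Λ ^ 7⌉₊ : ℝ) ^ (3 * Nat.clog 2 ⌈Λ ^ 8⌉₊) with hy
  have hy1 : 1 ≤ y := one_le_pow₀ ((one_le_pow₀ hΛ1).trans hR)
  have hyx : y ^ d * Λ ^ (34 * d ^ 2 + 6 * d) ≤ gcdThreshold x :=
    threshold_bound hA d hu hΛ hΛc hc3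
  have hlogc : ∀ i, (Nat.log 2 (c i).natAbs : ℝ) ≤ 2 * Λ := by
    intro i
    rcases Nat.eq_zero_or_pos (c i).natAbs with h0 | h0
    · rw [h0]; simp; linarith
    refine natLog_two_le h0.ne' ?_ (hlogH.trans huΛ)
    have := hc i
    rwa [Nat.cast_natAbs, Int.cast_abs]
  set bad := (Icc 1 N ×ˢ Icc 1 N).filter fun v =>
    ¬ GenericPair Q d k (d - l) (l - k) c Λ y N v with hbad
  have hbadc : (#bad : ℝ) ≤ (17 + 2 * C₁ ^ 2) * (N ^ 2 / Λ ^ 6) := by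
    have := card_not_genericPair_le hQ S (k := k) (i := d - l) (by omega) (c := c)
      (left_ne_zero_of_mul hcc) (right_ne_zero_of_mul hcc) hQC (by linarith) (hlogc _) (hlogc _)
      hR hν
    rw [sq_abs] at this
    convert this
  have hJ : 1536 * (N : ℝ) ^ 2 * H ^ 2 * Λ ^ (28 * d ^ 2) *
      (C₂ * Real.log H ^ (-(40 * A * (d : ℝ) ^ 2))) ^ 2 ≤
      1536 * C₂ ^ 2 * (N ^ 2 * H ^ 2 / Λ ^ 4) := by
    have h1 : Real.log H ^ (-(40 * A * (d : ℝ) ^ 2)) ≤ 1 / Λ ^ (40 * d ^ 2) := by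
      calc _ ≤ u ^ (-(40 * A * (d : ℝ) ^ 2)) :=
            Real.rpow_le_rpow_of_nonpos hu0 hulogH (by
              have : 0 ≤ 40 * A * (d : ℝ) ^ 2 := by positivity
              linarith)
        _ = _ := by
            rw [Real.rpow_neg hu0.le, hΛ, ← Real.rpow_natCast (u ^ A), ← Real.rpow_mul hu0.le, one_div]
            congr 2
            push_cast
            ring
    have h2 : 0 ≤ Real.log H ^ (-(40 * A * (d : ℝ) ^ 2)) :=
      Real.rpow_nonneg (by linarith) _
    have h3 : Λ ^ (28 * d ^ 2) * (1 / Λ ^ (40 * d ^ 2)) ^ 2 ≤ 1 / Λ ^ 4 := by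
      rw [div_pow, one_pow, ← pow_mul, mul_one_div, div_le_div_iff₀ (by positivity) (by positivity),
        ← pow_add, one_mul]
      refine pow_le_pow_right₀ hΛ1 ?_
      have : 1 ≤ d ^ 2 := Nat.one_le_pow _ _ hd1
      omega
    calc _ = 1536 * C₂ ^ 2 * (N ^ 2 * H ^ 2) * (Λ ^ (28 * d ^ 2) *
          (Real.log H ^ (-(40 * A * (d : ℝ) ^ 2))) ^ 2) := by ring
      _ ≤ 1536 * C₂ ^ 2 * (N ^ 2 * H ^ 2) * (Λ ^ (28 * d ^ 2) * (1 / Λ ^ (40 * d ^ 2)) ^ 2) := by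
          gcongr
      _ ≤ 1536 * C₂ ^ 2 * (N ^ 2 * H ^ 2) * (1 / Λ ^ 4) := by gcongr
      _ = _ := by ring
  have hA0 : 0 ≤ A := by linarith
  exact sum_norm_sq_formValue_le S Sh D hQ hE (by omega) hc hκ1 hκQ hy1 hyx
    (sum_tauGen_sq_monomial_le hB (by omega) (Nat.le_ceil _) hN1) (by positivity) (by positivity)
    (by positivity) (by positivity)
    (moment_product_le hA hd1 hB hBA hu1 hΛ hlogM0 hlogM hlogN0 hlogN)
    (le_of_eq (by rw [hκ]; field_simp; ring)) hJ
    (fun v hv hvb => by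
      by_contra hg
      exact hvb (mem_filter.2 ⟨hv, hg⟩)) (filter_subset _ _) hbadc α hα

theorem mainTheorem5 (A : ℝ) (hA : 1 ≤ A) (d : ℕ) :
    ∃ H₀ : ℝ, ∀ ε : ℝ, 0 < ε → ∀ k l : ℕ, k < l → l ≤ d → ∀ C₁ C₂ : ℝ,
      ∃ C : ℝ, ∀ H x : ℝ, H₀ ≤ H →
        Real.exp (Real.log H ^ (1 / 100 : ℝ)) ≤ x → x ≤ H ^ (1 / (2 * (d : ℝ))) →
        ∀ F : ℤ → ℂ,
          (∃ B : ℝ, 1 ≤ B ∧ 200 * B ^ (2 * d + 4) ≤ A ∧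
            ∀ n : ℤ, ‖F n‖ ≤ tauGen B n.natAbs) →
          (∃ Q : Finset ℕ,
            (∀ q ∈ Q, IsPrimePow q ∧ (q : ℝ) ≤ x ^ d) ∧
            ∑ q ∈ Q, (q : ℝ) ^ (-(1 / (4 * (d : ℝ)))) ≤ C₁ * Real.log x ^ (-(3 * (A + 1))) ∧
            EquidistributedOutside F Q d x (H ^ (1 - ε) * x ^ (l - k))
              (((d : ℝ) + 3) * H * x ^ d) (C₂ * Real.log H ^ (-(40 * A * (d : ℝ) ^ 2)))) →
          ∀ c : Fin (d + 1) → ℤ, (∀ i, |(c i : ℝ)| ≤ H) → c 0 * c (Fin.last d) ≠ 0 →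
            ∀ α : ℕ → ℕ → ℂ, (∀ m n, ‖α m n‖ ≤ 1) →
              ∀ x' : ℝ, x / 2 ≤ x' → x' ≤ x →
                ∑ a ∈ Finset.Icc (-⌊H⌋) ⌊H⌋, ∑ b ∈ Finset.Icc (-⌊H⌋) ⌊H⌋,
                  ‖∑ m ∈ Finset.Icc 1 ⌊x'⌋₊, ∑ n ∈ Finset.Icc 1 ⌊x'⌋₊,
                    α m n * F (a * (m : ℤ) ^ k * (n : ℤ) ^ (d - k)
                      + b * (m : ℤ) ^ l * (n : ℤ) ^ (d - l)
                      + binaryForm d c m n)‖ ^ 2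
                  ≤ C * H ^ 2 * x ^ 4 * Real.log x ^ (-A) := by
  -- `H ≥ 3` ensures `log H ≥ 1`
  refine ⟨3, fun ε hε k l hkl hld C₁ C₂ => ?_⟩
  have hd1 : 1 ≤ d := by omega
  obtain ⟨u₀, hu₀⟩ := Filter.eventually_atTop.1 (eventually_logarithmic_conditions A ε
    (10 ^ 6 * 64 ^ d * ((d : ℝ) + 3) ^ 2) (336 * d * A ^ 2 + (34 * d ^ 2 + 6 * d) * A)
    (by linarith) hε (200 * d ^ 3) (120 * d ^ 3))
  -- below `H₁` the trivial bound is used; above it `log x` exceeds `u₁`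
  set u₁ : ℝ := max u₀ (Real.exp 1) with hu₁
  have hu₁0 : 0 < u₁ := (Real.exp_pos 1).trans_le (le_max_right _ _)
  set H₁ : ℝ := Real.exp (u₁ ^ 100) with hH₁
  obtain ⟨C₃, hC₃, hsmall⟩ := sum_norm_sq_le_of_bounded A hd1 H₁
  obtain ⟨C₄, hC₄⟩ : ∃ C₄, C₄ = √(60 * A ^ 2 * 12 ^ ⌈A⌉₊) * √((5 / 4 + 2 * d * C₁ ^ 2) *
      (60 * A ^ 2 * 12 ^ ⌈A⌉₊) + 1536 * C₂ ^ 2) + 2 * (60 * A ^ 2 * 12 ^ ⌈A⌉₊) +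
      √(17 + 2 * C₁ ^ 2) * (60 * A ^ 2 * 12 ^ ⌈A⌉₊) := ⟨_, rfl⟩
  have hC₄0 : 0 ≤ C₄ := by rw [hC₄]; positivity
  refine ⟨max (C₃ * (u₁ ^ 100) ^ A) C₄, fun H x hH hxl hxr F ⟨B, hB, hBA, hF⟩
    ⟨Q, hQ, hQs, hE⟩ c hc hcc α hα x' hx1 hx2 => ?_⟩
  have hH0 : 0 < H := by linarith
  have hlogH1 : 1 ≤ Real.log H := by
    rw [Real.le_log_iff_exp_le hH0]
    linarith [Real.exp_one_lt_d9]
  have hx0 : 0 < x := (Real.exp_pos _).trans_le hxl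
  have hlx : Real.log H ^ (1 / 100 : ℝ) ≤ Real.log x := (Real.le_log_iff_exp_le hx0).2 hxl
  have hlx1 : 1 ≤ Real.log x :=
    (Real.one_le_rpow hlogH1 (by norm_num)).trans hlx
  have hx1' : 1 ≤ x := by
    by_contra hc
    have := Real.log_nonpos hx0.le (not_le.1 hc).le
    linarith
  have hlogH : Real.log H ≤ Real.log x ^ 100 := by
    calc Real.log H = (Real.log H ^ (1 / 100 : ℝ)) ^ 100 := by
          rw [← Real.rpow_natCast, ← Real.rpow_mul (by linarith)]
          norm_num
      _ ≤ _ := by gcongr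
  have hxH : x ^ (2 * d) ≤ H := by
    calc x ^ (2 * d) ≤ (H ^ (1 / (2 * (d : ℝ)))) ^ (2 * d) := by gcongr
      _ = H := by
          rw [← Real.rpow_natCast, ← Real.rpow_mul hH0.le]
          have : (d : ℝ) ≠ 0 := by positivity
          push_cast
          rw [one_div_mul_cancel (by positivity), Real.rpow_one]
  have hN : (⌊x'⌋₊ : ℝ) ≤ x := (Nat.floor_le (by linarith)).trans hx2
  rw [sum_eq_sum_formValue F hkl hld c α hH0.le]
  have hrhs : max (C₃ * (u₁ ^ 100) ^ A) C₄ * H ^ 2 * x ^ 4 * Real.log x ^ (-A) =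
      max (C₃ * (u₁ ^ 100) ^ A) C₄ / Real.log x ^ A * (H ^ 2 * x ^ 4) := by
    rw [Real.rpow_neg (by linarith)]
    ring
  have hlxA : 0 < Real.log x ^ A := Real.rpow_pos_of_pos (by linarith) A
  rw [hrhs]
  rcases le_total H H₁ with hHH₁ | hHH₁
  · have hBA' : B ≤ A := by
      have h1 : B ≤ B ^ (2 * d + 4) := le_self_pow₀ hB (by omega)
      linarith
    refine (hsmall H x (by linarith) hHH₁ hx1' hxH F
      (fun n => (hF n).trans (tauGen_mono_left (by linarith) hBA' _)) k (d - l) (l - k) (by omega)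
      c hc (fun v => α v.1 v.2) (fun v => hα _ _) _ hN).trans ?_
    refine mul_le_mul_of_nonneg_right ?_ (by positivity)
    rw [le_div_iff₀ hlxA]
    refine le_trans ?_ (le_max_left _ _)
    have hxH1 : x ≤ H := (le_self_pow₀ hx1' (by omega)).trans hxH
    have h1 : Real.log x ≤ u₁ ^ 100 := by
      rw [Real.log_le_iff_le_exp hx0]
      exact hxH1.trans hHH₁
    gcongr
  · have hu₁x : u₁ ≤ Real.log x := by
      have h1 : u₁ ^ 100 ≤ Real.log H := (Real.le_log_iff_exp_le hH0).2 hHH₁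
      exact le_of_pow_le_pow_left₀ (by norm_num) (by linarith) (h1.trans hlogH)
    obtain ⟨g1, g2, g3, g4⟩ := hu₀ (Real.log x) ((le_max_left _ _).trans hu₁x)
    refine (sum_norm_sq_le_of_large hA hkl hld ((le_max_right _ _).trans hu₁x) g1 g2 g3 hε g4 hx1'
      hxH hlogH hB hBA hF (fun q hq => (hQ q hq).1) hQs hE hc hcc (fun v => α v.1 v.2)
      (fun v => hα _ _) hx1 hx2).trans ?_
    rw [← hC₄]
    calc C₄ * (H ^ 2 * (⌊x'⌋₊ : ℝ) ^ 4 / Real.log x ^ A)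
        ≤ C₄ * (H ^ 2 * x ^ 4 / Real.log x ^ A) := by gcongr
      _ = C₄ / Real.log x ^ A * (H ^ 2 * x ^ 4) := by ring
      _ ≤ _ := by
          gcongr
          exact le_max_right _ _
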